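/- Let $k$ be a field with separable closure $k_s$, and let $\mathrm{Gal}(k)=\mathrm{Gal}(k_s/k)$ be its absolute Galois group with the Krull (profinite) topology, regarded as a topological groupoid with one object. Let $\mathbf{Vect}^k$ be the symmetric monoidal category of $k$-vector spaces. For a small groupoid $G$: * Let ${}^G\mathbf{Vect}^k$ be the category of functors $G\to\mathbf{Vect}^k$ with the pointwise tensor product, and $c_G:\mathbf{Vect}^k\to{}^G\mathbf{Vect}^k$ the functor sending a vector space to the constant functor. Let $\pi_1(\mathbf{Vect}^k)(G)$ be the category of morphisms ${}^G\mathbf{Vect}^k\to\mathbf{Vect}^k$ of commutative $\mathbf{Vect}^k$-2-algebras. Its objects are the pairs $(h,\zeta)$ of a (strong) symmetric monoidal functor $h:{}^G\mathbf{Vect}^k\to\mathbf{Vect}^k$ preserving small colimits and a monoidal natural isomorphism $\zeta:\mathrm{id}\cong h\circ c_G$. Its morphisms $(h,\zeta)\to(h',\zeta')$ are the monoidal natural transformations $\xi:h\to h'$ with $(\xi c_G)\circ\zeta=\zeta'$. By precomposition this defines a (pseudo)functor $\pi_1(\mathbf{Vect}^k)$ from the 2-category of small groupoids, functors and natural transformations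 to categories. * Let $\mathrm{Hom}_{\mathrm{cts}}(\mathrm{Gal}(k),G)$ be the groupoid of functors $\mathrm{Gal}(k)\to G$ whose action on arrows is continuous for the discrete topology on $G$, with all natural transformations between them. * A right $G$-torsor in $\mathbf{Vect}^k$ is a cocommutative (counital, coassociative) coalgebra $y$ in the symmetric monoidal category of functors $G^{\mathrm{op}}\to\mathbf{Vect}^k$ (with pointwise tensor product) such that (a) for all objects $s,t$ of $G$ with $\mathrm{Hom}_G(s,t)\neq\emptyset$, the map $\bigoplus_{g:s\to t}y(t)\to y(t)\otimes y(s)$ given on the summand of $g$ by $(\mathrm{id}\otimes y(g))\circ\Delta_{y(t)}$ is an isomorphism, and (b) the counit $y\to k$ (to the constant functor) exhibits $k$ as the colimit of $y$. Morphisms of torsors are the morphisms of coalgebras in functors $G^{\mathrm{op}}\to\mathbf{Vect}^k$. Then $\pi_1(\mathbf{Vect}^k)$ is represented by $\mathrm{Gal}(k)$, with no finiteness restriction: 1. There is a pseudonatural equivalence $$\mathrm{Hom}_{\mathrm{cts}}(\mathrm{Gal}(k),-)\;\simeq\;\pi_1(\mathbf{Vect}^k)$$ of 2-functors on small groupoids;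 that is, a pseudonatural transformation whose component at every small groupoid $G$ is an equivalence of categories $\mathrm{Hom}_{\mathrm{cts}}(\mathrm{Gal}(k),G)\simeq\pi_1(\mathbf{Vect}^k)(G)$. 2. For every small groupoid $G$, the category of right $G$-torsors in $\mathbf{Vect}^k$ is a groupoid, and it is equivalent to $\mathrm{Hom}_{\mathrm{cts}}(\mathrm{Gal}(k),G)$. -/

import Mathlib

open CategoryTheory CategoryTheory.Limits MonoidalCategory

noncomputable section

universe u

namespace TwoRing

section Homs

variable (A B C D : Type (u + 1)) [Category.{u} A] [MonoidalCategory A] [SymmetricCategory A]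
  [Category.{u} B] [MonoidalCategory B] [SymmetricCategory B]
  [Category.{u} C] [MonoidalCategory C] [SymmetricCategory C]
  [Category.{u} D] [MonoidalCategory D] [SymmetricCategory D]

/-- A commutative 2-ring is a presentable symmetric monoidal category whose tensor product
preserves small colimits in each variable; the definitions below make sense for all symmetric
monoidal categories, and are used for categories of modules.

A 1-morphism of commutative 2-rings: a functor that preserves all small colimits, equipped
with a (strong) symmetric monoidal structure. -/
structure Com2RingHom where
  /-- The underlying functor. -/
  functor : A ⥤ B
  [braided : functor.Braided]
  [cocontinuous : PreservesColimitsOfSize.{u, u} functor]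

attribute [instance] Com2RingHom.braided Com2RingHom.cocontinuous

variable {A B C D}

/-- A 2-morphism of commutative 2-rings: a monoidal natural transformation. -/
@[ext]
structure Com2RingHom.Hom (F G : Com2RingHom A B) where
  /-- The underlying natural transformation. -/
  hom : F.functor ⟶ G.functor
  [isMonoidal : NatTrans.IsMonoidal hom]

attribute [instance] Com2RingHom.Hom.isMonoidal

instance : Category (Com2RingHom A B) where
  Hom F G := Com2RingHom.Hom F G
  id F := { hom := 𝟙 F.functor }
  comp σ τ := { hom := σ.hom ≫ τ.hom }

@[ext]
theorem Com2RingHom.hom_ext {F G : Com2RingHom A B} {σ τ : F ⟶ G} (h : σ.hom = τ.hom) : σ = τ :=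
  Com2RingHom.Hom.ext h

@[simp]
theorem Com2RingHom.id_hom (F : Com2RingHom A B) :
    Com2RingHom.Hom.hom (𝟙 F) = 𝟙 F.functor := rfl

@[simp]
theorem Com2RingHom.comp_hom {F G H : Com2RingHom A B} (σ : F ⟶ G) (τ : G ⟶ H) :
    (σ ≫ τ).hom = σ.hom ≫ τ.hom := rfl

/-- The 2-isomorphism given by an invertible monoidal natural transformation. -/
@[simps]
def Com2RingHom.isoMk {F G : Com2RingHom A B} (e : F.functor ≅ G.functor)
    (_ : NatTrans.IsMonoidal e.hom) : F ≅ G where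
  hom := { hom := e.hom }
  inv := { hom := e.inv }

variable (A) in
/-- The identity 1-morphism. -/
abbrev Com2RingHom.id : Com2RingHom A A where
  functor := 𝟭 A

/-- Composition of 1-morphisms, in diagrammatic order. -/
abbrev Com2RingHom.comp (F : Com2RingHom A B) (G : Com2RingHom B C) : Com2RingHom A C where
  functor := F.functor ⋙ G.functor

/-- Whiskering a 2-morphism with a 1-morphism on the left. -/
@[simps]
def Com2RingHom.whiskerLeft (F : Com2RingHom A B) {G H : Com2RingHom B C} (τ : G ⟶ H) :
    F.comp G ⟶ F.comp H where
  hom := Functor.whiskerLeft F.functor τ.hom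
  isMonoidal := NatTrans.IsMonoidal.whiskerLeft _

/-- Whiskering a 2-morphism with a 1-morphism on the right. -/
@[simps]
def Com2RingHom.whiskerRight {F G : Com2RingHom A B} (τ : F ⟶ G) (H : Com2RingHom B C) :
    F.comp H ⟶ G.comp H where
  hom := Functor.whiskerRight τ.hom H.functor
  isMonoidal := NatTrans.IsMonoidal.whiskerRight _

/-- Whiskering a 2-isomorphism with a 1-morphism on the right. -/
@[simps]
def Com2RingHom.whiskerRightIso {F G : Com2RingHom A B} (e : F ≅ G) (H : Com2RingHom B C) :
    F.comp H ≅ G.comp H where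
  hom := Com2RingHom.whiskerRight e.hom H
  inv := Com2RingHom.whiskerRight e.inv H
  hom_inv_id := by
    ext a
    have h := congr_arg (fun τ => H.functor.map (τ.hom.app a)) e.hom_inv_id
    exact (H.functor.map_comp _ _).symm.trans (h.trans (H.functor.map_id _))
  inv_hom_id := by
    ext a
    have h := congr_arg (fun τ => H.functor.map (τ.hom.app a)) e.inv_hom_id
    exact (H.functor.map_comp _ _).symm.trans (h.trans (H.functor.map_id _))

/-- Composition of 1-morphisms is associative. -/
def Com2RingHom.associator (F : Com2RingHom A B) (G : Com2RingHom B C) (H : Com2RingHom C D) :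
    (F.comp G).comp H ≅ F.comp (G.comp H) :=
  Com2RingHom.isoMk (Functor.associator F.functor G.functor H.functor) inferInstance

end Homs

section Algebras

variable {A B C D : Type (u + 1)} [Category.{u} A] [MonoidalCategory A] [SymmetricCategory A]
  [Category.{u} B] [MonoidalCategory B] [SymmetricCategory B]
  [Category.{u} C] [MonoidalCategory C] [SymmetricCategory C]
  [Category.{u} D] [MonoidalCategory D] [SymmetricCategory D]

/-- A commutative `A`-2-algebra is a 1-morphism of commutative 2-rings with source `A`.
A 1-morphism of commutative `A`-2-algebras from `f : A → B` to `g : A → C` is a 1-morphism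
`h : B → C` of commutative 2-rings together with a 2-isomorphism `ζ : g ≅ h ∘ f`. -/
structure Com2AlgHom (f : Com2RingHom A B) (g : Com2RingHom A C) where
  /-- The underlying 1-morphism of commutative 2-rings. -/
  hom : Com2RingHom B C
  /-- The compatibility with the structure morphisms. -/
  unit : g ≅ f.comp hom

/-- A 2-morphism of commutative `A`-2-algebras from `(h, ζ)` to `(h', ζ')` is a 2-morphism
`ξ : h ⟶ h'` of commutative 2-rings such that `ζ' = (ξ . f) ζ`. -/
@[ext]
structure Com2AlgHom.Hom {f : Com2RingHom A B} {g : Com2RingHom A C} (h h' : Com2AlgHom f g) where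
  /-- The underlying 2-morphism of commutative 2-rings. -/
  hom : h.hom ⟶ h'.hom
  w : h.unit.hom ≫ f.whiskerLeft hom = h'.unit.hom

instance (f : Com2RingHom A B) (g : Com2RingHom A C) : Category (Com2AlgHom f g) where
  Hom h h' := Com2AlgHom.Hom h h'
  id h := { hom := 𝟙 h.hom, w := by ext a; exact Category.comp_id (h.unit.hom.hom.app a) }
  comp σ τ :=
    { hom := σ.hom ≫ τ.hom
      w := by
        rw [← τ.w, ← σ.w]
        ext a
        exact (Category.assoc _ (σ.hom.hom.app (f.functor.obj a))
          (τ.hom.hom.app (f.functor.obj a))).symm }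

@[ext]
theorem Com2AlgHom.hom_ext {f : Com2RingHom A B} {g : Com2RingHom A C} {h h' : Com2AlgHom f g}
    {σ τ : h ⟶ h'} (e : σ.hom = τ.hom) : σ = τ :=
  Com2AlgHom.Hom.ext e

@[simp]
theorem Com2AlgHom.id_hom {f : Com2RingHom A B} {g : Com2RingHom A C} (h : Com2AlgHom f g) :
    Com2AlgHom.Hom.hom (𝟙 h) = 𝟙 h.hom := rfl

@[simp]
theorem Com2AlgHom.comp_hom {f : Com2RingHom A B} {g : Com2RingHom A C} {h h' h'' : Com2AlgHom f g}
    (σ : h ⟶ h') (τ : h' ⟶ h'') : (σ ≫ τ).hom = σ.hom ≫ τ.hom := rfl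

/-- The 2-isomorphism of algebra morphisms given by a compatible 2-isomorphism of 2-rings. -/
@[simps]
def Com2AlgHom.isoMk {f : Com2RingHom A B} {g : Com2RingHom A C} {h h' : Com2AlgHom f g}
    (e : h.hom ≅ h'.hom) (w : h.unit.hom ≫ f.whiskerLeft e.hom = h'.unit.hom) : h ≅ h' where
  hom := { hom := e.hom, w := w }
  inv :=
    { hom := e.inv
      w := by
        have e' : f.whiskerLeft e.hom ≫ f.whiskerLeft e.inv = 𝟙 _ := by
          ext a
          exact congr_arg (fun τ => τ.hom.app (f.functor.obj a)) e.hom_inv_id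
        rw [← w, Category.assoc, e', Category.comp_id] }

/-- Composition of 1-morphisms of commutative `A`-2-algebras, in diagrammatic order. -/
def Com2AlgHom.comp {f : Com2RingHom A B} {g : Com2RingHom A C} {p : Com2RingHom A D}
    (h : Com2AlgHom f g) (h' : Com2AlgHom g p) : Com2AlgHom f p where
  hom := h.hom.comp h'.hom
  unit := h'.unit ≪≫ Com2RingHom.whiskerRightIso h.unit h'.hom ≪≫
    Com2RingHom.associator f h.hom h'.hom

theorem Com2AlgHom.comp_unit_hom_app {f : Com2RingHom A B} {g : Com2RingHom A C}
    {p : Com2RingHom A D} (h : Com2AlgHom f g) (h' : Com2AlgHom g p) (a : A) :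
    (h.comp h').unit.hom.hom.app a =
      h'.unit.hom.hom.app a ≫ h'.hom.functor.map (h.unit.hom.hom.app a) :=
  congr_arg (h'.unit.hom.hom.app a ≫ ·) (Category.comp_id _)

/-- Whiskering a 2-morphism of algebras with a 1-morphism on the left. -/
def Com2AlgHom.whiskerLeft {f : Com2RingHom A B} {g : Com2RingHom A C} {p : Com2RingHom A D}
    (h : Com2AlgHom f g) {h₁ h₂ : Com2AlgHom g p} (τ : h₁ ⟶ h₂) : h.comp h₁ ⟶ h.comp h₂ where
  hom := h.hom.whiskerLeft τ.hom
  w := by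
    ext a
    have e : h₁.unit.hom.hom.app a ≫ τ.hom.hom.app (g.functor.obj a) = h₂.unit.hom.hom.app a :=
      congr_arg (fun σ => σ.hom.app a) τ.w
    rw [Com2AlgHom.comp_unit_hom_app, ← e]
    refine (congr_arg (· ≫ _) (Com2AlgHom.comp_unit_hom_app h h₁ a)).trans ?_
    exact (Category.assoc _ _ _).trans ((congr_arg (_ ≫ ·)
      (τ.hom.hom.naturality (h.unit.hom.hom.app a))).trans (Category.assoc _ _ _).symm)

/-- Whiskering a 2-morphism of algebras with a 1-morphism on the right. -/
def Com2AlgHom.whiskerRight {f : Com2RingHom A B} {g : Com2RingHom A C} {p : Com2RingHom A D}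
    {h₁ h₂ : Com2AlgHom f g} (τ : h₁ ⟶ h₂) (h : Com2AlgHom g p) : h₁.comp h ⟶ h₂.comp h where
  hom := Com2RingHom.whiskerRight τ.hom h.hom
  w := by
    ext a
    have e : h₁.unit.hom.hom.app a ≫ τ.hom.hom.app (f.functor.obj a) = h₂.unit.hom.hom.app a :=
      congr_arg (fun σ => σ.hom.app a) τ.w
    rw [Com2AlgHom.comp_unit_hom_app, ← e]
    refine (congr_arg (· ≫ _) (Com2AlgHom.comp_unit_hom_app h₁ h a)).trans ?_
    exact (Category.assoc _ _ _).trans (congr_arg (_ ≫ ·) (h.hom.functor.map_comp _ _).symm)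

end Algebras

section PiOne

variable (A : Type (u + 1)) [Category.{u} A] [MonoidalCategory A] [SymmetricCategory A]

/-- The structure morphism `A → ᴳA` of the commutative `A`-2-algebra `ᴳA` of functors `G ⥤ A` with
pointwise tensor product. -/
instance constMonoidal (G : Type u) [Category.{u} G] : (Functor.const G (C := A)).Monoidal :=
  Functor.CoreMonoidal.toMonoidal
    { εIso := Iso.refl _
      μIso := fun a b => NatIso.ofComponents (fun _ => Iso.refl _) (fun _ => by simp)
      μIso_hom_natural_left := fun f b => by
        ext g; exact (Category.comp_id _).trans (Category.id_comp _).symm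
      μIso_hom_natural_right := fun f b => by
        ext g; exact (Category.comp_id _).trans (Category.id_comp _).symm
      associativity := fun a b c => by
        ext g
        change 𝟙 _ ▷ c ≫ 𝟙 _ ≫ _ = _ ≫ a ◁ 𝟙 _ ≫ 𝟙 _
        simp
      left_unitality := fun a => by
        ext g
        change _ = 𝟙 _ ▷ a ≫ 𝟙 _ ≫ _
        simp
      right_unitality := fun a => by
        ext g
        change _ = a ◁ 𝟙 _ ≫ 𝟙 _ ≫ _
        simp }

instance constBraided (G : Type u) [Category.{u} G] : (Functor.const G (C := A)).Braided where
  braided a b := by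
    ext g
    exact (Category.id_comp (β_ a b).hom).trans (Category.comp_id (β_ a b).hom).symm

/-- The structure morphism `A → ᴳA` of the commutative `A`-2-algebra `ᴳA` of functors `G ⥤ A`,
with the pointwise tensor product. -/
abbrev constHom (G : Type u) [Category.{u} G] : Com2RingHom A (G ⥤ A) where
  functor := Functor.const G

variable {G H K : Type u} [Category.{u} G] [Category.{u} H] [Category.{u} K]

instance whiskeringLeftBraided (F : G ⥤ H) : ((Functor.whiskeringLeft G H A).obj F).Braided where
  braided a b := by
    ext g
    exact (Category.id_comp (β_ (a.obj (F.obj g)) (b.obj (F.obj g))).hom).trans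
      (Category.comp_id (β_ (a.obj (F.obj g)) (b.obj (F.obj g))).hom).symm

/-- Constant functors are stable under precomposition. -/
def constPrecompIso (F : G ⥤ H) :
    Functor.const G (C := A) ≅ Functor.const H ⋙ (Functor.whiskeringLeft G H A).obj F :=
  NatIso.ofComponents
    (fun a => NatIso.ofComponents (fun _ => Iso.refl a) (fun _ => rfl))
    (fun f => by ext g; exact (Category.comp_id f).trans (Category.id_comp f).symm)

instance (F : G ⥤ H) : NatTrans.IsMonoidal (constPrecompIso A F).hom where
  unit := by
    ext g
    rfl
  tensor a b := by
    ext g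
    change 𝟙 _ ≫ 𝟙 _ = (𝟙 a ⊗ₘ 𝟙 b) ≫ 𝟙 _ ≫ 𝟙 _
    simp

variable [HasColimitsOfSize.{u, u} A]

/-- Precomposition with `F : G ⥤ H`, as a 1-morphism `ᴴA → ᴳA` of commutative 2-rings. -/
abbrev precompHom (F : G ⥤ H) : Com2RingHom (H ⥤ A) (G ⥤ A) where
  functor := (Functor.whiskeringLeft G H A).obj F

/-- Precomposition with `F : G ⥤ H`, as a 1-morphism `ᴴA → ᴳA` of commutative `A`-2-algebras. -/
def precomp (F : G ⥤ H) : Com2AlgHom (constHom A H) (constHom A G) where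
  hom := precompHom A F
  unit := Com2RingHom.isoMk (constPrecompIso A F) inferInstance

/-- The 2-morphism of commutative `A`-2-algebras induced by a natural transformation. -/
def precomp₂ {F F' : G ⥤ H} (α : F ⟶ F') : precomp A F ⟶ precomp A F' where
  hom :=
    { hom := (Functor.whiskeringLeft G H A).map α
      isMonoidal :=
        { unit := by
            ext g
            change 𝟙 _ ≫ 𝟙 _ = 𝟙 _
            simp
          tensor := fun X Y => by
            ext g
            change 𝟙 _ ≫ (X.map (α.app g) ⊗ₘ Y.map (α.app g)) =
              (X.map (α.app g) ⊗ₘ Y.map (α.app g)) ≫ 𝟙 _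
            simp } }
  w := by
    ext a g
    change 𝟙 a ≫ 𝟙 a = 𝟙 a
    simp

/-- The value of `π₁(A)` at a small category `G`: the category of morphisms `ᴳA → A` of
commutative `A`-2-algebras. -/
abbrev PiOne (G : Type u) [Category.{u} G] : Type (u + 1) :=
  Com2AlgHom (constHom A G) (Com2RingHom.id A)

/-- The functoriality of `π₁(A)`: composition with `ᴴA → ᴳA`. -/
@[simps]
def piOneMap (F : G ⥤ H) : PiOne A G ⥤ PiOne A H where
  obj h := (precomp A F).comp h
  map τ := (precomp A F).whiskerLeft τ

/-- The functoriality of `π₁(A)` on natural transformations. -/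
@[simps]
def piOneMap₂ {F F' : G ⥤ H} (α : F ⟶ F') : piOneMap A F ⟶ piOneMap A F' where
  app h := Com2AlgHom.whiskerRight (precomp₂ A α) h
  naturality h h' τ := by
    ext X
    exact (τ.hom.hom.naturality _).symm

/-- Precomposition with the identity is the identity, up to a monoidal isomorphism. -/
def precompIdIso (h : Com2RingHom (G ⥤ A) A) :
    ((precompHom A (𝟭 G)).comp h).functor ≅ h.functor :=
  NatIso.ofComponents (fun X => Iso.refl (h.functor.obj X))
    (fun _ => (Category.comp_id _).trans (Category.id_comp _).symm)

theorem precompIdIso_isMonoidal (h : Com2RingHom (G ⥤ A) A) :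
    NatTrans.IsMonoidal (precompIdIso A h).hom where
  unit := by
    refine (Category.comp_id _).trans ?_
    exact (congr_arg (Functor.LaxMonoidal.ε h.functor ≫ ·) (h.functor.map_id _)).trans
      (Category.comp_id _)
  tensor X Y := by
    refine (Category.comp_id _).trans ?_
    refine (congr_arg (Functor.LaxMonoidal.μ h.functor X Y ≫ ·) (h.functor.map_id _)).trans ?_
    refine (Category.comp_id _).trans ?_
    change _ = (𝟙 _ ⊗ₘ 𝟙 _) ≫ Functor.LaxMonoidal.μ h.functor X Y
    simp

/-- Precomposition with a composite is the composite of the precompositions, up to a monoidal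
isomorphism. -/
def precompCompIso (F : G ⥤ H) (F' : H ⥤ K) (h : Com2RingHom (G ⥤ A) A) :
    ((precompHom A (F ⋙ F')).comp h).functor ≅
      ((precompHom A F').comp ((precompHom A F).comp h)).functor :=
  NatIso.ofComponents (fun X => Iso.refl (h.functor.obj (F ⋙ F' ⋙ X)))
    (fun _ => (Category.comp_id _).trans (Category.id_comp _).symm)

theorem precompCompIso_isMonoidal (F : G ⥤ H) (F' : H ⥤ K) (h : Com2RingHom (G ⥤ A) A) :
    NatTrans.IsMonoidal (precompCompIso A F F' h).hom where
  unit := by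
    change (Functor.LaxMonoidal.ε h.functor ≫ h.functor.map (𝟙 _)) ≫ 𝟙 _ =
      (Functor.LaxMonoidal.ε h.functor ≫ h.functor.map (𝟙 _)) ≫ h.functor.map (𝟙 _)
    simp
  tensor X Y := by
    change (Functor.LaxMonoidal.μ h.functor _ _ ≫ h.functor.map (𝟙 _)) ≫ 𝟙 _ =
      (𝟙 _ ⊗ₘ 𝟙 _) ≫
        (Functor.LaxMonoidal.μ h.functor _ _ ≫ h.functor.map (𝟙 _)) ≫ h.functor.map (𝟙 _)
    simp

/-- `π₁(A)` preserves identities, up to isomorphism. -/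
def piOneMapId : piOneMap A (𝟭 G) ≅ 𝟭 (PiOne A G) :=
  NatIso.ofComponents
    (fun h => Com2AlgHom.isoMk (Com2RingHom.isoMk (precompIdIso A h.hom)
      (precompIdIso_isMonoidal A h.hom)) (by
      ext a
      refine (Category.comp_id _).trans ((Com2AlgHom.comp_unit_hom_app _ _ a).trans ?_)
      refine (congr_arg (h.unit.hom.hom.app a ≫ ·) (h.hom.functor.map_id _)).trans ?_
      exact Category.comp_id _))
    (fun {h h'} τ => by
      ext X
      exact (Category.comp_id _).trans (Category.id_comp _).symm)

/-- `π₁(A)` preserves composition, up to isomorphism. -/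
def piOneMapComp (F : G ⥤ H) (F' : H ⥤ K) :
    piOneMap A (F ⋙ F') ≅ piOneMap A F ⋙ piOneMap A F' :=
  NatIso.ofComponents
    (fun h => Com2AlgHom.isoMk (Com2RingHom.isoMk (precompCompIso A F F' h.hom)
      (precompCompIso_isMonoidal A F F' h.hom)) (by
      ext a
      refine (Category.comp_id _).trans ((Com2AlgHom.comp_unit_hom_app _ _ a).trans ?_)
      refine Eq.trans ?_ (Com2AlgHom.comp_unit_hom_app (precomp A F') ((precomp A F).comp h) a).symm
      refine Eq.trans ?_ (congr_arg (· ≫ _)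
        (Com2AlgHom.comp_unit_hom_app (precomp A F) h a).symm)
      change h.unit.hom.hom.app a ≫ h.hom.functor.map (𝟙 _) =
        (h.unit.hom.hom.app a ≫ h.hom.functor.map (𝟙 _)) ≫ h.hom.functor.map (𝟙 _)
      simp))
    (fun {h h'} τ => by
      ext X
      exact (Category.comp_id _).trans (Category.id_comp _).symm)

end PiOne

/-- The `2`-category of small groupoids, functors and natural transformations. -/
abbrev Gpd : Type (u + 1) :=
  Bicategory.InducedBicategory Cat.{u, u} (fun G : Grpd.{u, u} => Cat.of G)

/-- The underlying type of objects of a small groupoid. -/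
abbrev Gpd.Obj (G : Gpd.{u}) : Type u := Bundled.α (c := Groupoid.{u, u}) G

instance (G : Gpd.{u}) : Groupoid.{u} G.Obj := Bundled.str (c := Groupoid.{u, u}) G

theorem piOne_hom₂_ext {A : Type (u + 1)} [Category.{u} A] [MonoidalCategory A]
    [SymmetricCategory A] {C : Cat.{u + 1, u + 1}} {H : Type u} [Category.{u} H]
    {F F' : C ⟶ Cat.of (PiOne A H)} {σ τ : F ⟶ F'}
    (e : ∀ (c : C) (X : H ⥤ A),
      (Com2AlgHom.Hom.hom (σ.toNatTrans.app c)).hom.app X =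
        (Com2AlgHom.Hom.hom (τ.toNatTrans.app c)).hom.app X) : σ = τ :=
  Cat.Hom₂.ext (NatTrans.ext (funext fun c =>
    Com2AlgHom.hom_ext (Com2RingHom.hom_ext (NatTrans.ext (funext fun X => e c X)))))

section PiOneFunctor

variable (A : Type (u + 1)) [Category.{u} A] [MonoidalCategory A] [SymmetricCategory A]
  [HasColimitsOfSize.{u, u} A]

/-- `π₁(A)`, as a 2-functor from small groupoids to (large) categories. -/
def piOne : Pseudofunctor Gpd.{u} Cat.{u + 1, u + 1} where
  obj G := Cat.of (PiOne A G.Obj)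
  map F := (piOneMap A F.hom.toFunctor).toCatHom
  map₂ α := (piOneMap₂ A α.hom.toNatTrans).toCatHom₂
  mapId G := Cat.Hom.isoMk (piOneMapId A)
  mapComp F F' := Cat.Hom.isoMk (piOneMapComp A F.hom.toFunctor F'.hom.toFunctor)
  map₂_id F := piOne_hom₂_ext fun h X =>
    (congr_arg h.hom.functor.map (by ext g; exact X.map_id _)).trans
      (h.hom.functor.map_id (F.hom.toFunctor ⋙ X))
  map₂_comp σ τ := piOne_hom₂_ext fun h X =>
    (congr_arg h.hom.functor.map (by ext g; exact X.map_comp _ _)).trans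
      (h.hom.functor.map_comp (Functor.whiskerRight σ.hom.toNatTrans X)
        (Functor.whiskerRight τ.hom.toNatTrans X))
  map₂_whisker_left F _ _ τ := piOne_hom₂_ext fun h X =>
    Eq.symm ((Category.id_comp _).trans (Category.comp_id _))
  map₂_whisker_right τ F := piOne_hom₂_ext fun h X =>
    Eq.symm ((Category.id_comp _).trans (Category.comp_id _))
  map₂_associator F F' F'' := piOne_hom₂_ext fun h X => by
    have e : ((Functor.whiskeringLeft _ _ A).map (Functor.associator F.hom.toFunctor
        F'.hom.toFunctor F''.hom.toFunctor).hom).app X = 𝟙 _ := by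
      ext g; exact X.map_id _
    refine ((congr_arg h.hom.functor.map e).trans (h.hom.functor.map_id _)).trans ?_
    change _ = 𝟙 _ ≫ 𝟙 _ ≫ 𝟙 _ ≫ 𝟙 _ ≫ 𝟙 _
    simp only [Category.comp_id]
  map₂_left_unitor F := piOne_hom₂_ext fun h X => by
    have e : ((Functor.whiskeringLeft _ _ A).map
        (Functor.leftUnitor F.hom.toFunctor).hom).app X = 𝟙 _ := by
      ext g; exact X.map_id _
    refine ((congr_arg h.hom.functor.map e).trans (h.hom.functor.map_id _)).trans ?_
    change _ = 𝟙 _ ≫ 𝟙 _ ≫ 𝟙 _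
    simp only [Category.comp_id]
  map₂_right_unitor F := piOne_hom₂_ext fun h X => by
    have e : ((Functor.whiskeringLeft _ _ A).map
        (Functor.rightUnitor F.hom.toFunctor).hom).app X = 𝟙 _ := by
      ext g; exact X.map_id _
    refine ((congr_arg h.hom.functor.map e).trans (h.hom.functor.map_id _)).trans ?_
    change _ = 𝟙 _ ≫ 𝟙 _ ≫ 𝟙 _
    simp only [Category.comp_id]

end PiOneFunctor

section ContHom

variable (Γ : Type u) [Group Γ] [TopologicalSpace Γ]

/-- A functor from the one-object groupoid of a topological group `Γ` to a discrete category is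
topological if its action on arrows is continuous for the discrete topology on the target. -/
def IsTopological (G : Type u) [Category.{u} G] : ObjectProperty (SingleObj Γ ⥤ G) := fun F =>
  @Continuous Γ (F.obj (SingleObj.star Γ) ⟶ F.obj (SingleObj.star Γ)) _ ⊥
    (fun γ => F.map (SingleObj.toEnd Γ γ))

/-- The category of topological functors from `Γ` to the discrete category `G`, and all natural
transformations between them. -/
abbrev ContHom (G : Type u) [Category.{u} G] : Type u := (IsTopological Γ G).FullSubcategory

variable {G H : Type u} [Category.{u} G] [Category.{u} H]

/-- Composition of topological functors with a functor of discrete categories. -/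
def contHomMap (F : G ⥤ H) : ContHom Γ G ⥤ ContHom Γ H :=
  (IsTopological Γ H).lift ((IsTopological Γ G).ι ⋙ (Functor.whiskeringRight _ _ _).obj F)
    (fun ρ => @Continuous.comp Γ (ρ.obj.obj (SingleObj.star Γ) ⟶ ρ.obj.obj (SingleObj.star Γ)) _
      _ ⊥ ⊥ _ (fun g => F.map g) continuous_bot ρ.property)

/-- Whiskering of topological functors with a natural transformation. -/
def contHomMap₂ {F F' : G ⥤ H} (α : F ⟶ F') : contHomMap Γ F ⟶ contHomMap Γ F' where
  app ρ := ObjectProperty.homMk (Functor.whiskerLeft ρ.obj α)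
  naturality ρ ρ' τ := by
    ext x
    exact α.naturality _

theorem contHom_hom₂_ext {C : Cat.{u + 1, u + 1}} {F F' : C ⟶ Cat.of (AsSmall.{u + 1} (ContHom Γ H))}
    {σ τ : F ⟶ F'}
    (e : ∀ (c : C), (σ.toNatTrans.app c).down.hom.app (SingleObj.star Γ) =
      (τ.toNatTrans.app c).down.hom.app (SingleObj.star Γ)) : σ = τ :=
  Cat.Hom₂.ext (NatTrans.ext (funext fun c => ULift.ext _ _
    (ObjectProperty.hom_ext _ (NatTrans.ext (funext fun _ => e c)))))

/-- The 2-functor `Hom(Γ, -)` from small groupoids to categories, sending a small groupoid `G` to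
the category of topological functors from `Γ` to `G` with its discrete topology. The (small)
values are viewed as large categories through `AsSmall`. -/
def contHom : Pseudofunctor Gpd.{u} Cat.{u + 1, u + 1} where
  obj G := Cat.of (AsSmall.{u + 1} (ContHom Γ G.Obj))
  map F := (AsSmall.down ⋙ contHomMap Γ F.hom.toFunctor ⋙ AsSmall.up).toCatHom
  map₂ α := NatTrans.toCatHom₂ (Functor.whiskerLeft AsSmall.down
    (Functor.whiskerRight (contHomMap₂ Γ α.hom.toNatTrans) AsSmall.up))
  mapId G := Cat.Hom.isoMk (NatIso.ofComponents (fun ρ => Iso.refl ρ) fun _ =>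
    (Category.comp_id _).trans (Category.id_comp _).symm)
  mapComp F F' := Cat.Hom.isoMk (NatIso.ofComponents
    (fun ρ => Iso.refl (AsSmall.up.obj ((contHomMap Γ F'.hom.toFunctor).obj
      ((contHomMap Γ F.hom.toFunctor).obj (AsSmall.down.obj ρ))))) fun _ =>
        (Category.comp_id _).trans (Category.id_comp _).symm)
  map₂_id F := contHom_hom₂_ext Γ fun ρ => rfl
  map₂_comp σ τ := contHom_hom₂_ext Γ fun ρ => rfl
  map₂_whisker_left F _ _ τ := contHom_hom₂_ext Γ fun ρ =>
    Eq.symm ((Category.id_comp _).trans (Category.comp_id _))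
  map₂_whisker_right τ F := contHom_hom₂_ext Γ fun ρ =>
    Eq.symm ((Category.id_comp _).trans (Category.comp_id _))
  map₂_associator F F' F'' := contHom_hom₂_ext Γ fun ρ => Eq.symm
    ((Category.id_comp _).trans ((congr_arg (· ≫ _) (F''.hom.toFunctor.map_id _)).trans
      ((Category.id_comp _).trans ((Category.id_comp _).trans (Category.id_comp _)))))
  map₂_left_unitor F := contHom_hom₂_ext Γ fun ρ => Eq.symm
    ((Category.id_comp _).trans ((congr_arg (· ≫ _) (F.hom.toFunctor.map_id _)).trans
      (Category.id_comp _)))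
  map₂_right_unitor F := contHom_hom₂_ext Γ fun ρ => Eq.symm
    ((Category.id_comp _).trans (Category.id_comp _))

end ContHom

section Torsors

open ComonObj

variable {G : Type u} [Groupoid.{u} G] {A : Type (u + 1)} [Category.{u} A] [MonoidalCategory A]
  [SymmetricCategory A] [HasColimitsOfSize.{u, u} A]

/-- For a coalgebra `y` in the category of functors `Gᵒᵖ ⥤ A` and objects `s`, `t` of `G`, the
component `∐_{g : s ⟶ t} y(t) ⟶ y(t) ⊗ y(s)` of `τ_y`. It is given on the summand of `g` by
the comultiplication `y(t) ⟶ y(t) ⊗ y(t)` followed by `id ⊗ y(g)`. -/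
def torsorMap (y : Gᵒᵖ ⥤ A) [ComonObj y] (s t : G) :
    (∐ fun _ : s ⟶ t => y.obj (Opposite.op t)) ⟶
      y.obj (Opposite.op t) ⊗ y.obj (Opposite.op s) :=
  Sigma.desc fun g => (Δ[y] : y ⟶ y ⊗ y).app (Opposite.op t) ≫
    y.obj (Opposite.op t) ◁ y.map g.op

/-- The counit of a coalgebra `y` in `Gᵒᵖ ⥤ A`, as a cocone with vertex the unit object of `A`. -/
def counitCocone (y : Gᵒᵖ ⥤ A) [ComonObj y] : Cocone y where
  pt := 𝟙_ A
  ι := (ε[y] : y ⟶ 𝟙_ (Gᵒᵖ ⥤ A))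

/-- A right `G`-torsor in `A`: a cocommutative coalgebra `y` in `Gᵒᵖ ⥤ A` such that `τ_y` is an
isomorphism (it only involves pairs of objects in the same connected component of `G`) and the
counit is a colimiting cocone. -/
structure IsTorsor (y : CommComon (Gᵒᵖ ⥤ A)) : Prop where
  isIso_torsorMap (s t : G) (_ : Nonempty (s ⟶ t)) : IsIso (torsorMap y.X s t)
  isColimit_counit : Nonempty (IsColimit (counitCocone y.X))

variable (G A) in
/-- The category of right `G`-torsors in `A`, with all morphisms of coalgebras in `Gᵒᵖ ⥤ A`. -/
abbrev Tors : Type (u + 1) := ObjectProperty.FullSubcategory (C := CommComon (Gᵒᵖ ⥤ A)) IsTorsor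

end Torsors

end TwoRing

/-!
Let `K` be a separable closure of `k` with Galois group `Γ`, and let `k[t, -]` be the functor
`s ↦ k[Hom(t, s)]` from a groupoid `G` to vector spaces. The proof matches three kinds of objects:
continuous functors `ρ : Γ ⥤ G`, morphisms of algebras `h : ᴳVect → Vect`, and torsors `y`. The link
between them is a point of a coalgebra `C` over `K`, that is, a group-like element of `K ⊗ C`.

*Points trivialize.* If `p : V ⊗ C → D` is a linear map such that `v ⊗ c ↦ ∑ c₁ ⊗ p(v ⊗ c₂)` is an
isomorphism `V ⊗ C ≅ C ⊗ D`, then a point `x` of `C` gives an isomorphism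
`K ⊗ V ≅ K ⊗ D`, `v ↦ p(v ⊗ x)` (`fibre_bijective`). For a torsor `y` this says that the translates
`y(g)(x)` of a point `x` of `y(t)` form a basis of `K ⊗ y(s)`, where `g` runs through `Hom(s, t)`
(`torsorBasis`). For a morphism of algebras `h`, the coalgebra `h(k[t, -])` and the map
`X(t) ⊗ h(k[t, -]) → h(X)` induced by evaluation satisfy the hypothesis, because
`const X(t) ⊗ k[t, -] ≅ k[t, -] ⊗ X` over a groupoid; so a point of `h(k[t, -])` gives
`K ⊗ X(t) ≅ K ⊗ h(X)`, naturally and monoidally in `X` (`transport_bijective`, `transport_tensor`).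
In particular `s ↦ h(k[s, -])` is a torsor (`isTorsor_fibreComon`).

*Points exist.* A nonzero cocommutative coalgebra has a point with values in a finite extension `L`
of `k`, namely a residue field of the dual algebra (`exists_isPoint_finite`). A derivation of `L`
applied to this point yields a primitive element. A space with a basis of group-like elements has no
nonzero primitive element, so for the coalgebra `y(t)` of a torsor all derivations of `L` vanish, `L`
is separable, and the point is defined over `K` (`exists_isPoint`). The elements of `Γ` move a point
`x` of `y(t)` to translates `y(g)(x)` for unique arrows `g : t ⟶ t`, and `γ ↦ g` is the continuous
functor `ρ` attached to `y` (`IsTorsor.exists_isPointOver`).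

*Descent.* Two torsors, or two morphisms of algebras, with points on which `Γ` acts through the same
`ρ` are isomorphic by a unique isomorphism matching the points: the isomorphism exists over `K` by the
trivializations, and commutes with `Γ` (`IsTorsor.exists_app_eq`, `IsPointOver.exists_piOneHom`).
Conversely `ρ` gives the morphism of algebras `X ↦ (K ⊗ X(t))^Γ`, which is symmetric monoidal and
cocontinuous because Galois descent identifies `K ⊗ (K ⊗ X(t))^Γ` with `K ⊗ X(t)`
(`comparison_bijective`). It has a universal point over `ρ` (`isPointOver_universalPoint`).

Together these facts show that `ρ ↦ (X ↦ (K ⊗ X(t))^Γ)` and `h ↦ (s ↦ h(k[s, -]))` are equivalences.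
The first is visibly compatible with functors of groupoids, and continuous functors from `Γ` to a
groupoid form a groupoid.
-/

namespace TwoRing

open scoped TensorProduct

/-! ### External products after a base change -/

section BoxTensor

variable {k : Type*} [CommRing k] {L : Type*} [CommRing L] [Algebra k L]
  {L' : Type*} [CommRing L'] [Algebra k L']
  {M N M' N' P : Type*} [AddCommMonoid M] [Module k M] [AddCommMonoid N] [Module k N]
  [AddCommMonoid M'] [Module k M'] [AddCommMonoid N'] [Module k N'] [AddCommMonoid P] [Module k P]

/-- The external product `(L ⊗ M) × (L ⊗ N) → L ⊗ (M ⊗ N)`, which multiplies the scalars in the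
extension `L` of `k`. It identifies `L ⊗ (M ⊗ N)` with the tensor product of `L ⊗ M` and `L ⊗ N`
over `L`. -/
def box (x : L ⊗[k] M) (y : L ⊗[k] N) : L ⊗[k] (M ⊗[k] N) :=
  (TensorProduct.AlgebraTensorModule.distribBaseChange k L M N).symm (x ⊗ₜ[L] y)

local infixl:70 " ⊠ " => box

@[simp]
theorem tmul_box_tmul (a b : L) (m : M) (n : N) :
    (a ⊗ₜ[k] m) ⊠ (b ⊗ₜ[k] n) = (a * b) ⊗ₜ[k] (m ⊗ₜ[k] n) :=
  TensorProduct.AlgebraTensorModule.distribBaseChange_symm_tmul ..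

theorem add_box (x x' : L ⊗[k] M) (y : L ⊗[k] N) : (x + x') ⊠ y = x ⊠ y + x' ⊠ y := by
  simp [box, TensorProduct.add_tmul]

theorem box_add (x : L ⊗[k] M) (y y' : L ⊗[k] N) : x ⊠ (y + y') = x ⊠ y + x ⊠ y' := by
  simp [box, TensorProduct.tmul_add]

theorem smul_box (a : L) (x : L ⊗[k] M) (y : L ⊗[k] N) : (a • x) ⊠ y = a • (x ⊠ y) := by
  simp [box, ← TensorProduct.smul_tmul']

theorem box_smul (a : L) (x : L ⊗[k] M) (y : L ⊗[k] N) : x ⊠ (a • y) = a • (x ⊠ y) := by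
  simp [box]

@[simp]
theorem box_zero (x : L ⊗[k] M) : x ⊠ (0 : L ⊗[k] N) = 0 := by
  simp [box]

/-- The external product as a bilinear map. -/
@[simps!]
def boxₗ : (L ⊗[k] M) →ₗ[L] (L ⊗[k] N) →ₗ[L] L ⊗[k] (M ⊗[k] N) :=
  LinearMap.mk₂ L box add_box smul_box box_add box_smul

/-- Linear maps out of `L ⊗ (M ⊗ N)` are determined by their values on external products. -/
theorem box_ext {Q : Type*} [AddCommMonoid Q] [Module L Q] {f g : L ⊗[k] (M ⊗[k] N) →ₗ[L] Q}
    (h : ∀ x y, f (x ⊠ y) = g (x ⊠ y)) : f = g := by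
  refine LinearMap.ext fun z => ?_
  induction z using TensorProduct.induction_on with
  | zero => simp
  | add x y hx hy => simp only [map_add, hx, hy]
  | tmul a w =>
    induction w using TensorProduct.induction_on with
    | zero => simp
    | add x y hx hy => simp only [TensorProduct.tmul_add, map_add, hx, hy]
    | tmul m n => simpa using h (a ⊗ₜ m) (1 ⊗ₜ n)

theorem box_induction {motive : L ⊗[k] M → Prop} (x : L ⊗[k] M)
    (tmul : ∀ a m, motive (a ⊗ₜ m)) (add : ∀ x y, motive x → motive y → motive (x + y)) :
    motive x := by
  induction x using TensorProduct.induction_on with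
  | zero => simpa using tmul 0 0
  | tmul a m => exact tmul a m
  | add x y hx hy => exact add x y hx hy

theorem baseChange_map_box (f : M →ₗ[k] M') (g : N →ₗ[k] N') (x : L ⊗[k] M) (y : L ⊗[k] N) :
    (TensorProduct.map f g).baseChange L (x ⊠ y) = f.baseChange L x ⊠ g.baseChange L y := by
  induction x using box_induction with
  | add x x' h h' => simp only [add_box, map_add, h, h']
  | tmul a m =>
    induction y using box_induction with
    | add y y' h h' => simp only [box_add, map_add, h, h']
    | tmul b n => simp

theorem baseChange_lTensor_box (g : N →ₗ[k] N') (x : L ⊗[k] M) (y : L ⊗[k] N) :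
    (g.lTensor M).baseChange L (x ⊠ y) = x ⊠ g.baseChange L y := by
  rw [LinearMap.lTensor, baseChange_map_box, LinearMap.baseChange_id, LinearMap.id_apply]

theorem baseChange_rTensor_box (f : M →ₗ[k] M') (x : L ⊗[k] M) (y : L ⊗[k] N) :
    (f.rTensor N).baseChange L (x ⊠ y) = f.baseChange L x ⊠ y := by
  rw [LinearMap.rTensor, baseChange_map_box, LinearMap.baseChange_id, LinearMap.id_apply]

theorem baseChange_comm_box (x : L ⊗[k] M) (y : L ⊗[k] N) :
    (TensorProduct.comm k M N).toLinearMap.baseChange L (x ⊠ y) = y ⊠ x := by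
  induction x using box_induction with
  | add x x' h h' => simp only [add_box, box_add, map_add, h, h']
  | tmul a m =>
    induction y using box_induction with
    | add y y' h h' => simp only [add_box, box_add, map_add, h, h']
    | tmul b n => simp [mul_comm]

theorem baseChange_assoc_box (x : L ⊗[k] M) (y : L ⊗[k] N) (z : L ⊗[k] P) :
    (TensorProduct.assoc k M N P).toLinearMap.baseChange L (x ⊠ y ⊠ z) = x ⊠ (y ⊠ z) := by
  induction x using box_induction with
  | add x x' h h' => simp only [add_box, map_add, h, h']
  | tmul a m =>
    induction y using box_induction with
    | add y y' h h' => simp only [add_box, box_add, map_add, h, h']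
    | tmul b n =>
      induction z using box_induction with
      | add y y' h h' => simp only [box_add, map_add, h, h']
      | tmul c p => simp [mul_assoc]

theorem baseChange_leftComm_box (x : L ⊗[k] M) (y : L ⊗[k] N) (z : L ⊗[k] P) :
    (TensorProduct.leftComm k M N P).toLinearMap.baseChange L (x ⊠ (y ⊠ z)) = y ⊠ (x ⊠ z) := by
  induction x using box_induction with
  | add x x' h h' => simp only [add_box, box_add, map_add, h, h']
  | tmul a m =>
    induction y using box_induction with
    | add y y' h h' => simp only [add_box, box_add, map_add, h, h']
    | tmul b n =>
      induction z using box_induction with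
      | add y y' h h' => simp only [box_add, map_add, h, h']
      | tmul c p => simp [mul_left_comm]

theorem baseChange_rid_box (x : L ⊗[k] M) :
    (TensorProduct.rid k M).toLinearMap.baseChange L (x ⊠ (1 ⊗ₜ[k] (1 : k) : L ⊗[k] k)) = x := by
  induction x using box_induction with
  | add x x' h h' => simp only [add_box, map_add, h, h']
  | tmul a m => simp

theorem baseChange_lid_box (x : L ⊗[k] M) :
    (TensorProduct.lid k M).toLinearMap.baseChange L ((1 ⊗ₜ[k] (1 : k) : L ⊗[k] k) ⊠ x) = x := by
  induction x using box_induction with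
  | add x x' h h' => simp only [box_add, map_add, h, h']
  | tmul a m => simp

/-- Extension of scalars along an algebra homomorphism is compatible with external products. -/
theorem rTensor_box (φ : L →ₐ[k] L') (x : L ⊗[k] M) (y : L ⊗[k] N) :
    φ.toLinearMap.rTensor _ (x ⊠ y) = φ.toLinearMap.rTensor M x ⊠ φ.toLinearMap.rTensor N y := by
  induction x using box_induction with
  | add x x' h h' => simp only [add_box, map_add, h, h']
  | tmul a m =>
    induction y using box_induction with
    | add y y' h h' => simp only [box_add, map_add, h, h']
    | tmul b n => simp

theorem rTensor_baseChange (φ : L →ₗ[k] L') (f : M →ₗ[k] N) (x : L ⊗[k] M) :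
    φ.rTensor N (f.baseChange L x) = f.baseChange L' (φ.rTensor M x) := by
  induction x using box_induction with
  | add x x' h h' => simp only [map_add, h, h']
  | tmul a m => simp

theorem rTensor_smul (φ : L →ₐ[k] L') (a : L) (x : L ⊗[k] M) :
    φ.toLinearMap.rTensor M (a • x) = φ a • φ.toLinearMap.rTensor M x := by
  induction x using box_induction with
  | add x x' h h' => simp only [map_add, smul_add, h, h']
  | tmul b m => simp [TensorProduct.smul_tmul']

theorem baseChange_comp_apply (g : N →ₗ[k] P) (f : M →ₗ[k] N) (x : L ⊗[k] M) :
    (g ∘ₗ f).baseChange L x = g.baseChange L (f.baseChange L x) := by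
  rw [LinearMap.baseChange_comp]; rfl

theorem baseChange_bijective {f : M →ₗ[k] N} (hf : Function.Bijective f) :
    Function.Bijective (f.baseChange L) :=
  ((LinearEquiv.ofBijective f hf).baseChange k L _ _).bijective

end BoxTensor

/-! ### Points of coalgebras -/

section Point

open Coalgebra

variable {k : Type*} [CommRing k] (L : Type*) [CommRing L] [Algebra k L]
  {C : Type*} [AddCommGroup C] [Module k C] [Coalgebra k C]
  {D : Type*} [AddCommGroup D] [Module k D] [Coalgebra k D]

local infixl:70 " ⊠ " => box

variable {L} in
/-- An `L`-valued point of a coalgebra `C` over `k`: a group-like element of `L ⊗ C`. -/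
structure IsPoint (x : L ⊗[k] C) : Prop where
  comul : (comul : C →ₗ[k] C ⊗[k] C).baseChange L x = x ⊠ x
  counit : (counit : C →ₗ[k] k).baseChange L x = 1 ⊗ₜ 1

variable {L}

theorem IsPoint.map {x : L ⊗[k] C} (hx : IsPoint x) (f : C →ₗc[k] D) :
    IsPoint (f.toLinearMap.baseChange L x) where
  comul := by
    rw [← baseChange_comp_apply]
    have : (Coalgebra.comul : D →ₗ[k] _) ∘ₗ f.toLinearMap =
      TensorProduct.map f.toLinearMap f.toLinearMap ∘ₗ Coalgebra.comul := f.map_comp_comul.symm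
    rw [this, baseChange_comp_apply, hx.comul, baseChange_map_box]
  counit := by
    rw [← baseChange_comp_apply]
    have : (Coalgebra.counit : D →ₗ[k] _) ∘ₗ f.toLinearMap = Coalgebra.counit := f.counit_comp
    rw [this, hx.counit]

theorem IsPoint.rTensor {L' : Type*} [CommRing L'] [Algebra k L'] {x : L ⊗[k] C} (hx : IsPoint x)
    (φ : L →ₐ[k] L') : IsPoint (φ.toLinearMap.rTensor C x) where
  comul := by rw [← rTensor_baseChange, hx.comul, rTensor_box]
  counit := by rw [← rTensor_baseChange, hx.counit]; simp

end Point

/-! ### Trivializations given by points -/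

section Trivialization

open Coalgebra

variable {k : Type*} [CommRing k] {L : Type*} [CommRing L] [Algebra k L]
  {C : Type*} [AddCommGroup C] [Module k C]
  {V D : Type*} [AddCommGroup V] [Module k V] [AddCommGroup D] [Module k D]

local infixl:70 " ⊠ " => box

/-- The map `L ⊗ V → L ⊗ D` obtained from `p : V ⊗ C → D` by inserting `x ∈ L ⊗ C`. -/
def fibre (p : V ⊗[k] C →ₗ[k] D) (x : L ⊗[k] C) : L ⊗[k] V →ₗ[L] L ⊗[k] D :=
  p.baseChange L ∘ₗ boxₗ.flip x

theorem fibre_apply (p : V ⊗[k] C →ₗ[k] D) (x : L ⊗[k] C) (u : L ⊗[k] V) :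
    fibre p x u = p.baseChange L (u ⊠ x) := rfl

variable [Coalgebra k C]

/-- For a coalgebra `C` and a linear map `p : V ⊗ C → D`, the map `V ⊗ C → C ⊗ D` sending `v ⊗ c`
to `∑ c₁ ⊗ p (v ⊗ c₂)`. -/
def shear (p : V ⊗[k] C →ₗ[k] D) : V ⊗[k] C →ₗ[k] C ⊗[k] D :=
  p.lTensor C ∘ₗ (TensorProduct.leftComm k V C C).toLinearMap ∘ₗ comul.lTensor V

/-- After base change, multiplication by a point `x` turns `shear p` into `fibre p x`. -/
theorem baseChange_shear_box (p : V ⊗[k] C →ₗ[k] D) {x : L ⊗[k] C} (hx : IsPoint x)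
    (u : L ⊗[k] V) : (shear p).baseChange L (u ⊠ x) = x ⊠ fibre p x u := by
  rw [shear, baseChange_comp_apply, baseChange_comp_apply, baseChange_lTensor_box, hx.comul,
    baseChange_leftComm_box, baseChange_lTensor_box, fibre_apply]

/-- `shear p` is a map of left `C`-comodules. -/
theorem comul_shear (p : V ⊗[k] C →ₗ[k] D) (z : V ⊗[k] C) :
    TensorProduct.assoc k C C D (comul.rTensor D (shear p z)) =
      (shear p).lTensor C (TensorProduct.leftComm k V C C (comul.lTensor V z)) := by
  induction z using TensorProduct.induction_on with
  | zero => simp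
  | add x y hx hy => simp only [map_add, hx, hy]
  | tmul v c =>
    let q : C →ₗ[k] D := p ∘ₗ TensorProduct.mk k V C v
    have hq (w : C ⊗[k] C) :
        p.lTensor C (TensorProduct.leftComm k V C C (v ⊗ₜ w)) = q.lTensor C w := by
      induction w using TensorProduct.induction_on with
      | zero => simp
      | add x y hx hy => simp only [TensorProduct.tmul_add, map_add, hx, hy]
      | tmul a b => simp [q]
    have hs (c : C) : shear p (v ⊗ₜ c) = q.lTensor C (comul c) := by simp [shear, hq]
    have h1 (w : C ⊗[k] C) : (shear p).lTensor C (TensorProduct.leftComm k V C C (v ⊗ₜ w)) =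
        (q.lTensor C).lTensor C (comul.lTensor C w) := by
      induction w using TensorProduct.induction_on with
      | zero => simp
      | add x y hx hy => simp only [TensorProduct.tmul_add, map_add, hx, hy]
      | tmul a b => simp [hs]
    have h2 (w : C ⊗[k] C) : TensorProduct.assoc k C C D (comul.rTensor D (q.lTensor C w)) =
        (q.lTensor C).lTensor C (TensorProduct.assoc k C C C (comul.rTensor C w)) := by
      induction w using TensorProduct.induction_on with
      | zero => simp
      | add x y hx hy => simp only [map_add, hx, hy]
      | tmul a b =>
        simp only [LinearMap.lTensor_tmul, LinearMap.rTensor_tmul]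
        induction comul (R := k) a using TensorProduct.induction_on with
        | zero => simp
        | add x y hx hy => simp only [TensorProduct.add_tmul, map_add, hx, hy]
        | tmul a b => simp
    rw [LinearMap.lTensor_tmul, h1, hs, h2, Coalgebra.coassoc_apply]

variable {p : V ⊗[k] C →ₗ[k] D}

theorem fibre_injective (hp : Function.Bijective (shear p)) {x : L ⊗[k] C} (hx : IsPoint x) :
    Function.Injective (fibre p x) := by
  rw [injective_iff_map_eq_zero]
  intro u hu
  have h := baseChange_shear_box p hx u
  rw [hu, box_zero] at h
  have h0 : u ⊠ x = 0 := (baseChange_bijective hp).1 (h.trans (map_zero _).symm)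
  have h1 := baseChange_lTensor_box (counit : C →ₗ[k] k) u x
  rw [h0, map_zero, hx.counit] at h1
  rw [← baseChange_rid_box u, ← h1, map_zero]

/-- The preimage of `x ⊠ d` under `shear p` has the form `u ⊠ x`, because `shear p` is a map of
comodules; then `u` is a preimage of `d`. -/
theorem fibre_surjective (hp : Function.Bijective (shear p)) {x : L ⊗[k] C} (hx : IsPoint x) :
    Function.Surjective (fibre p x) := by
  intro d
  obtain ⟨q, hq⟩ := (baseChange_bijective (L := L) hp).2 (x ⊠ d)
  -- Comparing the coactions of `C` on both sides of `hq` shows that `q` is of the form `u ⊠ x`.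
  have h1 := congr_arg (fun z => (TensorProduct.assoc k C C D).toLinearMap.baseChange L
    ((comul.rTensor D).baseChange L z)) hq
  simp only [baseChange_rTensor_box, hx.comul, baseChange_assoc_box] at h1
  have h2 : (TensorProduct.assoc k C C D).toLinearMap ∘ₗ comul.rTensor D ∘ₗ shear p =
      (shear p).lTensor C ∘ₗ (TensorProduct.leftComm k V C C).toLinearMap ∘ₗ comul.lTensor V :=
    LinearMap.ext (comul_shear p)
  rw [← baseChange_comp_apply, ← baseChange_comp_apply, LinearMap.comp_assoc, h2,
    baseChange_comp_apply, ← hq, ← baseChange_lTensor_box] at h1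
  have h3 := (baseChange_bijective (L := L) (f := (shear p).lTensor C)
    ((LinearEquiv.ofBijective _ hp).lTensor C).bijective).1 h1
  let e : C ⊗[k] (V ⊗[k] C) →ₗ[k] V ⊗[k] C := (TensorProduct.comm k C V).toLinearMap ∘ₗ
    ((TensorProduct.rid k V).toLinearMap ∘ₗ counit.lTensor V).lTensor C
  have h4 : e ∘ₗ ((TensorProduct.leftComm k V C C).toLinearMap ∘ₗ comul.lTensor V) =
      LinearMap.id := by
    ext v c
    have : ∀ w : C ⊗[k] C, e (TensorProduct.leftComm k V C C (v ⊗ₜ w)) =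
        v ⊗ₜ TensorProduct.rid k C (counit.lTensor C w) := by
      intro w
      induction w using TensorProduct.induction_on with
      | zero => simp
      | add x y hx hy => simp only [TensorProduct.tmul_add, map_add, hx, hy]
      | tmul a b => simp [e, TensorProduct.smul_tmul']
    simp [this]
  have h5 := congr_arg (e.baseChange L) h3
  rw [← baseChange_comp_apply, h4, baseChange_comp_apply, baseChange_lTensor_box,
    baseChange_comm_box] at h5
  rw [LinearMap.baseChange_id, LinearMap.id_apply] at h5
  rw [h5, baseChange_shear_box p hx] at hq
  refine ⟨((TensorProduct.rid k V).toLinearMap ∘ₗ counit.lTensor V).baseChange L q, ?_⟩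
  have h6 := congr_arg ((counit : C →ₗ[k] k).rTensor D |>.baseChange L) hq
  rw [baseChange_rTensor_box, baseChange_rTensor_box, hx.counit] at h6
  rw [← baseChange_lid_box (fibre p x _), h6, baseChange_lid_box]

/-- If `V ⊗ C ≅ C ⊗ D` through `shear p`, then a point of `C` trivializes `D`. -/
theorem fibre_bijective (hp : Function.Bijective (shear p)) {x : L ⊗[k] C} (hx : IsPoint x) :
    Function.Bijective (fibre p x) :=
  ⟨fibre_injective hp hx, fibre_surjective hp hx⟩

end Trivialization

/-! ### Bases consisting of points -/

section PointBasis

open Coalgebra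

variable {k : Type*} [CommRing k] {L : Type*} [CommRing L] [Algebra k L]
  {M N : Type*} [AddCommGroup M] [Module k M] [AddCommGroup N] [Module k N]

local infixl:70 " ⊠ " => box

/-- The basis of `L ⊗ (M ⊗ N)` formed by external products of basis vectors. -/
def boxBasis {ι κ : Type*} (b : Module.Basis ι L (L ⊗[k] M)) (c : Module.Basis κ L (L ⊗[k] N)) :
    Module.Basis (ι × κ) L (L ⊗[k] (M ⊗[k] N)) :=
  (b.tensorProduct c).map (TensorProduct.AlgebraTensorModule.distribBaseChange k L M N).symm

theorem boxBasis_repr_box {ι κ : Type*} (b : Module.Basis ι L (L ⊗[k] M))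
    (c : Module.Basis κ L (L ⊗[k] N)) (x : L ⊗[k] M) (y : L ⊗[k] N) (i : ι) (j : κ) :
    (boxBasis b c).repr (x ⊠ y) (i, j) = b.repr x i * c.repr y j := by
  simp [boxBasis, box, mul_comm]

variable {D : Type*} [AddCommGroup D] [Module k D] [Coalgebra k D]
  {S : Type*} (b : Module.Basis S L (L ⊗[k] D))

/-- If `L ⊗ D` has a basis of points, then the comultiplication is diagonal in this basis. -/
theorem boxBasis_repr_comul (hb : ∀ s, IsPoint (b s)) [DecidableEq S] (z : L ⊗[k] D) (s t : S) :
    (boxBasis b b).repr ((comul : D →ₗ[k] D ⊗[k] D).baseChange L z) (s, t) =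
      if s = t then b.repr z s else 0 := by
  have h : (boxBasis b b).coord (s, t) ∘ₗ (comul : D →ₗ[k] D ⊗[k] D).baseChange L =
      if s = t then b.coord s else 0 := by
    refine b.ext fun i => ?_
    rw [LinearMap.comp_apply, (hb i).comul, Module.Basis.coord_apply, boxBasis_repr_box]
    simp only [Module.Basis.repr_self, Finsupp.single_apply]
    split_ifs <;> simp_all
  refine (LinearMap.congr_fun h z).trans ?_
  split_ifs <;> rfl

/-- If `L ⊗ D` has a basis of points, then there are no further points. -/
theorem IsPoint.exists_eq_basis (hb : ∀ s, IsPoint (b s)) [IsDomain L] {z : L ⊗[k] D}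
    (hz : IsPoint z) : ∃ s, z = b s := by
  classical
  have h (s t : S) : b.repr z s * b.repr z t = if s = t then b.repr z s else 0 := by
    rw [← boxBasis_repr_comul b hb, hz.comul, boxBasis_repr_box]
  have hne : z ≠ 0 := by
    rintro rfl
    have := hz.counit
    rw [map_zero] at this
    have := congr_arg (TensorProduct.rid k L) this
    simp at this
  obtain ⟨s, hs⟩ : ∃ s, b.repr z s ≠ 0 := by
    by_contra! h0
    exact hne (b.repr.injective (Finsupp.ext fun s => by simp [h0 s]))
  refine ⟨s, b.repr.injective (Finsupp.ext fun t => ?_)⟩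
  rw [Module.Basis.repr_self, Finsupp.single_apply]
  split_ifs with hst
  · subst hst
    have := h s s
    rw [if_pos rfl] at this
    exact mul_left_cancel₀ hs (this.trans (mul_one _).symm)
  · have := h s t
    rw [if_neg hst] at this
    exact (mul_eq_zero.mp this).resolve_left hs

/-- If `L ⊗ D` has a basis of points, then it has no nonzero primitive elements. -/
theorem eq_zero_of_primitive (hb : ∀ s, IsPoint (b s)) {z : L ⊗[k] D} {s : S}
    (hz : (comul : D →ₗ[k] D ⊗[k] D).baseChange L z = z ⊠ b s + b s ⊠ z) : z = 0 := by
  classical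
  refine b.repr.injective (Finsupp.ext fun t => ?_)
  have h := boxBasis_repr_comul b hb z t t
  rw [hz, map_add, Finsupp.add_apply, boxBasis_repr_box, boxBasis_repr_box, if_pos rfl,
    Module.Basis.repr_self, Finsupp.single_apply] at h
  simp only [map_zero, Finsupp.coe_zero, Pi.zero_apply]
  split_ifs at h with hst
  · simpa using h
  · simpa using h.symm

end PointBasis

/-! ### Families of linear maps -/

section FamilyAction

open Coalgebra

variable {k : Type*} [CommRing k] {L : Type*} [CommRing L] [Algebra k L]
  {C D : Type*} [AddCommGroup C] [Module k C] [AddCommGroup D] [Module k D] {S : Type*}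

/-- The map `k[S] ⊗ C → D` given by a family of linear maps `C → D` indexed by `S`. -/
def familyMap (f : S → C →ₗ[k] D) : (S →₀ k) ⊗[k] C →ₗ[k] D :=
  TensorProduct.lift (Finsupp.linearCombination k f)

@[simp]
theorem familyMap_single_tmul (f : S → C →ₗ[k] D) (s : S) (a : k) (c : C) :
    familyMap f (Finsupp.single s a ⊗ₜ c) = a • f s c := by
  simp [familyMap]

theorem fibre_familyMap_single (f : S → C →ₗ[k] D) (s : S) (a : L) (x : L ⊗[k] C) :
    fibre (familyMap f) x (a ⊗ₜ Finsupp.single s 1) = a • (f s).baseChange L x := by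
  induction x using box_induction with
  | add x y hx hy =>
    rw [fibre_apply] at *
    simp only [box_add, map_add, hx, hy, smul_add] at *
  | tmul b c => simp [fibre_apply, TensorProduct.smul_tmul']

variable [Coalgebra k C] {f : S → C →ₗ[k] D}

/-- The basis of `L ⊗ D` formed by the images of a point of `C`. -/
def familyBasis (hf : Function.Bijective (shear (familyMap f))) {x : L ⊗[k] C} (hx : IsPoint x) :
    Module.Basis S L (L ⊗[k] D) :=
  ((Finsupp.basisSingleOne (R := k) (ι := S)).baseChange L).map
    (LinearEquiv.ofBijective _ (fibre_bijective hf hx))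

@[simp]
theorem familyBasis_apply (hf : Function.Bijective (shear (familyMap f))) {x : L ⊗[k] C}
    (hx : IsPoint x) (s : S) : familyBasis hf hx s = (f s).baseChange L x := by
  simp [familyBasis, fibre_familyMap_single]

end FamilyAction

/-! ### Existence of points -/

section Existence

open Coalgebra WithConv

local infixl:70 " ⊠ " => box

/-- A derivation of `L` satisfies the Leibniz rule for external products. -/
theorem derivation_box {k : Type*} [CommRing k] {L : Type*} [CommRing L] [Algebra k L]
    {M N : Type*} [AddCommGroup M] [Module k M] [AddCommGroup N] [Module k N]
    (d : Derivation k L L) (x : L ⊗[k] M) (y : L ⊗[k] N) :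
    d.toLinearMap.rTensor _ (x ⊠ y) =
      d.toLinearMap.rTensor M x ⊠ y + x ⊠ d.toLinearMap.rTensor N y := by
  induction x using box_induction with
  | add x x' h h' => simp only [add_box, map_add, h, h']; abel
  | tmul a m =>
    induction y using box_induction with
    | add y y' h h' => simp only [box_add, map_add, h, h']; abel
    | tmul b n =>
      simp [TensorProduct.add_tmul, mul_comm b, add_comm]

variable {k : Type u} [Field k] {C : Type u} [AddCommGroup C] [Module k C] [Coalgebra k C]

/-- If the translates of a point `x` of `L ⊗ C` form a basis, then the coefficients of `x` are
annihilated by all derivations of `L`. -/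
theorem derivation_point_eq_zero {L : Type*} [CommRing L] [Algebra k L] {S : Type*}
    {f : S → C →ₗc[k] C} {s₀ : S} (hs₀ : f s₀ = .id k C)
    (hf : Function.Bijective (shear (familyMap fun s => (f s).toLinearMap))) {x : L ⊗[k] C}
    (hx : IsPoint x) (d : Derivation k L L) : d.toLinearMap.rTensor C x = 0 := by
  have h0 : familyBasis hf hx s₀ = x := by
    rw [familyBasis_apply, hs₀]
    exact congr_arg (· x) (LinearMap.baseChange_id (R := k) (A := L) (M := C))
  refine eq_zero_of_primitive (familyBasis hf hx) (fun s => ?_) (s := s₀) ?_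
  · rw [familyBasis_apply]
    exact hx.map (f s)
  · rw [h0, ← rTensor_baseChange, hx.comul, derivation_box]

/-- A finite field extension without nonzero derivations is separable, because its module of Kähler
differentials vanishes. -/
theorem isSeparable_of_forall_derivation_eq_zero {L : Type*} [Field L] [Algebra k L]
    [FiniteDimensional k L] (h : ∀ d : Derivation k L L, d = 0) : Algebra.IsSeparable k L := by
  have : Subsingleton (Module.Dual L (Ω[L⁄k])) :=
    ⟨fun a b => (KaehlerDifferential.linearMapEquivDerivation k L).injective
      ((h _).trans (h _).symm)⟩
  have : Subsingleton (Ω[L⁄k]) := (Module.subsingleton_dual_iff L).mp this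
  have : Algebra.FormallyUnramified k L := ⟨this⟩
  exact Algebra.FormallyUnramified.isSeparable k L

/-- The action of the dual algebra of a coalgebra `C` on `C`. -/
def dualAct (f : C →ₗ[k] k) : C →ₗ[k] C :=
  (TensorProduct.lid k C).toLinearMap ∘ₗ f.rTensor C ∘ₗ comul

/-- The dual algebra acts: the convolution product `f * g` acts by `f` followed by `g`. -/
theorem dualAct_mul (f g : WithConv (C →ₗ[k] k)) (c : C) :
    dualAct (f * g).ofConv c = dualAct g.ofConv (dualAct f.ofConv c) := by
  let Φ : C ⊗[k] (C ⊗[k] C) →ₗ[k] C := (TensorProduct.lid k C).toLinearMap ∘ₗ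
    TensorProduct.map f.ofConv ((TensorProduct.lid k C).toLinearMap ∘ₗ g.ofConv.rTensor C)
  have h1 (w : C ⊗[k] C) : Φ (TensorProduct.assoc k C C C (comul.rTensor C w)) =
      TensorProduct.lid k C ((f * g).ofConv.rTensor C w) := by
    induction w using TensorProduct.induction_on with
    | zero => simp
    | add x y hx hy => simp only [map_add, hx, hy]
    | tmul a b =>
      have h2 (v : C ⊗[k] C) : Φ (TensorProduct.assoc k C C C (v ⊗ₜ b)) =
          (LinearMap.mul' k k (TensorProduct.map f.ofConv g.ofConv v)) • b := by
        induction v using TensorProduct.induction_on with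
        | zero => simp
        | add x y hx hy => simp only [TensorProduct.add_tmul, map_add, hx, hy, add_smul]
        | tmul a b => simp [Φ, mul_smul, smul_comm (f.ofConv a)]
      simp only [LinearMap.rTensor_tmul, h2, TensorProduct.lid_tmul]
      rfl
  have h3 (w : C ⊗[k] C) : Φ (comul.lTensor C w) =
      dualAct g.ofConv (TensorProduct.lid k C (f.ofConv.rTensor C w)) := by
    induction w using TensorProduct.induction_on with
    | zero => simp
    | add x y hx hy => simp only [map_add, hx, hy]
    | tmul a b => simp [Φ, dualAct]
  exact (h1 _).symm.trans ((congr_arg Φ (Coalgebra.coassoc_apply c)).trans (h3 _))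

theorem exists_comp_eq_of_ker_le {U V W : Type*} [AddCommGroup U] [Module k U] [AddCommGroup V]
    [Module k V] [AddCommGroup W] [Module k W] (T : U →ₗ[k] V) (φ : U →ₗ[k] W)
    (h : LinearMap.ker T ≤ LinearMap.ker φ) : ∃ g : V →ₗ[k] W, g ∘ₗ T = φ := by
  obtain ⟨g, hg⟩ := LinearMap.exists_extend
    ((LinearMap.ker T).liftQ φ h ∘ₗ T.quotKerEquivRange.symm.toLinearMap)
  refine ⟨g, LinearMap.ext fun u => ?_⟩
  have := LinearMap.congr_fun hg ⟨T u, u, rfl⟩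
  refine this.trans ?_
  have h2 : T.quotKerEquivRange.symm ⟨T u, u, rfl⟩ = (LinearMap.ker T).mkQ u :=
    T.quotKerEquivRange_symm_apply_image u _
  simp only [LinearMap.comp_apply, LinearEquiv.coe_coe, h2]
  simp

theorem rid_lid_box {L : Type*} [CommRing L] [Algebra k L] (x y : L ⊗[k] k) :
    TensorProduct.AlgebraTensorModule.rid k L L
      ((TensorProduct.lid k k).toLinearMap.baseChange L (x ⊠ y)) =
      TensorProduct.AlgebraTensorModule.rid k L L x *
        TensorProduct.AlgebraTensorModule.rid k L L y := by
  induction x using box_induction with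
  | add x x' h h' => simp only [add_box, map_add, h, h', add_mul]
  | tmul a m =>
    induction y using box_induction with
    | add y y' h h' => simp only [box_add, map_add, h, h', mul_add]
    | tmul b n => simp [mul_comm m, mul_smul]

theorem rid_coord_baseChange {L : Type*} [CommRing L] [Algebra k L] {M : Type*} [AddCommGroup M]
    [Module k M] {ι : Type*} (b : Module.Basis ι k M) (i : ι) (x : L ⊗[k] M) :
    TensorProduct.AlgebraTensorModule.rid k L L ((b.coord i).baseChange L x) =
      (b.baseChange L).repr x i := by
  induction x using box_induction with
  | add x x' h h' => simp only [map_add, h, h', Finsupp.add_apply]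
  | tmul a m => simp

/-- A vector of `L ⊗ (M ⊗ N)` is determined by its contractions with pairs of functionals. -/
theorem eq_of_forall_map_baseChange {L : Type*} [CommRing L] [Algebra k L] {M N : Type*}
    [AddCommGroup M] [Module k M] [AddCommGroup N] [Module k N] {w w' : L ⊗[k] (M ⊗[k] N)}
    (h : ∀ (f : M →ₗ[k] k) (g : N →ₗ[k] k),
      (TensorProduct.map f g).baseChange L w = (TensorProduct.map f g).baseChange L w') :
    w = w' := by
  let b := Module.Basis.ofVectorSpace k M
  let c := Module.Basis.ofVectorSpace k N
  let B := boxBasis (b.baseChange L) (c.baseChange L)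
  have key (i j) : (TensorProduct.AlgebraTensorModule.rid k L L).toLinearMap ∘ₗ
      ((TensorProduct.lid k k).toLinearMap.baseChange L ∘ₗ
        (TensorProduct.map (b.coord i) (c.coord j)).baseChange L) = B.coord (i, j) := by
    refine box_ext fun x y => ?_
    rw [LinearMap.comp_apply, LinearMap.comp_apply, baseChange_map_box, Module.Basis.coord_apply,
      boxBasis_repr_box, LinearEquiv.coe_coe, rid_lid_box, rid_coord_baseChange,
      rid_coord_baseChange]
  refine B.repr.injective (Finsupp.ext fun ⟨i, j⟩ => ?_)
  have h1 (v) := LinearMap.congr_fun (key i j) v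
  refine (h1 w).symm.trans (Eq.trans ?_ (h1 w'))
  simp only [LinearMap.comp_apply, h]

/-- A nonzero cocommutative coalgebra over a field `k` has a point with values in a finite field
extension `L` of `k`, which moreover is generated by the coefficients of the point: the point
`x ∈ L ⊗ C` induces a surjective homomorphism from the dual algebra of `C` to `L`. -/
theorem exists_isPoint_finite [IsCocomm k C] [Nontrivial C] :
    ∃ (L : Type u) (_ : Field L) (_ : Algebra k L) (_ : FiniteDimensional k L) (x : L ⊗[k] C),
      IsPoint x ∧ ∀ a : L, ∃ f : C →ₗ[k] k, f.baseChange L x = a ⊗ₜ 1 := by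
  obtain ⟨c, hc⟩ := exists_ne (0 : C)
  -- The annihilator of a nonzero vector `c` in the dual algebra has finite codimension; `L` is the
  -- residue field of a maximal ideal containing it.
  let I : Ideal (WithConv (C →ₗ[k] k)) :=
    { carrier := {f | dualAct f.ofConv c = 0}
      add_mem' := fun {f g} hf hg => by
        have hf' : dualAct f.ofConv c = 0 := hf
        have hg' : dualAct g.ofConv c = 0 := hg
        have : dualAct (f + g).ofConv c = dualAct f.ofConv c + dualAct g.ofConv c := by
          simp only [dualAct, WithConv.ofConv_add, LinearMap.rTensor_add]; simp
        exact this.trans (by rw [hf', hg', add_zero])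
      zero_mem' := by simp [dualAct]
      smul_mem' := fun g f hf => by
        have hf' : dualAct f.ofConv c = 0 := hf
        simp [smul_eq_mul, mul_comm g f, dualAct_mul, hf'] }
  have hI (f : WithConv (C →ₗ[k] k)) : f ∈ I ↔ dualAct f.ofConv c = 0 := Iff.rfl
  have hne : I ≠ ⊤ := by
    rw [Ideal.ne_top_iff_one, hI]
    intro h
    apply hc
    rw [← h]
    have : (1 : WithConv (C →ₗ[k] k)).ofConv = counit := by
      ext; simp [LinearMap.convOne_def]
    simp [this, dualAct]
  obtain ⟨m, hm, hIm⟩ := I.exists_le_maximal hne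
  let : Field (WithConv (C →ₗ[k] k) ⧸ m) := Ideal.Quotient.field m
  -- The comultiplication of `c` involves only finitely many vectors `a i` on the left.
  let r := Coalgebra.Repr.arbitrary k c
  let T : WithConv (C →ₗ[k] k) →ₗ[k] (r.index → k) :=
    LinearMap.pi (fun i => LinearMap.applyₗ (r.left i) ∘ₗ
      (WithConv.linearEquiv k (C →ₗ[k] k)).toLinearMap)
  have hT (f) (i : r.index) : T f i = f.ofConv (r.left i) := rfl
  have hker : LinearMap.ker T ≤ LinearMap.ker (Ideal.Quotient.mkₐ k m).toLinearMap := by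
    intro f hf
    rw [LinearMap.mem_ker]
    refine Ideal.Quotient.eq_zero_iff_mem.mpr (hIm ((hI f).mpr ?_))
    have h0 (i) (hi : i ∈ r.index) : f.ofConv (r.left i) = 0 := by
      rw [← hT f ⟨i, hi⟩, LinearMap.mem_ker.mp hf]; rfl
    rw [dualAct, LinearMap.comp_apply, LinearMap.comp_apply, ← r.eq, map_sum, map_sum]
    exact Finset.sum_eq_zero fun i hi => by simp [h0 i hi]
  obtain ⟨g, hg⟩ := exists_comp_eq_of_ker_le T _ hker
  have hg' (f) : g (T f) = Ideal.Quotient.mk m f := LinearMap.congr_fun hg f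
  have hfin : FiniteDimensional k (WithConv (C →ₗ[k] k) ⧸ m) := by
    refine Module.Finite.of_surjective g fun a => ?_
    obtain ⟨f, rfl⟩ := Ideal.Quotient.mk_surjective a
    exact ⟨T f, hg' f⟩
  classical
  -- The quotient map from the dual algebra to `L` is the evaluation at the following vector.
  let x : (WithConv (C →ₗ[k] k) ⧸ m) ⊗[k] C := ∑ i : r.index,
    g (fun j => if i = j then 1 else 0) ⊗ₜ r.left i
  have hx (f : C →ₗ[k] k) : f.baseChange _ x = (Ideal.Quotient.mk m (toConv f)) ⊗ₜ 1 := by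
    rw [← hg', LinearMap.pi_apply_eq_sum_univ g, map_sum, TensorProduct.sum_tmul]
    refine Finset.sum_congr rfl fun i _ => ?_
    rw [LinearMap.baseChange_tmul, hT, TensorProduct.smul_tmul, smul_eq_mul, mul_one]
  refine ⟨_, inferInstance, inferInstance, hfin, x, ⟨?_, ?_⟩, fun a => ?_⟩
  · refine eq_of_forall_map_baseChange fun f g => ?_
    rw [← baseChange_comp_apply, baseChange_map_box, hx, hx, tmul_box_tmul, ← map_mul]
    apply ((TensorProduct.lid k k).baseChange k (WithConv (C →ₗ[k] k) ⧸ m) _ _).injective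
    have h1 := hx (toConv f * toConv g).ofConv
    have h2 : (toConv f * toConv g).ofConv =
        (TensorProduct.lid k k).toLinearMap ∘ₗ TensorProduct.map f g ∘ₗ comul := by
      rw [LinearMap.convMul_def]
      congr 1
    rw [h2, baseChange_comp_apply] at h1
    refine h1.trans ?_
    change _ = (TensorProduct.lid k k).toLinearMap.baseChange _ _
    rw [LinearMap.baseChange_tmul, LinearEquiv.coe_coe, TensorProduct.lid_tmul, one_smul, ← h2]
  · rw [hx, ← map_one (Ideal.Quotient.mk m)]
    rfl
  · obtain ⟨f, rfl⟩ := Ideal.Quotient.mk_surjective a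
    exact ⟨f.ofConv, hx _⟩

/-- Let `C` be a nonzero cocommutative coalgebra over a field `k` and let `S` be a set of
endomorphisms of `C`, one of which is the identity, such that `k[S] ⊗ C ≅ C ⊗ C` through the shear
map. Then `C` has a point with values in every separably closed extension of `k`.

The point with values in a finite extension `L` is annihilated by all derivations of `L`. As it
generates `L`, the extension `L` has no derivations and is separable. -/
theorem exists_isPoint [IsCocomm k C] [Nontrivial C] {S : Type*} {f : S → C →ₗc[k] C} {s₀ : S}
    (hs₀ : f s₀ = .id k C)
    (hf : Function.Bijective (shear (familyMap fun s => (f s).toLinearMap)))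
    (K : Type*) [Field K] [Algebra k K] [IsSepClosed K] : ∃ x : K ⊗[k] C, IsPoint x := by
  obtain ⟨L, _, _, _, x, hx, hgen⟩ := exists_isPoint_finite (k := k) (C := C)
  have : Algebra.IsSeparable k L := by
    refine isSeparable_of_forall_derivation_eq_zero fun d => Derivation.ext fun a => ?_
    obtain ⟨g, hg⟩ := hgen a
    have h := rTensor_baseChange d.toLinearMap g x
    rw [derivation_point_eq_zero hs₀ hf hx d, hg, map_zero] at h
    have := congr_arg (TensorProduct.rid k L) h
    simpa using this
  exact ⟨_, hx.rTensor (IsSepClosed.lift : L →ₐ[k] K)⟩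

end Existence

/-! ### The semilinear action of the Galois group -/

section GaloisAction

variable {k K : Type*} [Field k] [Field K] [Algebra k K]
  {M N : Type*} [AddCommMonoid M] [Module k M] [AddCommMonoid N] [Module k N]

local infixl:70 " ⊠ " => box

/-- The semilinear action of the Galois group on `K ⊗ M`. -/
def galAct (γ : Gal(K/k)) : K ⊗[k] M →ₗ[k] K ⊗[k] M :=
  (γ : K →ₐ[k] K).toLinearMap.rTensor M

@[simp]
theorem galAct_tmul (γ : Gal(K/k)) (a : K) (m : M) : galAct γ (a ⊗ₜ[k] m) = γ a ⊗ₜ m := rfl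

theorem galAct_smul (γ : Gal(K/k)) (a : K) (x : K ⊗[k] M) :
    galAct γ (a • x) = γ a • galAct γ x :=
  rTensor_smul (γ : K →ₐ[k] K) a x

theorem galAct_box (γ : Gal(K/k)) (x : K ⊗[k] M) (y : K ⊗[k] N) :
    galAct γ (x ⊠ y) = galAct γ x ⊠ galAct γ y :=
  rTensor_box (γ : K →ₐ[k] K) x y

theorem galAct_baseChange (γ : Gal(K/k)) (f : M →ₗ[k] N) (x : K ⊗[k] M) :
    galAct γ (f.baseChange K x) = f.baseChange K (galAct γ x) :=
  rTensor_baseChange _ f x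

theorem galAct_mul (γ δ : Gal(K/k)) (x : K ⊗[k] M) :
    galAct (γ * δ) x = galAct γ (galAct δ x) := by
  induction x using box_induction with
  | add x y hx hy => simp only [map_add, hx, hy]
  | tmul a m => simp

theorem IsPoint.galAct {C : Type*} [AddCommGroup C] [Module k C] [Coalgebra k C] {x : K ⊗[k] C}
    (hx : IsPoint x) (γ : Gal(K/k)) :
    IsPoint (galAct γ x) :=
  hx.rTensor (γ : K →ₐ[k] K)

theorem repr_galAct {ι : Type*} (b : Module.Basis ι k M) (γ : Gal(K/k)) (x : K ⊗[k] M) (i : ι) :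
    (b.baseChange K).repr (galAct γ x) i = γ ((b.baseChange K).repr x i) := by
  induction x using box_induction with
  | add x y hx hy => simp only [map_add, Finsupp.add_apply, hx, hy]
  | tmul a m => simp

end GaloisAction

/-! ### Galois descent -/

section Descent

variable {k K : Type*} [Field k] [Field K] [Algebra k K]
  {M N : Type*} [AddCommGroup M] [Module k M] [AddCommGroup N] [Module k N]

theorem one_tmul_injective : Function.Injective fun m : M => (1 : K) ⊗ₜ[k] m := by
  intro m m' h
  rw [← sub_eq_zero]
  refine (Module.FaithfullyFlat.one_tmul_eq_zero_iff k M (A := K) (m - m')).mp ?_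
  rw [TensorProduct.tmul_sub]
  exact sub_eq_zero.mpr h

theorem baseChange_injective : Function.Injective fun f : M →ₗ[k] N => f.baseChange K := by
  intro f g h
  refine LinearMap.ext fun m => one_tmul_injective (K := K) (k := k) ?_
  simpa using LinearMap.congr_fun h (1 ⊗ₜ m)

theorem bijective_of_baseChange {M N : Type*} [AddCommMonoid M] [Module k M] [AddCommMonoid N]
    [Module k N] {f : M →ₗ[k] N} (h : Function.Bijective (f.baseChange K)) :
    Function.Bijective f := by
  let : AddCommGroup M := Module.addCommMonoidToAddCommGroup k
  let : AddCommGroup N := Module.addCommMonoidToAddCommGroup k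
  exact (Module.FaithfullyFlat.lTensor_bijective_iff_bijective k K f).mp h

/-- The vectors of `K ⊗ M` fixed by the Galois group are those defined over `k`. -/
theorem exists_eq_one_tmul [IsGalois k K] {x : K ⊗[k] M} (hx : ∀ γ : Gal(K/k), galAct γ x = x) :
    ∃ m, x = 1 ⊗ₜ m := by
  let b := Module.Basis.ofVectorSpace k M
  have h (i) : ∃ c : k, algebraMap k K c = (b.baseChange K).repr x i := by
    rw [← Set.mem_range, InfiniteGalois.mem_range_algebraMap_iff_fixed]
    intro γ
    rw [← repr_galAct, hx]
  choose c hc using h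
  refine ⟨((b.baseChange K).repr x).sum fun i _ => c i • b i, ?_⟩
  conv_lhs => rw [← (b.baseChange K).linearCombination_repr x]
  rw [Finsupp.linearCombination_apply, Finsupp.sum, Finsupp.sum, TensorProduct.tmul_sum]
  refine Finset.sum_congr rfl fun i _ => ?_
  rw [← hc, Module.Basis.baseChange_apply, TensorProduct.smul_tmul', smul_eq_mul, mul_one,
    ← TensorProduct.smul_tmul, Algebra.smul_def, mul_one]

/-- A `K`-linear map `K ⊗ M → K ⊗ N` commuting with the Galois action is defined over `k`. -/
theorem exists_baseChange_eq [IsGalois k K] (F : K ⊗[k] M →ₗ[K] K ⊗[k] N)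
    (hF : ∀ (γ : Gal(K/k)) x, F (galAct γ x) = galAct γ (F x)) :
    ∃ f : M →ₗ[k] N, f.baseChange K = F := by
  let i : N →ₗ[k] K ⊗[k] N := TensorProduct.mk k K N 1
  have hi : Function.Injective i := one_tmul_injective
  have h (m : M) : F (1 ⊗ₜ m) ∈ LinearMap.range i := by
    obtain ⟨n, hn⟩ := exists_eq_one_tmul (k := k) (x := F (1 ⊗ₜ m)) fun γ => by
      rw [← hF, galAct_tmul, map_one]
    exact ⟨n, hn.symm⟩
  let f : M →ₗ[k] N := (LinearEquiv.ofInjective i hi).symm.toLinearMap ∘ₗ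
    (F.restrictScalars k ∘ₗ TensorProduct.mk k K M 1).codRestrict (LinearMap.range i) h
  have hf (m : M) : (1 : K) ⊗ₜ[k] f m = F (1 ⊗ₜ m) := by
    have := (LinearEquiv.ofInjective i hi).apply_symm_apply ⟨F (1 ⊗ₜ m), h m⟩
    exact congr_arg Subtype.val this
  refine ⟨f, ?_⟩
  ext m
  simpa using hf m

/-- A nonzero `K`-subspace of `K ⊗ M` which is stable under the Galois group contains a nonzero
vector defined over `k`. -/
theorem exists_one_tmul_mem [IsGalois k K] (U : Submodule K (K ⊗[k] M))
    (hU : ∀ (γ : Gal(K/k)), ∀ x ∈ U, galAct γ x ∈ U) {x : K ⊗[k] M} (hx : x ∈ U) (hx0 : x ≠ 0) :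
    ∃ m : M, m ≠ 0 ∧ 1 ⊗ₜ m ∈ U := by
  let b := (Module.Basis.ofVectorSpace k M)
  -- Induction on the number of nonzero coordinates.
  induction h : ((b.baseChange K).repr x).support.card using Nat.strong_induction_on
    generalizing x with | _ n ih =>
  obtain ⟨i, hi⟩ : ∃ i, (b.baseChange K).repr x i ≠ 0 := by
    by_contra! h0
    exact hx0 ((b.baseChange K).repr.injective (Finsupp.ext fun s => by simp [h0 s]))
  set a := (b.baseChange K).repr x i with ha
  have hx' : a⁻¹ • x ∈ U := U.smul_mem _ hx
  by_cases hfix : ∀ γ : Gal(K/k), galAct γ (a⁻¹ • x) = a⁻¹ • x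
  · obtain ⟨m, hm⟩ := exists_eq_one_tmul hfix
    refine ⟨m, ?_, hm ▸ hx'⟩
    rintro rfl
    rw [TensorProduct.tmul_zero, smul_eq_zero] at hm
    exact hm.elim (inv_ne_zero hi) hx0
  · -- If `a⁻¹ • x` is moved by `γ`, then the difference has fewer nonzero coordinates.
    push Not at hfix
    obtain ⟨γ, hγ⟩ := hfix
    refine ih _ ?_ (U.sub_mem (hU γ _ hx') hx') (sub_ne_zero.mpr hγ) rfl
    rw [← h]
    refine Finset.card_lt_card ⟨fun j hj => ?_, fun hss => ?_⟩
    · rw [Finsupp.mem_support_iff] at hj ⊢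
      contrapose! hj
      simp [repr_galAct, hj]
    · have := hss (Finsupp.mem_support_iff.mpr hi)
      rw [Finsupp.mem_support_iff] at this
      apply this
      simp [repr_galAct, ← ha, hi]

end Descent

/-! ### Twisted invariants -/

section Twisted

variable {k K : Type*} [Field k] [Field K] [Algebra k K]
  {V W : Type*} [AddCommGroup V] [Module k V] [AddCommGroup W] [Module k W]

local infixl:70 " ⊠ " => box

/-- The vectors of `K ⊗ V` fixed by the diagonal action of the Galois group, where the action on
`V` is given by `σ`. -/
def twistedInvariants (σ : Gal(K/k) → V →ₗ[k] V) : Submodule k (K ⊗[k] V) where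
  carrier := {w | ∀ γ, (σ γ).baseChange K (galAct γ w) = w}
  add_mem' hx hy γ := by rw [map_add, map_add, hx γ, hy γ]
  zero_mem' γ := by rw [map_zero, map_zero]
  smul_mem' c x hx γ := by
    rw [map_smul, ← algebraMap_smul K c (galAct γ x), map_smul, hx γ, algebraMap_smul]

theorem box_mem_twistedInvariants {σ : Gal(K/k) → V →ₗ[k] V} {σ' : Gal(K/k) → W →ₗ[k] W}
    {v : K ⊗[k] V} {w : K ⊗[k] W} (hv : v ∈ twistedInvariants σ)
    (hw : w ∈ twistedInvariants σ') :
    v ⊠ w ∈ twistedInvariants fun γ => TensorProduct.map (σ γ) (σ' γ) := fun γ => by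
  rw [galAct_box, baseChange_map_box, hv γ, hw γ]

variable (σ : Gal(K/k) → V →ₗ[k] V) (σ' : Gal(K/k) → W →ₗ[k] W)

/-- The comparison map `K ⊗ (K ⊗ V)^Γ → K ⊗ V`. -/
def comparison : K ⊗[k] twistedInvariants σ →ₗ[K] K ⊗[k] V :=
  (twistedInvariants σ).subtype.liftBaseChange K

@[simp]
theorem comparison_tmul (a : K) (w : twistedInvariants σ) :
    comparison σ (a ⊗ₜ w) = a • (w : K ⊗[k] V) := by
  simp [comparison]

/-- The comparison map intertwines the action on the scalars with the diagonal action. -/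
theorem baseChange_galAct_comparison (γ : Gal(K/k)) (x : K ⊗[k] twistedInvariants σ) :
    (σ γ).baseChange K (galAct γ (comparison σ x)) = comparison σ (galAct γ x) := by
  induction x using box_induction with
  | add x y hx hy => simp only [map_add, hx, hy]
  | tmul a w => rw [comparison_tmul, galAct_smul, map_smul, w.2, galAct_tmul, comparison_tmul]

/-- The kernel of the comparison map is stable under the Galois group, and contains no nonzero
vector defined over `k`. -/
theorem comparison_injective [IsGalois k K] : Function.Injective (comparison σ) := by
  rw [← LinearMap.ker_eq_bot]
  by_contra h
  obtain ⟨x, hx, hx0⟩ := (Submodule.ne_bot_iff _).mp h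
  obtain ⟨w, hw, hw'⟩ := exists_one_tmul_mem (M := twistedInvariants σ)
    (LinearMap.ker (comparison σ)) (fun γ x hx => by
    rw [LinearMap.mem_ker] at hx ⊢
    rw [← baseChange_galAct_comparison, hx, map_zero, map_zero]) hx hx0
  rw [LinearMap.mem_ker, comparison_tmul, one_smul] at hw'
  exact hw (Subtype.ext hw')

/-- Galois descent: if the action on `V` factors through a finite quotient of the Galois group, then
`K ⊗ V` is spanned by invariant vectors. The proof applies the linear independence of characters to
the traces of the vectors `a ⊗ v`. -/
theorem comparison_surjective [IsGalois k K] (hmul : ∀ γ δ, σ (γ * δ) = σ γ ∘ₗ σ δ)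
    (E : IntermediateField k K) [FiniteDimensional k E] [Normal k E]
    (hE : ∀ γ ∈ E.fixingSubgroup, σ γ = LinearMap.id) : Function.Surjective (comparison σ) := by
  rw [← LinearMap.range_eq_top]
  by_contra h
  obtain ⟨ℓ, hℓ0, hℓ⟩ := Submodule.exists_le_ker_of_lt_top _ (lt_top_iff_ne_top.mpr h)
  apply hℓ0
  ext v
  let r : Gal(K/k) →* Gal(E/k) := AlgEquiv.restrictNormalHom E
  have hr (γ : Gal(K/k)) (a : E) : ((r γ a : E) : K) = γ a := AlgEquiv.restrictNormal_commutes γ E a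
  have hker {γ δ : Gal(K/k)} (hγδ : r γ = r δ) : σ γ = σ δ := by
    have h1 : δ⁻¹ * γ ∈ E.fixingSubgroup := by
      rw [IntermediateField.mem_fixingSubgroup_iff]
      intro a ha
      have := hr (δ⁻¹ * γ) ⟨a, ha⟩
      rw [map_mul, hγδ, map_inv, inv_mul_cancel] at this
      exact this.symm
    have h2 : γ = δ * (δ⁻¹ * γ) := by group
    rw [h2, hmul, hE _ h1, LinearMap.comp_id]
  obtain ⟨s, hs⟩ := (AlgEquiv.restrictNormalHom_surjective (F := k) (K₁ := E) K).hasRightInverse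
  have hs' (τ : Gal(E/k)) : r (s τ) = τ := hs τ
  let w (a : E) : K ⊗[k] V := ∑ τ : Gal(E/k), ((τ a : E) : K) ⊗ₜ σ (s τ) v
  have hw (a : E) : w a ∈ twistedInvariants σ := by
    intro γ
    simp only [w, map_sum, galAct_tmul, LinearMap.baseChange_tmul]
    refine Fintype.sum_equiv (Equiv.mulLeft (r γ)) _ _ fun τ => ?_
    rw [Equiv.coe_mulLeft, AlgEquiv.mul_apply, hr, ← LinearMap.comp_apply, ← hmul]
    congr 2
    exact hker (by rw [map_mul, hs', hs'])
  have hsum (a : E) : ∑ τ : Gal(E/k), ℓ (1 ⊗ₜ σ (s τ) v) * ((τ a : E) : K) = 0 := by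
    have h0 : ℓ (w a) = 0 := by
      refine hℓ ⟨1 ⊗ₜ ⟨w a, hw a⟩, ?_⟩
      rw [comparison_tmul, one_smul]
    rw [← h0, map_sum]
    refine Finset.sum_congr rfl fun τ _ => ?_
    rw [mul_comm, ← smul_eq_mul, ← map_smul, TensorProduct.smul_tmul', smul_eq_mul, mul_one]
  let χ (τ : Gal(E/k)) : E →* K := ((algebraMap E K).comp (τ : E →+* E)).toMonoidHom
  have hχ : Function.Injective χ := fun τ τ' hτ => AlgEquiv.ext fun a =>
    (algebraMap E K).injective (DFunLike.congr_fun hτ a)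
  have hind := (linearIndependent_monoidHom E K).comp χ hχ
  rw [Fintype.linearIndependent_iff] at hind
  have h1 := hind (fun τ => ℓ (1 ⊗ₜ σ (s τ) v)) (funext fun a => by
    rw [Finset.sum_apply]; exact hsum a) 1
  have h2 : σ (s 1) = LinearMap.id := by
    rw [hker (show r (s 1) = r 1 by rw [hs', map_one]), hE 1 (one_mem _)]
  simpa [h2] using h1

theorem comparison_bijective [IsGalois k K] (hmul : ∀ γ δ, σ (γ * δ) = σ γ ∘ₗ σ δ)
    (E : IntermediateField k K) [FiniteDimensional k E] [Normal k E]
    (hE : ∀ γ ∈ E.fixingSubgroup, σ γ = LinearMap.id) : Function.Bijective (comparison σ) :=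
  ⟨comparison_injective σ, comparison_surjective σ hmul E hE⟩

/-- The external product of twisted invariants. -/
def invariantsBox : twistedInvariants σ ⊗[k] twistedInvariants σ' →ₗ[k]
    twistedInvariants fun γ => TensorProduct.map (σ γ) (σ' γ) :=
  TensorProduct.lift (LinearMap.mk₂ k (fun v w => ⟨v.1 ⊠ w.1, box_mem_twistedInvariants v.2 w.2⟩)
    (fun _ _ _ => Subtype.ext (add_box _ _ _))
    (fun c v w => Subtype.ext (by
      change (c • v.1) ⊠ w.1 = c • (v.1 ⊠ w.1)
      rw [← algebraMap_smul K, smul_box, algebraMap_smul]))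
    (fun _ _ _ => Subtype.ext (box_add _ _ _))
    (fun c v w => Subtype.ext (by
      change v.1 ⊠ (c • w.1) = c • (v.1 ⊠ w.1)
      rw [← algebraMap_smul K, box_smul, algebraMap_smul])))

@[simp]
theorem invariantsBox_tmul (v : twistedInvariants σ) (w : twistedInvariants σ') :
    (invariantsBox σ σ' (v ⊗ₜ w)).1 = v.1 ⊠ w.1 := rfl

theorem comparison_baseChange_invariantsBox (x : K ⊗[k] twistedInvariants σ)
    (y : K ⊗[k] twistedInvariants σ') :
    comparison _ ((invariantsBox σ σ').baseChange K (x ⊠ y)) =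
      comparison σ x ⊠ comparison σ' y := by
  induction x using box_induction with
  | add x x' h h' => simp only [add_box, map_add, h, h']
  | tmul a m =>
    induction y using box_induction with
    | add y y' h h' => simp only [box_add, map_add, h, h']
    | tmul b n =>
      rw [tmul_box_tmul, LinearMap.baseChange_tmul, comparison_tmul, comparison_tmul,
        comparison_tmul, invariantsBox_tmul, smul_box, box_smul, mul_smul]

theorem invariantsBox_bijective (h : Function.Bijective (comparison σ))
    (h' : Function.Bijective (comparison σ'))
    (h'' : Function.Bijective (comparison fun γ => TensorProduct.map (σ γ) (σ' γ))) :
    Function.Bijective (invariantsBox σ σ') := by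
  refine bijective_of_baseChange (K := K) ?_
  let e : K ⊗[k] (twistedInvariants σ ⊗[k] twistedInvariants σ') ≃ₗ[K]
    K ⊗[k] twistedInvariants fun γ => TensorProduct.map (σ γ) (σ' γ) :=
    TensorProduct.AlgebraTensorModule.distribBaseChange k K (twistedInvariants σ)
      (twistedInvariants σ') ≪≫ₗ
    TensorProduct.congr (LinearEquiv.ofBijective _ h) (LinearEquiv.ofBijective _ h') ≪≫ₗ
    (TensorProduct.AlgebraTensorModule.distribBaseChange k K V W).symm ≪≫ₗ
    (LinearEquiv.ofBijective _ h'').symm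
  have he : e.toLinearMap = (invariantsBox σ σ').baseChange K := by
    refine box_ext (M := twistedInvariants σ) (N := twistedInvariants σ') fun x y => ?_
    have : (comparison fun γ => TensorProduct.map (σ γ) (σ' γ)) (e (x ⊠ y)) =
        comparison σ x ⊠ comparison σ' y := by
      refine (LinearEquiv.apply_symm_apply (LinearEquiv.ofBijective _ h'') _).trans ?_
      simp [box]
    apply h''.1
    rw [comparison_baseChange_invariantsBox]
    exact this
  rw [← he]
  exact e.bijective

end Twisted

/-! ### Linearized representable functors -/

section Representable

variable {k : Type u} [Field k] {G : Type u} [Category.{u} G]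

/-- The linearization of the functor corepresented by `s`. -/
def freeRep (k : Type u) [Field k] {G : Type u} [Category.{u} G] (s : G) : G ⥤ ModuleCat.{u} k where
  obj t := ModuleCat.of k ((s ⟶ t) →₀ k)
  map f := ModuleCat.ofHom (Finsupp.lmapDomain k k (· ≫ f))
  map_id t := by
    ext : 1
    refine (congr_arg (Finsupp.lmapDomain k k) (funext Category.comp_id)).trans ?_
    exact Finsupp.lmapDomain_id k k
  map_comp f g := by
    ext : 1
    refine Finsupp.lhom_ext' fun h => LinearMap.ext_ring ?_
    simp [Finsupp.mapDomain_single]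

/-- The basis vectors of the values of `freeRep k s`. -/
def freeRepBasis {s t : G} (a : s ⟶ t) : (freeRep k s).obj t := Finsupp.single a (1 : k)

theorem freeRep_map_basis {s t u : G} (a : s ⟶ t) (f : t ⟶ u) :
    ((freeRep k s).map f).hom (freeRepBasis a) = freeRepBasis (a ≫ f) :=
  Finsupp.mapDomain_single

theorem freeRep_obj_hom_ext {s t : G} {M : ModuleCat.{u} k} {f g : (freeRep k s).obj t ⟶ M}
    (h : ∀ a : s ⟶ t, f.hom (freeRepBasis a) = g.hom (freeRepBasis a)) : f = g :=
  ModuleCat.hom_ext (Finsupp.lhom_ext' fun a => LinearMap.ext_ring (h a))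

/-- The Yoneda lemma: a morphism out of `freeRep k s` is determined by the image of the identity. -/
theorem freeRep_hom_ext {s : G} {X : G ⥤ ModuleCat.{u} k} {f g : freeRep k s ⟶ X}
    (h : (f.app s).hom (freeRepBasis (𝟙 s)) = (g.app s).hom (freeRepBasis (𝟙 s))) : f = g := by
  ext t : 2
  refine freeRep_obj_hom_ext fun a => ?_
  have key (f : freeRep k s ⟶ X) : (f.app t).hom (freeRepBasis a) =
      (X.map a).hom ((f.app s).hom (freeRepBasis (𝟙 s))) := by
    refine Eq.trans ?_ (ConcreteCategory.congr_hom (f.naturality a) (freeRepBasis (𝟙 s)))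
    refine congr_arg (f.app t).hom ?_
    refine Eq.trans ?_ (freeRep_map_basis (𝟙 s) a).symm
    rw [Category.id_comp]
  exact (key f).trans ((congr_arg (X.map a).hom h).trans (key g).symm)

/-- The morphism out of `freeRep k s` corresponding to an element of `X.obj s`. -/
def freeRepDesc {s : G} {X : G ⥤ ModuleCat.{u} k} (v : X.obj s) : freeRep k s ⟶ X where
  app t := ModuleCat.ofHom (Y := X.obj t)
    (Finsupp.linearCombination k fun a : s ⟶ t => (X.map a).hom v)
  naturality t t' f := by
    refine freeRep_obj_hom_ext fun a => ?_
    change Finsupp.linearCombination k _ (Finsupp.mapDomain _ (Finsupp.single a 1)) =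
      (X.map f).hom (Finsupp.linearCombination k _ (Finsupp.single a 1))
    simp [Finsupp.mapDomain_single]

theorem freeRepDesc_app_basis {s t : G} {X : G ⥤ ModuleCat.{u} k} (v : X.obj s) (a : s ⟶ t) :
    ((freeRepDesc v).app t).hom (freeRepBasis a) = (X.map a).hom v := by
  change Finsupp.linearCombination k _ (Finsupp.single a 1) = _
  simp

@[simp]
theorem freeRepDesc_app_one {s : G} {X : G ⥤ ModuleCat.{u} k} (v : X.obj s) :
    ((freeRepDesc v).app s).hom (freeRepBasis (𝟙 s)) = v := by
  rw [freeRepDesc_app_basis]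
  simp

theorem freeRepDesc_comp {s : G} {X Y : G ⥤ ModuleCat.{u} k} (v : X.obj s) (f : X ⟶ Y) :
    freeRepDesc v ≫ f = freeRepDesc ((f.app s).hom v) := by
  refine freeRep_hom_ext ?_
  rw [freeRepDesc_app_one]
  exact congr_arg (f.app s).hom (freeRepDesc_app_one v)

theorem freeRepDesc_basis_one (s : G) : freeRepDesc (freeRepBasis (𝟙 s)) = 𝟙 (freeRep k s) :=
  freeRep_hom_ext (freeRepDesc_app_one _)

variable (k G) in
/-- The linearized Yoneda embedding. -/
def linYoneda : Gᵒᵖ ⥤ G ⥤ ModuleCat.{u} k where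
  obj s := freeRep k s.unop
  map f := freeRepDesc (freeRepBasis f.unop)
  map_id s := freeRepDesc_basis_one s.unop
  map_comp f g := by
    rw [freeRepDesc_comp, freeRepDesc_app_basis, freeRep_map_basis, unop_comp]

theorem freeRepDesc_comp_freeRepDesc {s t : G} (f : s ⟶ t) {X : G ⥤ ModuleCat.{u} k}
    (v : X.obj s) : freeRepDesc (freeRepBasis f) ≫ freeRepDesc v =
      freeRepDesc ((X.map f).hom v) := by
  rw [freeRepDesc_comp, freeRepDesc_app_basis]

/-- The element `x ⊗ y` of the pointwise tensor product. -/
def pureTensor {X Y : G ⥤ ModuleCat.{u} k} {s : G} (x : X.obj s) (y : Y.obj s) :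
    (X ⊗ Y : G ⥤ ModuleCat.{u} k).obj s :=
  x ⊗ₜ[k] y

theorem tensor_map_pureTensor {X Y : G ⥤ ModuleCat.{u} k} {s t : G} (f : s ⟶ t) (x : X.obj s)
    (y : Y.obj s) : ((X ⊗ Y).map f).hom (pureTensor x y) =
      pureTensor ((X.map f).hom x) ((Y.map f).hom y) := rfl

/-- The unit of the base field, as an element of the values of the unit object. -/
def unitOne (s : G) : (𝟙_ (G ⥤ ModuleCat.{u} k)).obj s := (1 : k)

/-- The counit `freeRep k s ⟶ 𝟙_` and the comultiplication `freeRep k s ⟶ freeRep k s ⊗ freeRep k s`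
for which the elements of the basis are group-like. -/
instance freeRepComonObj (s : G) : ComonObj (freeRep k s) where
  counit := freeRepDesc (unitOne s)
  comul := freeRepDesc (pureTensor (freeRepBasis (𝟙 s)) (freeRepBasis (𝟙 s)))
  counit_comul := by
    rw [freeRepDesc_comp]
    refine freeRep_hom_ext ((freeRepDesc_app_one _).trans ?_)
    exact congr_arg (pureTensor · (freeRepBasis (𝟙 s))) (freeRepDesc_app_one (unitOne s))
  comul_counit := by
    rw [freeRepDesc_comp]
    refine freeRep_hom_ext ((freeRepDesc_app_one _).trans ?_)
    exact congr_arg (pureTensor (freeRepBasis (𝟙 s)) ·) (freeRepDesc_app_one (unitOne s))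
  comul_assoc := by
    rw [freeRepDesc_comp, ← Category.assoc, freeRepDesc_comp, freeRepDesc_comp]
    congr 1
    have h := freeRepDesc_app_one (pureTensor (freeRepBasis (k := k) (𝟙 s)) (freeRepBasis (𝟙 s)))
    refine (congr_arg (pureTensor (freeRepBasis (𝟙 s)) ·) h).trans ?_
    exact (congr_arg (fun z => ((α_ (freeRep k s) (freeRep k s) (freeRep k s)).hom.app s).hom
      (pureTensor z (freeRepBasis (𝟙 s)))) h).symm

open scoped ComonObj

theorem freeRep_counit (s : G) : ε[freeRep k s] = freeRepDesc (unitOne s) := rfl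

theorem freeRep_comul (s : G) : Δ[freeRep k s] =
    freeRepDesc (pureTensor (freeRepBasis (𝟙 s)) (freeRepBasis (𝟙 s))) := rfl

instance (s : G) : IsCommComonObj (freeRep k s) where
  comul_comm := by
    rw [freeRep_comul, freeRepDesc_comp]
    rfl

instance {s t : Gᵒᵖ} (f : s ⟶ t) :
    IsComonHom (M := freeRep k s.unop) (N := freeRep k t.unop) ((linYoneda k G).map f) where
  hom_counit := freeRepDesc_comp_freeRepDesc f.unop _
  hom_comul := by
    refine (freeRepDesc_comp_freeRepDesc f.unop _).trans ?_
    rw [freeRep_comul, freeRepDesc_comp]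
    congr 1
    refine (tensor_map_pureTensor _ _ _).trans ?_
    rw [freeRep_map_basis, Category.id_comp]
    have h := freeRepDesc_app_one (freeRepBasis (k := k) f.unop)
    exact (congr_arg₂ pureTensor h h).symm

end Representable

/-! ### Comonoids in functor categories -/

section PointwiseComon

open ComonObj

variable {C : Type*} [Category* C] {A : Type*} [Category* A] [MonoidalCategory A]

/-- A functor whose values are compatibly comonoid objects is a comonoid object of the functor
category. -/
@[reducible]
def pointwiseComonObj (y : C ⥤ A) [∀ s, ComonObj (y.obj s)]
    [∀ {s t : C} (f : s ⟶ t), IsComonHom (y.map f)] : ComonObj y where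
  counit :=
    { app s := ε[y.obj s]
      naturality s t f := (IsComonHom.hom_counit (y.map f)).trans (Category.comp_id _).symm }
  comul :=
    { app s := Δ[y.obj s]
      naturality s t f := IsComonHom.hom_comul (y.map f) }
  counit_comul := by ext s; exact ComonObj.counit_comul (y.obj s)
  comul_counit := by ext s; exact ComonObj.comul_counit (y.obj s)
  comul_assoc := by ext s; exact ComonObj.comul_assoc (y.obj s)

/-- Braided functors preserve the commutativity of comonoid objects. -/
theorem map_comul_comp_δ_comm {A B : Type*} [Category* A] [MonoidalCategory A] [BraidedCategory A]
    [Category* B] [MonoidalCategory B] [BraidedCategory B] (F : A ⥤ B) [F.Braided] (X : A)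
    [ComonObj X] [IsCommComonObj X] :
    (F.map Δ[X] ≫ Functor.OplaxMonoidal.δ F X X) ≫ (β_ (F.obj X) (F.obj X)).hom =
      F.map Δ[X] ≫ Functor.OplaxMonoidal.δ F X X := by
  conv_rhs => rw [← IsCommComonObj.comul_comm X]
  rw [Functor.map_comp, Category.assoc, Category.assoc, Functor.map_braiding, Category.assoc,
    Category.assoc, Functor.Monoidal.μ_δ, Category.comp_id]

end PointwiseComon

/-! ### Images of representable functors under a symmetric monoidal functor -/

section PiOneToComon

open ComonObj Functor

variable {k : Type u} [Field k] {G : Type u} [Category.{u} G]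
  (h : (G ⥤ ModuleCat.{u} k) ⥤ ModuleCat.{u} k) [h.Braided]

instance (s : Gᵒᵖ) : ComonObj ((linYoneda k G ⋙ h).obj s) :=
  Functor.obj.instComonObj (freeRep k s.unop) h

instance {s t : Gᵒᵖ} (f : s ⟶ t) : IsComonHom ((linYoneda k G ⋙ h).map f) :=
  Functor.map.instIsComon_Hom (X := freeRep k s.unop) (Y := freeRep k t.unop) h
    ((linYoneda k G).map f)

instance : ComonObj (linYoneda k G ⋙ h) := pointwiseComonObj _

theorem linYoneda_comp_counit_app (s : Gᵒᵖ) :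
    (ε[linYoneda k G ⋙ h] : linYoneda k G ⋙ h ⟶ 𝟙_ _).app s =
      h.map ε[freeRep k s.unop] ≫ OplaxMonoidal.η h := rfl

theorem linYoneda_comp_comul_app (s : Gᵒᵖ) :
    (Δ[linYoneda k G ⋙ h] : linYoneda k G ⋙ h ⟶ _).app s =
      h.map Δ[freeRep k s.unop] ≫ OplaxMonoidal.δ h _ _ := rfl

instance : IsCommComonObj (linYoneda k G ⋙ h) where
  comul_comm := by
    ext s : 2
    exact map_comul_comp_δ_comm h (freeRep k s.unop)

end PiOneToComon

/-! ### Coalgebras in functor categories -/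

section CoalgebraObj

open ComonObj Opposite

variable {k : Type u} [Field k] {C : Type*} [Category* C]

/-- The values of a coalgebra in a category of functors to vector spaces are coalgebras. -/
instance coalgebraObj (y : C ⥤ ModuleCat.{u} k) [ComonObj y] (s : C) : Coalgebra k (y.obj s) where
  comul := ((Δ[y] : y ⟶ y ⊗ y).app s).hom
  counit := ((ε[y] : y ⟶ 𝟙_ (C ⥤ ModuleCat.{u} k)).app s).hom
  coassoc := (congr_arg (fun f => (f.app s).hom) (ComonObj.comul_assoc y)).symm
  rTensor_counit_comp_comul := congr_arg (fun f => (f.app s).hom) (ComonObj.counit_comul y)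
  lTensor_counit_comp_comul := congr_arg (fun f => (f.app s).hom) (ComonObj.comul_counit y)

instance (y : C ⥤ ModuleCat.{u} k) [ComonObj y] [IsCommComonObj y] (s : C) :
    Coalgebra.IsCocomm k (y.obj s) where
  comm_comp_comul := congr_arg (fun f => (f.app s).hom) (IsCommComonObj.comul_comm y)

/-- The structure maps of a coalgebra in a category of functors are morphisms of coalgebras. -/
def coalgHomMap (y : C ⥤ ModuleCat.{u} k) [ComonObj y] {s t : C} (f : s ⟶ t) :
    y.obj s →ₗc[k] y.obj t where
  toLinearMap := (y.map f).hom
  counit_comp := congr_arg ModuleCat.Hom.hom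
    (((ε[y] : y ⟶ 𝟙_ (C ⥤ ModuleCat.{u} k)).naturality f).trans (Category.comp_id _))
  map_comp_comul := (congr_arg ModuleCat.Hom.hom ((Δ[y] : y ⟶ y ⊗ y).naturality f)).symm

/-- The components of a morphism of coalgebras in a category of functors. -/
def coalgHomApp {y y' : C ⥤ ModuleCat.{u} k} [ComonObj y] [ComonObj y'] (f : y ⟶ y')
    [IsComonHom f] (s : C) : y.obj s →ₗc[k] y'.obj s where
  toLinearMap := (f.app s).hom
  counit_comp := congr_arg (fun f => (f.app s).hom) (IsComonHom.hom_counit f)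
  map_comp_comul := (congr_arg (fun f => (f.app s).hom) (IsComonHom.hom_comul f)).symm

theorem isComonHom_of_app {y y' : C ⥤ ModuleCat.{u} k} [ComonObj y] [ComonObj y'] (f : y ⟶ y')
    (h₁ : ∀ s, Coalgebra.counit ∘ₗ (f.app s).hom = (Coalgebra.counit : y.obj s →ₗ[k] k))
    (h₂ : ∀ s, Coalgebra.comul ∘ₗ (f.app s).hom =
      TensorProduct.map (f.app s).hom (f.app s).hom ∘ₗ Coalgebra.comul) : IsComonHom f where
  hom_counit := by
    ext s : 2
    exact ModuleCat.hom_ext (h₁ s)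
  hom_comul := by
    ext s : 2
    exact ModuleCat.hom_ext (h₂ s)

end CoalgebraObj

/-! ### Copowers of vector spaces -/

section Coproduct

variable {k : Type u} [Field k]

theorem familyMap_single_one_tmul {S : Type*} {M N : Type*} [AddCommGroup M] [Module k M]
    [AddCommGroup N] [Module k N] (f : S → M →ₗ[k] N) (s : S) (m : M) :
    familyMap f (Finsupp.single s 1 ⊗ₜ m) = f s m := by
  rw [familyMap_single_tmul, one_smul]

/-- The cofan exhibiting `k[S] ⊗ M` as a coproduct of copies of `M`. -/
def finsuppCofan (S : Type u) (M : ModuleCat.{u} k) : Cofan fun _ : S => M :=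
  Cofan.mk (ModuleCat.of k ((S →₀ k) ⊗[k] M)) fun s =>
    ModuleCat.ofHom (TensorProduct.mk k (S →₀ k) M (Finsupp.single s 1))

theorem familyMap_hom_ext {S : Type*} {M N : Type*} [AddCommGroup M] [Module k M] [AddCommGroup N]
    [Module k N] {f g : (S →₀ k) ⊗[k] M →ₗ[k] N}
    (h : ∀ s m, f (Finsupp.single s 1 ⊗ₜ m) = g (Finsupp.single s 1 ⊗ₜ m)) : f = g := by
  refine TensorProduct.ext (Finsupp.lhom_ext' fun s => LinearMap.ext_ring ?_)
  exact LinearMap.ext (h s)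

/-- The cofan `finsuppCofan` is colimiting. -/
def isColimitFinsuppCofan (S : Type u) (M : ModuleCat.{u} k) :
    IsColimit (finsuppCofan S M) :=
  Cofan.IsColimit.mk _ (fun c => ModuleCat.ofHom (familyMap fun s => (c.inj s).hom))
    (fun c s => by
      ext m
      exact familyMap_single_one_tmul _ _ _)
    (fun c f hf => by
      refine ModuleCat.hom_ext (familyMap_hom_ext fun s m => ?_)
      refine (ConcreteCategory.congr_hom (hf s) m).trans ?_
      exact (familyMap_single_one_tmul (k := k) (fun s => (c.inj s).hom) s m).symm)

/-- Maps out of the coproduct of copies of `M` are maps out of `k[S] ⊗ M`. -/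
theorem isIso_sigmaDesc_iff {S : Type u} {M N : ModuleCat.{u} k} (f : S → (M ⟶ N)) :
    IsIso (Sigma.desc f) ↔ Function.Bijective (familyMap fun s => (f s).hom) := by
  let e := (colimit.isColimit (Discrete.functor fun _ : S => M)).coconePointUniqueUpToIso
    (isColimitFinsuppCofan S M)
  let φ : (finsuppCofan S M).pt ⟶ N := ModuleCat.ofHom (familyMap fun s => (f s).hom)
  have h : Sigma.desc f = e.hom ≫ φ := by
    refine Sigma.hom_ext _ _ fun s => ?_
    rw [colimit.ι_desc]
    have h1 : Sigma.ι (fun _ : S => M) s ≫ e.hom = (finsuppCofan S M).inj s :=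
      IsColimit.comp_coconePointUniqueUpToIso_hom _ _ _
    refine Eq.trans ?_ (Category.assoc _ _ _)
    rw [h1]
    ext m
    exact (familyMap_single_one_tmul (k := k) (fun s => (f s).hom) s m).symm
  rw [h]
  exact (isIso_comp_left_iff e.hom φ).trans (ConcreteCategory.isIso_iff_bijective φ)

end Coproduct

/-! ### Torsors of vector spaces -/

section TorsorMap

open ComonObj Opposite

variable {k : Type u} [Field k] {G : Type u} [Groupoid.{u} G]

/-- The shear map of a family of linear maps is given by the formula that defines `torsorMap`. -/
theorem familyMap_comul_eq_shear {S : Type*} {C D : Type*} [AddCommGroup C] [Module k C]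
    [Coalgebra k C] [AddCommGroup D] [Module k D] (f : S → C →ₗ[k] D) :
    familyMap (fun s => (f s).lTensor C ∘ₗ Coalgebra.comul) = shear (familyMap f) := by
  refine familyMap_hom_ext fun s c => ?_
  rw [familyMap_single_tmul, one_smul]
  simp only [shear, LinearMap.comp_apply, LinearMap.lTensor_tmul, LinearEquiv.coe_coe]
  induction Coalgebra.comul (R := k) c using TensorProduct.induction_on with
  | zero => simp
  | add x y hx hy => simp only [TensorProduct.tmul_add, map_add, hx, hy]
  | tmul a b => simp

/-- The first torsor axiom says that a shear map is bijective. -/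
theorem isIso_torsorMap_iff (y : Gᵒᵖ ⥤ ModuleCat.{u} k) [ComonObj y] (s t : G) :
    IsIso (torsorMap y s t) ↔
      Function.Bijective (shear (familyMap fun g : s ⟶ t => (y.map g.op).hom)) := by
  rw [torsorMap, isIso_sigmaDesc_iff, ← familyMap_comul_eq_shear]
  rfl

theorem eq_zero_of_counit_eq_zero {C : Type*} [AddCommGroup C] [Module k C] [Coalgebra k C]
    (h : (Coalgebra.counit : C →ₗ[k] k) = 0) (c : C) : c = 0 := by
  have := Coalgebra.rTensor_counit_comul (R := k) c
  rw [h, LinearMap.rTensor_zero, LinearMap.zero_apply] at this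
  simpa using (congr_arg (TensorProduct.lid k C) this).symm

variable {y : CommComon (Gᵒᵖ ⥤ ModuleCat.{u} k)}

/-- A torsor is nonzero, because its colimit is the base field. -/
theorem IsTorsor.exists_nontrivial (hy : IsTorsor y) : ∃ t : G, Nontrivial (y.X.obj (op t)) := by
  by_contra! h
  obtain ⟨hc⟩ := hy.isColimit_counit
  have h1 : 𝟙 (𝟙_ (ModuleCat.{u} k)) = 0 := hc.hom_ext fun s => by
    ext m
    have : m = 0 := (h s.unop).elim _ _
    rw [this, map_zero, map_zero]
  have h2 := ConcreteCategory.congr_hom h1 (1 : k)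
  exact one_ne_zero h2

open Classical in
/-- A torsor vanishes on all connected components except one: the counit restricted to the component
of `t` is a cocone, hence a scalar multiple of the counit. The scalar is `1` because the counit does
not vanish at `t`, so the counit, and with it the coalgebra, vanishes on the other components. -/
theorem IsTorsor.subsingleton (hy : IsTorsor y) {s t : G} (ht : Nontrivial (y.X.obj (op t)))
    (hst : IsEmpty (s ⟶ t)) : Subsingleton (y.X.obj (op s)) := by
  obtain ⟨hc⟩ := hy.isColimit_counit
  -- The counit, restricted to the connected component of `t`.
  let c : Cocone y.X :=
    { pt := 𝟙_ (ModuleCat.{u} k)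
      ι :=
        { app := fun s => if Nonempty (s.unop ⟶ t) then (ε[y.X] : y.X ⟶ 𝟙_ _).app s else 0
          naturality := fun s s' f => by
            have : Nonempty (s.unop ⟶ t) ↔ Nonempty (s'.unop ⟶ t) :=
              ⟨fun ⟨g⟩ => ⟨f.unop ≫ g⟩, fun ⟨g⟩ => ⟨Groupoid.inv f.unop ≫ g⟩⟩
            rw [this]
            split_ifs with hs
            · exact (ε[y.X] : y.X ⟶ 𝟙_ _).naturality f
            · simp } }
  have hφ (s : Gᵒᵖ) : (ε[y.X] : y.X ⟶ 𝟙_ _).app s ≫ hc.desc c =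
    if Nonempty (s.unop ⟶ t) then (ε[y.X] : y.X ⟶ 𝟙_ _).app s else 0 := hc.fac c s
  have h1 := hφ (op t)
  rw [if_pos ⟨𝟙 t⟩] at h1
  have h2 := hφ (op s)
  rw [if_neg (by simpa using hst)] at h2
  obtain ⟨a, ha⟩ : ∃ a : y.X.obj (op t), (Coalgebra.counit a : k) ≠ 0 := by
    by_contra! h
    obtain ⟨a, ha⟩ := exists_ne (0 : y.X.obj (op t))
    exact ha (eq_zero_of_counit_eq_zero (LinearMap.ext h) a)
  let ψ : k →ₗ[k] k := (hc.desc c).hom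
  have hlin (b : k) : ψ b = b * ψ 1 := by
    rw [← smul_eq_mul, ← map_smul, smul_eq_mul, mul_one]
  have h3 : ψ 1 = 1 := by
    have h4 : ψ (Coalgebra.counit a) = Coalgebra.counit a := ConcreteCategory.congr_hom h1 a
    rw [hlin] at h4
    exact mul_left_cancel₀ ha (h4.trans (mul_one _).symm)
  refine subsingleton_of_forall_eq 0 fun b => eq_zero_of_counit_eq_zero (k := k) ?_ b
  refine LinearMap.ext fun b => ?_
  have h5 : ψ (Coalgebra.counit b) = 0 := ConcreteCategory.congr_hom h2 b
  rw [hlin, h3] at h5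
  exact (mul_one _).symm.trans h5

/-- The shear map is bijective even for objects in different components, where both sides vanish. -/
theorem IsTorsor.shear_bijective (hy : IsTorsor y) {t : G} (ht : Nontrivial (y.X.obj (op t)))
    (s : G) :
    Function.Bijective (shear (familyMap fun g : s ⟶ t => (y.X.map g.op).hom)) := by
  by_cases hst : Nonempty (s ⟶ t)
  · exact (isIso_torsorMap_iff y.X s t).mp (hy.isIso_torsorMap s t hst)
  · have := hy.subsingleton ht (not_nonempty_iff.mp hst)
    have := not_nonempty_iff.mp hst
    have h1 : Subsingleton (((s ⟶ t) →₀ k) ⊗[k] y.X.obj (op t)) := inferInstance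
    have h2 : Subsingleton (y.X.obj (op t) ⊗[k] y.X.obj (op s)) := inferInstance
    exact ⟨fun _ _ _ => Subsingleton.elim _ _, fun b => ⟨0, Subsingleton.elim _ _⟩⟩

end TorsorMap

/-! ### Points of torsors -/

section TorsorPoints

open ComonObj Opposite

variable {k : Type u} [Field k] {G : Type u} [Groupoid.{u} G] {K : Type u} [Field K] [Algebra k K]

local infixl:70 " ⊠ " => box

/-- The linear map `y(t) → y(s)` induced by `g : s ⟶ t`. -/
def pull (y : Gᵒᵖ ⥤ ModuleCat.{u} k) {s t : G} (g : s ⟶ t) : y.obj (op t) →ₗ[k] y.obj (op s) :=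
  (y.map g.op).hom

theorem pull_id (y : Gᵒᵖ ⥤ ModuleCat.{u} k) (t : G) : pull y (𝟙 t) = LinearMap.id :=
  congr_arg ModuleCat.Hom.hom (y.map_id (op t))

theorem pull_comp (y : Gᵒᵖ ⥤ ModuleCat.{u} k) {r s t : G} (f : r ⟶ s) (g : s ⟶ t) :
    pull y (f ≫ g) = pull y f ∘ₗ pull y g :=
  congr_arg ModuleCat.Hom.hom (y.map_comp g.op f.op)

theorem pull_comp_apply (y : Gᵒᵖ ⥤ ModuleCat.{u} k) {r s t : G} (f : r ⟶ s) (g : s ⟶ t)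
    (x : K ⊗[k] y.obj (op t)) :
    (pull y (f ≫ g)).baseChange K x = (pull y f).baseChange K ((pull y g).baseChange K x) := by
  rw [pull_comp, baseChange_comp_apply]

theorem pull_naturality {y y' : Gᵒᵖ ⥤ ModuleCat.{u} k} (f : y ⟶ y') {s t : G} (g : s ⟶ t)
    (x : K ⊗[k] y.obj (op t)) :
    (f.app (op s)).hom.baseChange K ((pull y g).baseChange K x) =
      (pull y' g).baseChange K ((f.app (op t)).hom.baseChange K x) := by
  rw [← baseChange_comp_apply, ← baseChange_comp_apply]
  exact congr_arg (fun φ : y.obj (op t) ⟶ y'.obj (op s) => φ.hom.baseChange K x)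
    (f.naturality g.op)

theorem IsPoint.pull {y : Gᵒᵖ ⥤ ModuleCat.{u} k} [ComonObj y] {s t : G} (g : s ⟶ t)
    {x : K ⊗[k] y.obj (op t)} (hx : IsPoint x) : IsPoint ((pull y g).baseChange K x) :=
  hx.map (coalgHomMap y g.op)

theorem IsPoint.app {y y' : Gᵒᵖ ⥤ ModuleCat.{u} k} [ComonObj y] [ComonObj y'] (f : y ⟶ y')
    [IsComonHom f] {t : G} {x : K ⊗[k] y.obj (op t)} (hx : IsPoint x) :
    IsPoint ((f.app (op t)).hom.baseChange K x) :=
  hx.map (coalgHomApp f (op t))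

theorem IsPoint.ne_zero {C : Type*} [AddCommGroup C] [Module k C] [Coalgebra k C] {x : K ⊗[k] C}
    (hx : IsPoint x) : x ≠ 0 := by
  rintro rfl
  have h := hx.counit
  rw [map_zero] at h
  exact one_ne_zero ((one_tmul_injective (k := k) (K := K))
    (h.symm.trans (TensorProduct.tmul_zero _ _).symm))

theorem IsPoint.nontrivial {C : Type*} [AddCommGroup C] [Module k C] [Coalgebra k C]
    {x : K ⊗[k] C} (hx : IsPoint x) : Nontrivial C := by
  by_contra h
  rw [not_nontrivial_iff_subsingleton] at h
  exact hx.ne_zero (Subsingleton.elim _ _)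

variable {y y' : CommComon (Gᵒᵖ ⥤ ModuleCat.{u} k)}

/-- The translates of a point of a torsor form bases of all of its values. -/
def torsorBasis (hy : IsTorsor y) {t : G} {x : K ⊗[k] y.X.obj (op t)} (hx : IsPoint x) (s : G) :
    Module.Basis (s ⟶ t) K (K ⊗[k] y.X.obj (op s)) :=
  familyBasis (f := fun g : s ⟶ t => pull y.X g) (hy.shear_bijective hx.nontrivial s) hx

theorem torsorBasis_apply (hy : IsTorsor y) {t : G} {x : K ⊗[k] y.X.obj (op t)} (hx : IsPoint x)
    {s : G} (g : s ⟶ t) : torsorBasis hy hx s g = (pull y.X g).baseChange K x :=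
  familyBasis_apply _ _ _

/-- Any two points of a torsor are translates of each other. -/
theorem IsTorsor.exists_eq_pull (hy : IsTorsor y) {s t : G} {x : K ⊗[k] y.X.obj (op t)}
    (hx : IsPoint x) {z : K ⊗[k] y.X.obj (op s)} (hz : IsPoint z) :
    ∃ g : s ⟶ t, z = (pull y.X g).baseChange K x := by
  obtain ⟨g, hg⟩ := IsPoint.exists_eq_basis (torsorBasis hy hx s) (fun g => by
    rw [torsorBasis_apply]
    exact hx.pull g) hz
  exact ⟨g, hg.trans (torsorBasis_apply hy hx g)⟩

/-- The groupoid acts freely on the points of a torsor. -/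
theorem IsTorsor.pull_injective (hy : IsTorsor y) {s t : G} {x : K ⊗[k] y.X.obj (op t)}
    (hx : IsPoint x) {g g' : s ⟶ t}
    (h : (pull y.X g).baseChange K x = (pull y.X g').baseChange K x) : g = g' := by
  rw [← torsorBasis_apply hy hx, ← torsorBasis_apply hy hx] at h
  exact (torsorBasis hy hx s).injective h

/-- A morphism out of a torsor is determined by the image of a point. -/
theorem IsTorsor.hom_ext (hy : IsTorsor y) {t : G} {x : K ⊗[k] y.X.obj (op t)} (hx : IsPoint x)
    {z : Gᵒᵖ ⥤ ModuleCat.{u} k} {f f' : y.X ⟶ z}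
    (h : (f.app (op t)).hom.baseChange K x = (f'.app (op t)).hom.baseChange K x) : f = f' := by
  ext s : 2
  refine ModuleCat.hom_ext (baseChange_injective (K := K) ?_)
  refine (torsorBasis hy hx s.unop).ext fun g => ?_
  rw [torsorBasis_apply]
  exact (pull_naturality f g x).trans ((congr_arg _ h).trans (pull_naturality f' g x).symm)

/-- The Galois group acts on a point `x` of a functor `y` through `ρ`. -/
structure IsPointOver (ρ : SingleObj Gal(K/k) ⥤ G) (y : Gᵒᵖ ⥤ ModuleCat.{u} k) [ComonObj y]
    (x : K ⊗[k] y.obj (op (ρ.obj (SingleObj.star _)))) : Prop where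
  isPoint : IsPoint x
  galAct_eq (γ : Gal(K/k)) :
    galAct γ x = (pull y (ρ.map (SingleObj.toEnd _ γ))).baseChange K x

theorem IsPointOver.app {ρ : SingleObj Gal(K/k) ⥤ G} {y y' : Gᵒᵖ ⥤ ModuleCat.{u} k} [ComonObj y]
    [ComonObj y'] {x : K ⊗[k] y.obj (op (ρ.obj (SingleObj.star _)))} (hx : IsPointOver ρ y x)
    (f : y ⟶ y') [IsComonHom f] : IsPointOver ρ y' ((f.app (op _)).hom.baseChange K x) where
  isPoint := hx.isPoint.app f
  galAct_eq γ := by rw [galAct_baseChange, hx.galAct_eq, pull_naturality]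

/-- If the Galois group acts in the same way on points of two coalgebras, the first of which is a
torsor, then there is a morphism sending one point to the other. Over `K` it is determined by
sending translates to translates, and it descends because it commutes with the Galois action. -/
theorem IsTorsor.exists_app_eq [IsGalois k K] (hy : IsTorsor y)
    {ρ : SingleObj Gal(K/k) ⥤ G} {x : K ⊗[k] y.X.obj (op (ρ.obj (SingleObj.star _)))}
    (hx : IsPointOver ρ y.X x) {x' : K ⊗[k] y'.X.obj (op (ρ.obj (SingleObj.star _)))}
    (hx' : IsPointOver ρ y'.X x') :
    ∃ f : y.X ⟶ y'.X, IsComonHom f ∧ (f.app (op _)).hom.baseChange K x = x' := by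
  let b (s : G) := torsorBasis hy hx.isPoint s
  have hb {s : G} (g : s ⟶ _) : b s g = (pull y.X g).baseChange K x :=
    torsorBasis_apply hy hx.isPoint g
  -- The linear map sending each translate of `x` to the corresponding translate of `x'`.
  let F (s : G) : K ⊗[k] y.X.obj (op s) →ₗ[K] K ⊗[k] y'.X.obj (op s) :=
    (b s).constr K fun g => (pull y'.X g).baseChange K x'
  have hF {s : G} (g : s ⟶ _) :
      F s ((pull y.X g).baseChange K x) = (pull y'.X g).baseChange K x' := by
    rw [← hb]
    exact (b s).constr_basis K _ g
  have hgal (s : G) (γ : Gal(K/k)) (z) : F s (galAct γ z) = galAct γ (F s z) := by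
    induction (b s).mem_span z using Submodule.span_induction with
    | zero => simp only [map_zero]
    | add z z' _ _ h h' => simp only [map_add, h, h']
    | smul a z _ h => rw [galAct_smul, map_smul, map_smul, galAct_smul, h]
    | mem z hz =>
      obtain ⟨g, rfl⟩ := hz
      rw [hb, galAct_baseChange, hx.galAct_eq, ← pull_comp_apply, hF, hF, galAct_baseChange,
        hx'.galAct_eq, ← pull_comp_apply]
  choose f hf using fun s => exists_baseChange_eq (F s) (hgal s)
  have hfx {s : G} (g : s ⟶ _) :
      (f s).baseChange K ((pull y.X g).baseChange K x) = (pull y'.X g).baseChange K x' := by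
    rw [hf, hF]
  let φ : y.X ⟶ y'.X :=
    { app s := ModuleCat.ofHom (f s.unop)
      naturality s s' g := by
        refine ModuleCat.hom_ext (baseChange_injective (K := K) ?_)
        refine (b s.unop).ext fun a => ?_
        rw [hb]
        change (f s'.unop ∘ₗ pull y.X g.unop).baseChange K _ =
          (pull y'.X g.unop ∘ₗ f s.unop).baseChange K _
        rw [baseChange_comp_apply, baseChange_comp_apply, hfx, ← pull_comp_apply, hfx,
          pull_comp_apply] }
  refine ⟨φ, isComonHom_of_app φ (fun s => ?_) (fun s => ?_), ?_⟩
  · refine baseChange_injective (K := K) ((b s.unop).ext fun g => ?_)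
    rw [hb]
    refine (baseChange_comp_apply _ (f s.unop) _).trans ?_
    rw [hfx]
    exact (hx'.isPoint.pull g).counit.trans (hx.isPoint.pull g).counit.symm
  · refine baseChange_injective (K := K) ((b s.unop).ext fun g => ?_)
    rw [hb]
    refine (baseChange_comp_apply _ (f s.unop) _).trans ?_
    refine Eq.trans ?_ (baseChange_comp_apply (TensorProduct.map (f s.unop) (f s.unop)) _ _).symm
    rw [hfx]
    refine (hx'.isPoint.pull g).comul.trans ?_
    refine Eq.trans ?_ (congr_arg _ (hx.isPoint.pull g).comul.symm)
    rw [baseChange_map_box, hfx]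
  · have h := hfx (𝟙 _)
    rwa [pull_id, pull_id, LinearMap.baseChange_id, LinearMap.baseChange_id] at h

/-- An arrow relating points on which the Galois group acts through `ρ` and `ρ'` intertwines `ρ` and
`ρ'`. -/
theorem IsTorsor.map_comp_eq (hy : IsTorsor y) {ρ ρ' : SingleObj Gal(K/k) ⥤ G}
    {x : K ⊗[k] y.X.obj (op (ρ'.obj (SingleObj.star _)))} (hx : IsPointOver ρ' y.X x)
    (g : ρ.obj (SingleObj.star _) ⟶ ρ'.obj (SingleObj.star _))
    (hz : IsPointOver ρ y.X ((pull y.X g).baseChange K x)) (γ : Gal(K/k)) :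
    ρ.map (SingleObj.toEnd _ γ) ≫ g = g ≫ ρ'.map (SingleObj.toEnd _ γ) := by
  refine hy.pull_injective hx.isPoint ?_
  rw [pull_comp_apply, pull_comp_apply, ← hz.galAct_eq, galAct_baseChange, hx.galAct_eq]

/-- The action of the Galois group on `K ⊗ M` is continuous for the discrete topology, because a
vector of `K ⊗ M` involves only finitely many scalars. -/
theorem eventually_galAct_eq [Algebra.IsAlgebraic k K] {M : Type*} [AddCommMonoid M] [Module k M]
    (x : K ⊗[k] M) : ∀ᶠ γ in nhds (1 : Gal(K/k)), galAct γ x = x := by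
  induction x using box_induction with
  | add x y hx hy => filter_upwards [hx, hy] with γ h h' using by rw [map_add, h, h']
  | tmul a m =>
    have := IntermediateField.adjoin.finiteDimensional (Algebra.IsIntegral.isIntegral (R := k) a)
    filter_upwards [((IntermediateField.adjoin k {a}).fixingSubgroup_isOpen).mem_nhds
      (one_mem _)] with γ hγ
    have h := (IntermediateField.mem_fixingSubgroup_iff _ γ).mp hγ a
      (IntermediateField.mem_adjoin_simple_self k a)
    rw [galAct_tmul, h]

/-- Every torsor acquires a point over a separably closed extension, and the Galois group acts on
it through a continuous functor. -/
theorem IsTorsor.exists_isPointOver [IsGalois k K] [IsSepClosed K] (hy : IsTorsor y) :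
    ∃ (ρ : ContHom Gal(K/k) G) (x : K ⊗[k] y.X.obj (op (ρ.obj.obj (SingleObj.star _)))),
      IsPointOver ρ.obj y.X x := by
  obtain ⟨t, ht⟩ := hy.exists_nontrivial
  have := ht
  obtain ⟨x, hx⟩ := exists_isPoint (k := k) (C := y.X.obj (op t))
    (f := fun g : t ⟶ t => coalgHomMap y.X g.op) (s₀ := 𝟙 t)
    (by ext c; exact LinearMap.congr_fun (pull_id y.X t) c) (hy.shear_bijective ht t) K
  choose r hr using fun γ => hy.exists_eq_pull hx (hx.galAct γ)
  have hone : r 1 = 𝟙 t := hy.pull_injective hx (by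
    rw [← hr, pull_id, LinearMap.baseChange_id]
    exact LinearMap.congr_fun (LinearMap.rTensor_id _ _) x)
  have hmul (γ δ : Gal(K/k)) : r (δ * γ) = r γ ≫ r δ := hy.pull_injective hx (by
    rw [pull_comp_apply, ← hr, ← hr, galAct_mul, hr γ, galAct_baseChange])
  let ρ : SingleObj Gal(K/k) ⥤ G :=
    { obj _ := t
      map := fun γ => r γ
      map_id _ := hone
      map_comp γ δ := hmul γ δ }
  refine ⟨⟨ρ, ?_⟩, x, hx, hr⟩
  let : TopologicalSpace (t ⟶ t) := ⊥
  refine (continuous_iff_continuousAt (f := r)).mpr fun γ => ?_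
  refine ContinuousAt.congr (f := fun _ => r γ) continuousAt_const ?_
  have h : ContinuousAt (fun δ : Gal(K/k) => γ⁻¹ * δ) γ := (continuous_const_mul _).continuousAt
  have h' := eventually_galAct_eq (k := k) x
  rw [← inv_mul_cancel γ] at h'
  filter_upwards [h.eventually h'] with δ hδ
  refine hy.pull_injective hx ?_
  rw [← hr, ← hr]
  conv_lhs => rw [← hδ, ← galAct_mul, mul_inv_cancel_left]

end TorsorPoints

/-! ### The action of vector spaces on the values of a morphism of algebras -/

section FibreFunctor

open Functor Functor.LaxMonoidal ComonObj Opposite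

variable {k : Type u} [Field k] {G : Type u} [Groupoid.{u} G] (h : PiOne (ModuleCat.{u} k) G)

/-- The isomorphism `V ≅ h(const V)` that is part of a morphism of algebras. -/
def unitIso (V : ModuleCat.{u} k) : V ≅ h.hom.functor.obj ((Functor.const G).obj V) where
  hom := h.unit.hom.hom.app V
  inv := h.unit.inv.hom.app V
  hom_inv_id := congr_arg (fun τ => τ.hom.app V) h.unit.hom_inv_id
  inv_hom_id := congr_arg (fun τ => τ.hom.app V) h.unit.inv_hom_id

theorem unitIso_naturality {V W : ModuleCat.{u} k} (f : V ⟶ W) :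
    f ≫ (unitIso h W).hom =
      (unitIso h V).hom ≫ h.hom.functor.map ((Functor.const G).map f) :=
  h.unit.hom.hom.naturality f

theorem unitIso_one : (unitIso h (𝟙_ _)).hom = LaxMonoidal.ε h.hom.functor := by
  have h1 := (h.unit.hom.isMonoidal).unit
  refine (Category.id_comp _).symm.trans (h1.trans ?_)
  exact (congr_arg (LaxMonoidal.ε h.hom.functor ≫ ·) (h.hom.functor.map_id _)).trans
    (Category.comp_id _)

/-- The isomorphism `V ⊗ h(M) ≅ h(const V ⊗ M)`. -/
def actIso (V : ModuleCat.{u} k) (M : G ⥤ ModuleCat.{u} k) :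
    V ⊗ h.hom.functor.obj M ≅ h.hom.functor.obj ((Functor.const G).obj V ⊗ M) :=
  whiskerRightIso (unitIso h V) _ ≪≫ Functor.Monoidal.μIso h.hom.functor _ _

theorem actIso_hom (V : ModuleCat.{u} k) (M : G ⥤ ModuleCat.{u} k) :
    (actIso h V M).hom = (unitIso h V).hom ▷ _ ≫ μ h.hom.functor _ _ := rfl

theorem actIso_naturality {V W : ModuleCat.{u} k} (f : V ⟶ W) (M : G ⥤ ModuleCat.{u} k) :
    f ▷ _ ≫ (actIso h W M).hom =
      (actIso h V M).hom ≫ h.hom.functor.map ((Functor.const G).map f ▷ M) := by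
  rw [actIso_hom, actIso_hom, ← Category.assoc, ← comp_whiskerRight, unitIso_naturality,
    comp_whiskerRight, Category.assoc, Category.assoc, μ_natural_left]

/-- The map `M ⟶ const V ⊗ M` sending `m` to `v ⊗ m`. -/
def insertLeft {V : ModuleCat.{u} k} (v : V) (M : G ⥤ ModuleCat.{u} k) :
    M ⟶ (Functor.const G).obj V ⊗ M :=
  (λ_ M).inv ≫ (Functor.const G).map (X := 𝟙_ _)
    (ModuleCat.ofHom (LinearMap.toSpanSingleton k V v)) ▷ M

theorem insertLeft_app {V : ModuleCat.{u} k} (v : V) (M : G ⥤ ModuleCat.{u} k) (s : G)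
    (m : M.obj s) : ((insertLeft v M).app s).hom m =
      pureTensor (X := (Functor.const G).obj V) (Y := M) (s := s) v m :=
  congr_arg (fun v => pureTensor (X := (Functor.const G).obj V) (Y := M) (s := s) v m)
    (one_smul k v)

/-- The isomorphism `V ⊗ h(M) ≅ h(const V ⊗ M)` can be described without reference to the monoidal
structure of `h`. -/
theorem actIso_tmul {V : ModuleCat.{u} k} (v : V) {M : G ⥤ ModuleCat.{u} k}
    (c : h.hom.functor.obj M) :
    (actIso h V M).hom.hom (v ⊗ₜ c) = (h.hom.functor.map (insertLeft v M)).hom c := by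
  let f : 𝟙_ (ModuleCat.{u} k) ⟶ V := ModuleCat.ofHom (LinearMap.toSpanSingleton k V v)
  have h1 : (actIso h (𝟙_ (ModuleCat.{u} k)) M).hom =
      (λ_ (h.hom.functor.obj M)).hom ≫ h.hom.functor.map (λ_ M).inv := by
    rw [actIso_hom, unitIso_one, left_unitality, Category.assoc, Category.assoc,
      ← h.hom.functor.map_comp]
    refine congr_arg (_ ≫ ·) ?_
    exact ((congr_arg (μ h.hom.functor (𝟙_ _) M ≫ ·) ((congr_arg h.hom.functor.map
      (λ_ M).hom_inv_id).trans (h.hom.functor.map_id _))).trans (Category.comp_id _)).symm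
  have h2 : (λ_ (h.hom.functor.obj M)).inv ≫ f ▷ _ ≫ (actIso h V M).hom =
      h.hom.functor.map (insertLeft v M) := by
    rw [actIso_naturality, h1, Category.assoc, Iso.inv_hom_id_assoc]
    exact (h.hom.functor.map_comp _ _).symm
  rw [← h2]
  refine congr_arg (fun v : V => (actIso h V M).hom.hom (v ⊗ₜ c)) ?_
  exact (one_smul k v).symm

theorem const_tensor_freeRep_hom_ext {V : ModuleCat.{u} k} {t s : G} {N : ModuleCat.{u} k}
    {f g : ((Functor.const G).obj V ⊗ freeRep k t : G ⥤ ModuleCat.{u} k).obj s ⟶ N}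
    (h : ∀ (v : V) (a : t ⟶ s),
      f.hom (pureTensor (X := (Functor.const G).obj V) (s := s) v (freeRepBasis a)) =
        g.hom (pureTensor (X := (Functor.const G).obj V) (s := s) v (freeRepBasis a))) : f = g :=
  ModuleCat.hom_ext (TensorProduct.ext (LinearMap.ext fun v =>
    Finsupp.lhom_ext' fun a => LinearMap.ext_ring (h v a)))

/-- The natural transformation `const V ⊗ k[t, -] ⟶ X` sending `v ⊗ a` to `X(a)(f(v))`. -/
def constTensorDesc {V : ModuleCat.{u} k} {t : G} {X : G ⥤ ModuleCat.{u} k}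
    (f : V ⟶ X.obj t) : (Functor.const G).obj V ⊗ freeRep k t ⟶ X where
  app s := ModuleCat.ofHom (Y := X.obj s)
    (familyMap (fun a : t ⟶ s => (f ≫ X.map a).hom) ∘ₗ (TensorProduct.comm k _ _).toLinearMap)
  naturality s s' b := const_tensor_freeRep_hom_ext fun v a => by
    have key {s : G} (a : t ⟶ s) : familyMap (fun a : t ⟶ s => (f ≫ X.map a).hom)
        (Finsupp.single a 1 ⊗ₜ v) = (X.map a).hom (f.hom v) := familyMap_single_one_tmul _ _ _
    have h1 : ((Functor.const G).obj V ⊗ freeRep k t).map b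
        (pureTensor (X := (Functor.const G).obj V) (s := s) v (freeRepBasis a)) =
        pureTensor (X := (Functor.const G).obj V) (s := s') v (freeRepBasis (a ≫ b)) :=
      (tensor_map_pureTensor _ _ _).trans (congr_arg _ (freeRep_map_basis a b))
    refine (congr_arg (fun z => familyMap (fun a : t ⟶ s' => (f ≫ X.map a).hom)
      (TensorProduct.comm k _ _ z)) h1).trans ?_
    refine (key (a ≫ b)).trans (Eq.trans ?_ (congr_arg (X.map b).hom (key a).symm))
    exact ConcreteCategory.congr_hom (X.map_comp a b) (f.hom v)

theorem constTensorDesc_app {V : ModuleCat.{u} k} {t : G} {X : G ⥤ ModuleCat.{u} k}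
    (f : V ⟶ X.obj t) {s : G} (v : V) (a : t ⟶ s) :
    ((constTensorDesc f).app s).hom
      (pureTensor (X := (Functor.const G).obj V) (s := s) v (freeRepBasis a)) =
      (X.map a).hom (f.hom v) :=
  familyMap_single_one_tmul (fun a : t ⟶ s => (f ≫ X.map a).hom) a v

theorem insertLeft_comp_constTensorDesc {V : ModuleCat.{u} k} {t : G} {X : G ⥤ ModuleCat.{u} k}
    (f : V ⟶ X.obj t) (v : V) :
    insertLeft v (freeRep k t) ≫ constTensorDesc f = freeRepDesc (f.hom v) := by
  refine freeRep_hom_ext (Eq.trans ?_ (freeRepDesc_app_one _).symm)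
  refine (congr_arg ((constTensorDesc f).app t).hom (insertLeft_app v _ t _)).trans ?_
  refine (constTensorDesc_app f v (𝟙 t)).trans ?_
  rw [X.map_id]
  rfl

/-- The map `X(t) ⊗ h(k[t, -]) ⟶ h(X)` induced by the evaluation `const X(t) ⊗ k[t, -] ⟶ X`. -/
def fibreMap (X : G ⥤ ModuleCat.{u} k) (t : G) :
    X.obj t ⊗[k] h.hom.functor.obj (freeRep k t) →ₗ[k] h.hom.functor.obj X :=
  ((actIso h (X.obj t) (freeRep k t)).hom ≫ h.hom.functor.map (constTensorDesc (𝟙 _))).hom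

theorem fibreMap_tmul {X : G ⥤ ModuleCat.{u} k} {t : G} (v : X.obj t)
    (c : h.hom.functor.obj (freeRep k t)) :
    fibreMap h X t (v ⊗ₜ c) = (h.hom.functor.map (freeRepDesc v)).hom c := by
  refine (congr_arg _ (actIso_tmul h v c)).trans ?_
  refine (ConcreteCategory.congr_hom (h.hom.functor.map_comp _ _) c).symm.trans ?_
  exact congr_arg (fun f => (h.hom.functor.map f).hom c) (insertLeft_comp_constTensorDesc _ v)

/-- The coalgebra structure of `h(k[t, -])`. -/
instance fibreCoalgebra (t : G) : Coalgebra k (h.hom.functor.obj (freeRep k t)) :=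
  coalgebraObj (linYoneda k G ⋙ h.hom.functor) (op t)

/-- The map `const X(t) ⊗ k[t, -] ⟶ k[t, -] ⊗ X` sending `v ⊗ a` to `a ⊗ X(a)(v)`. -/
def constShear (X : G ⥤ ModuleCat.{u} k) (t : G) :
    (Functor.const G).obj (X.obj t) ⊗ freeRep k t ⟶ freeRep k t ⊗ X :=
  constTensorDesc (ModuleCat.ofHom (TensorProduct.mk k _ _ (freeRepBasis (𝟙 t))))

theorem constShear_app {X : G ⥤ ModuleCat.{u} k} {t s : G} (v : X.obj t) (a : t ⟶ s) :
    ((constShear X t).app s).hom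
      (pureTensor (X := (Functor.const G).obj (X.obj t)) (s := s) v (freeRepBasis a)) =
      pureTensor (freeRepBasis a) ((X.map a).hom v) := by
  refine (constTensorDesc_app _ v a).trans ((tensor_map_pureTensor _ _ _).trans ?_)
  rw [freeRep_map_basis, Category.id_comp]

/-- Since `G` is a groupoid, `a ⊗ w ↦ X(a⁻¹)(w) ⊗ a` is inverse to `constShear`. -/
instance (X : G ⥤ ModuleCat.{u} k) (t : G) : IsIso (constShear X t) := by
  have h (s : G) : IsIso ((constShear X t).app s) := by
    let r : (freeRep k t ⊗ X : G ⥤ ModuleCat.{u} k).obj s ⟶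
        ((Functor.const G).obj (X.obj t) ⊗ freeRep k t : G ⥤ ModuleCat.{u} k).obj s :=
      ModuleCat.ofHom (familyMap fun a : t ⟶ s =>
        (TensorProduct.mk k (X.obj t) ((t ⟶ s) →₀ k)).flip (Finsupp.single a 1) ∘ₗ
          (X.map (Groupoid.inv a)).hom)
    have hr (a : t ⟶ s) (w : X.obj s) : r.hom (pureTensor (freeRepBasis a) w) =
        pureTensor (X := (Functor.const G).obj (X.obj t)) (s := s)
          ((X.map (Groupoid.inv a)).hom w) (freeRepBasis a) :=
      familyMap_single_one_tmul (fun a : t ⟶ s =>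
        (TensorProduct.mk k (X.obj t) ((t ⟶ s) →₀ k)).flip (Finsupp.single a 1) ∘ₗ
          (X.map (Groupoid.inv a)).hom) a w
    refine ⟨r, const_tensor_freeRep_hom_ext fun v a => ?_,
      ModuleCat.hom_ext (familyMap_hom_ext fun a w => ?_)⟩
    · refine (congr_arg r.hom (constShear_app v a)).trans ((hr _ _).trans ?_)
      refine congr_arg (fun v => pureTensor (X := (Functor.const G).obj (X.obj t)) (s := s) v
        (freeRepBasis a)) ?_
      refine (ConcreteCategory.congr_hom (X.map_comp a (Groupoid.inv a)) v).symm.trans ?_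
      rw [Groupoid.comp_inv, X.map_id]
      rfl
    · refine (congr_arg ((constShear X t).app s).hom (hr a w)).trans
        ((constShear_app _ a).trans ?_)
      refine congr_arg (pureTensor (freeRepBasis a)) ?_
      refine (ConcreteCategory.congr_hom (X.map_comp (Groupoid.inv a) a) w).symm.trans ?_
      rw [Groupoid.inv_comp, X.map_id]
      rfl
  exact NatIso.isIso_of_isIso_app _

/-- The shear map `X(t) ⊗ h(k[t, -]) → h(k[t, -]) ⊗ h(X)` is the image under `h` of the isomorphism
`constShear`, up to the structure isomorphisms of `h`. Hence points of `h(k[t, -])` trivialize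
`h(X)`. -/
theorem shear_fibreMap_bijective (X : G ⥤ ModuleCat.{u} k) (t : G) :
    Function.Bijective (shear (fibreMap h X t)) := by
  let H := h.hom.functor
  let m := (μ H (freeRep k t) X).hom
  let e := (actIso h (X.obj t) (freeRep k t)).hom ≫ H.map (constShear X t)
  have hm : Function.Bijective m :=
    (ConcreteCategory.isIso_iff_bijective (μ H (freeRep k t) X)).mp inferInstance
  have he : Function.Bijective e.hom :=
    (ConcreteCategory.isIso_iff_bijective e).mp inferInstance
  have key : m ∘ₗ shear (fibreMap h X t) = e.hom := by
    refine TensorProduct.ext' fun v c => ?_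
    -- Both sides are the image of `c` under the map `k[t, -] ⟶ k[t, -] ⊗ X` given by `1 ⊗ v`.
    let f : freeRep k t ⟶ freeRep k t ⊗ X := freeRepDesc (pureTensor (freeRepBasis (𝟙 t)) v)
    have h1 : e.hom (v ⊗ₜ c) = (H.map f).hom c := by
      refine (congr_arg _ (actIso_tmul h v c)).trans ?_
      refine (ConcreteCategory.congr_hom (H.map_comp _ _) c).symm.trans ?_
      exact congr_arg (fun f => (H.map f).hom c) (insertLeft_comp_constTensorDesc _ v)
    have h2 : shear (fibreMap h X t) (v ⊗ₜ c) =
        (H.map (freeRepDesc v)).hom.lTensor _ (Coalgebra.comul (R := k) c) := by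
      simp only [shear, LinearMap.comp_apply, LinearMap.lTensor_tmul, LinearEquiv.coe_coe]
      induction Coalgebra.comul (R := k) c using TensorProduct.induction_on with
      | zero => simp
      | add x y hx hy => simp only [TensorProduct.tmul_add, _root_.map_add, hx, hy]
      | tmul a b =>
        rw [TensorProduct.leftComm_tmul, LinearMap.lTensor_tmul, fibreMap_tmul,
          LinearMap.lTensor_tmul]
    have h3 : (H.map Δ[freeRep k t] ≫ OplaxMonoidal.δ H _ _) ≫ H.obj (freeRep k t) ◁
        H.map (freeRepDesc v) ≫ μ H (freeRep k t) X = H.map f := by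
      rw [μ_natural_right, Category.assoc, Functor.Monoidal.δ_μ_assoc, ← H.map_comp]
      refine congr_arg H.map ?_
      rw [freeRep_comul, freeRepDesc_comp]
      exact congr_arg (fun v => freeRepDesc (pureTensor (freeRepBasis (𝟙 t)) v))
        (freeRepDesc_app_one v)
    rw [h1, LinearMap.comp_apply, h2, ← h3]
    rfl
  rw [← key] at he
  exact (Function.Bijective.of_comp_iff' hm _).mp he

end FibreFunctor

/-! ### The torsor of a morphism of algebras -/

section FibreTorsor

open Functor Functor.LaxMonoidal ComonObj Opposite

variable {k : Type u} [Field k] {G : Type u}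

/-- The cocone with vertex the unit object under the linearized Yoneda embedding. -/
def linYonedaCocone (k : Type u) [Field k] (G : Type u) [Category.{u} G] :
    Cocone (linYoneda k G) where
  pt := 𝟙_ _
  ι :=
    { app s := freeRepDesc (unitOne s.unop)
      naturality _ _ _ := (freeRepDesc_comp_freeRepDesc _ _).trans (Category.comp_id _).symm }

/-- The unit object is the colimit of the linearized representable functors. -/
def isColimitLinYonedaCocone (k : Type u) [Field k] (G : Type u) [Category.{u} G] :
    IsColimit (linYonedaCocone k G) where
  desc c :=
    { app u := ModuleCat.ofHom (Y := c.pt.obj u) (LinearMap.toSpanSingleton k _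
        (((c.ι.app (op u)).app u).hom (freeRepBasis (𝟙 u))))
      naturality u u' f := by
        refine ModuleCat.hom_ext (LinearMap.ext_ring ?_)
        refine (one_smul k _).trans ?_
        have h1 : ((c.ι.app (op u')).app u').hom (freeRepBasis (𝟙 u')) =
            ((c.ι.app (op u)).app u').hom (freeRepBasis f) := by
          rw [← c.w f.op]
          refine congr_arg ((c.ι.app (op u)).app u').hom ?_
          exact (freeRepDesc_app_one _)
        refine h1.trans ?_
        have h2 := ConcreteCategory.congr_hom ((c.ι.app (op u)).naturality f) (freeRepBasis (𝟙 u))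
        refine Eq.trans ?_ (h2.trans ?_)
        · refine congr_arg ((c.ι.app (op u)).app u').hom ?_
          refine Eq.trans ?_ (freeRep_map_basis _ _).symm
          rw [Category.id_comp]
        · exact congr_arg (c.pt.map f).hom (one_smul k _).symm }
  fac c s := by
    refine freeRep_hom_ext ?_
    refine (congr_arg (LinearMap.toSpanSingleton k (c.pt.obj s.unop)
      (((c.ι.app s).app s.unop).hom (freeRepBasis (𝟙 s.unop))))
      (freeRepDesc_app_one (unitOne s.unop))).trans ?_
    exact one_smul k _
  uniq c m hm := by
    ext u : 2
    refine ModuleCat.hom_ext (LinearMap.ext_ring ?_)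
    refine Eq.trans ?_ (one_smul k _).symm
    have h := congr_arg (fun f => (f.app u).hom (freeRepBasis (𝟙 u))) (hm (op u))
    refine Eq.trans ?_ h
    exact congr_arg (m.app u).hom (freeRepDesc_app_one (unitOne u)).symm

variable [Groupoid.{u} G]

/-- The cocommutative coalgebra `s ↦ h(k[s, -])`. -/
abbrev fibreComon (h : PiOne (ModuleCat.{u} k) G) : CommComon (Gᵒᵖ ⥤ ModuleCat.{u} k) where
  X := linYoneda k G ⋙ h.hom.functor

/-- The coalgebra `s ↦ h(k[s, -])` is a torsor: the first axiom is the case of representable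
functors of `shear_fibreMap_bijective`, the second holds because `h` preserves colimits. -/
theorem isTorsor_fibreComon (h : PiOne (ModuleCat.{u} k) G) : IsTorsor (fibreComon h) where
  isIso_torsorMap s t _ := by
    refine (isIso_torsorMap_iff (linYoneda k G ⋙ h.hom.functor) s t).mpr ?_
    have e : (familyMap fun g : s ⟶ t => ((linYoneda k G ⋙ h.hom.functor).map g.op).hom) =
        fibreMap h (freeRep k s) t := by
      refine familyMap_hom_ext fun g c => (familyMap_single_one_tmul _ _ _).trans ?_
      exact (fibreMap_tmul h (freeRepBasis g) c).symm
    rw [e]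
    exact shear_fibreMap_bijective h (freeRep k s) t
  isColimit_counit := ⟨(isColimitOfPreserves h.hom.functor
    (isColimitLinYonedaCocone k G)).ofIsoColimit
      (Cocone.ext (Functor.Monoidal.εIso h.hom.functor).symm fun s => rfl)⟩

theorem isComonHom_whiskerLeft_linYoneda {H H' : (G ⥤ ModuleCat.{u} k) ⥤ ModuleCat.{u} k}
    [H.Braided] [H'.Braided] (ξ : H ⟶ H') [NatTrans.IsMonoidal ξ] :
    IsComonHom (Functor.whiskerLeft (linYoneda k G) ξ) where
  hom_counit := by
    ext s : 2
    refine (congr_arg (ξ.app _ ≫ ·) (linYoneda_comp_counit_app H' s)).trans ?_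
    refine Eq.trans ?_ (linYoneda_comp_counit_app H s).symm
    have h1 : ξ.app (𝟙_ _) ≫ OplaxMonoidal.η H' = OplaxMonoidal.η H := by
      rw [← cancel_epi (LaxMonoidal.ε H), NatTrans.IsMonoidal.unit_assoc,
        Functor.Monoidal.ε_η, Functor.Monoidal.ε_η]
    rw [← h1]
    exact ξ.naturality_assoc _ _ |>.symm
  hom_comul := by
    ext s : 2
    refine (congr_arg (ξ.app _ ≫ ·) (linYoneda_comp_comul_app H' s)).trans ?_
    refine Eq.trans ?_ (congr_arg (· ≫ (ξ.app _ ⊗ₘ ξ.app _)) (linYoneda_comp_comul_app H s).symm)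
    have h1 (X Y) : ξ.app (X ⊗ Y) ≫ OplaxMonoidal.δ H' X Y =
        OplaxMonoidal.δ H X Y ≫ (ξ.app X ⊗ₘ ξ.app Y) := by
      rw [← cancel_epi (μ H X Y), NatTrans.IsMonoidal.tensor_assoc,
        Functor.Monoidal.μ_δ, Category.comp_id, Functor.Monoidal.μ_δ_assoc]
    refine Eq.trans ?_ (Category.assoc _ _ _).symm
    refine Eq.trans ?_ (congr_arg (H.map Δ[freeRep k s.unop] ≫ ·) (h1 _ _))
    exact (ξ.naturality_assoc _ _).symm

variable (k G) in
/-- The functor sending a morphism of algebras `h` to the torsor `s ↦ h(k[s, -])`. -/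
def fibreTors : PiOne (ModuleCat.{u} k) G ⥤ Tors G (ModuleCat.{u} k) where
  obj h := ⟨fibreComon h, isTorsor_fibreComon h⟩
  map ξ := ObjectProperty.homMk (InducedCategory.homMk
    { hom := Functor.whiskerLeft (linYoneda k G) ξ.hom.hom
      isComonHom_hom := isComonHom_whiskerLeft_linYoneda ξ.hom.hom })

end FibreTorsor

/-! ### Points of morphisms of algebras -/

section FibrePoints

open Functor Functor.LaxMonoidal ComonObj Opposite

variable {k : Type u} [Field k] {G : Type u} [Groupoid.{u} G] {K : Type u} [Field K] [Algebra k K]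

local infixl:70 " ⊠ " => box

theorem hom_comp_baseChange {M N P : ModuleCat.{u} k} (f : M ⟶ N) (g : N ⟶ P) (x : K ⊗[k] M) :
    (f ≫ g).hom.baseChange K x = g.hom.baseChange K (f.hom.baseChange K x) :=
  baseChange_comp_apply g.hom f.hom x

section

variable (h : PiOne (ModuleCat.{u} k) G) {t : G} (x : K ⊗[k] h.hom.functor.obj (freeRep k t))

/-- The map `K ⊗ X(t) → K ⊗ h(X)` given by a `K`-valued point `x` of `h(k[t, -])`. -/
def transport (X : G ⥤ ModuleCat.{u} k) : K ⊗[k] X.obj t →ₗ[K] K ⊗[k] h.hom.functor.obj X :=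
  fibre (fibreMap h X t) x

theorem transport_tmul {X : G ⥤ ModuleCat.{u} k} (a : K) (v : X.obj t) :
    transport h x X (a ⊗ₜ v) =
      a • (h.hom.functor.map (freeRepDesc v)).hom.baseChange K x := by
  change (fibreMap h X t).baseChange K ((a ⊗ₜ v) ⊠ x) = _
  induction x using box_induction with
  | add x y hx hy => simp only [box_add, _root_.map_add, hx, hy, smul_add]
  | tmul b c =>
    rw [tmul_box_tmul, LinearMap.baseChange_tmul, fibreMap_tmul, LinearMap.baseChange_tmul,
      TensorProduct.smul_tmul', smul_eq_mul]

theorem map_comp_baseChange {X Y Z : G ⥤ ModuleCat.{u} k} (f : X ⟶ Y) (g : Y ⟶ Z)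
    (x : K ⊗[k] h.hom.functor.obj X) :
    (h.hom.functor.map g).hom.baseChange K ((h.hom.functor.map f).hom.baseChange K x) =
      (h.hom.functor.map (f ≫ g)).hom.baseChange K x := by
  rw [h.hom.functor.map_comp, hom_comp_baseChange]

theorem transport_basis_one : transport h x (freeRep k t) (1 ⊗ₜ freeRepBasis (𝟙 t)) = x := by
  refine (transport_tmul h x 1 (freeRepBasis (𝟙 t))).trans ?_
  rw [one_smul, freeRepDesc_basis_one, h.hom.functor.map_id]
  exact LinearMap.congr_fun LinearMap.baseChange_id x

theorem transport_naturality {X Y : G ⥤ ModuleCat.{u} k} (f : X ⟶ Y) (w : K ⊗[k] X.obj t) :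
    (h.hom.functor.map f).hom.baseChange K (transport h x X w) =
      transport h x Y ((f.app t).hom.baseChange K w) := by
  induction w using box_induction with
  | add w w' h h' => simp only [_root_.map_add, h, h']
  | tmul a v =>
    rw [transport_tmul, LinearMap.baseChange_tmul, transport_tmul, _root_.map_smul,
      map_comp_baseChange, freeRepDesc_comp]

/-- Transport along a translate of `x` differs from transport along `x` by the action on `X(t)`. -/
theorem transport_pull {X : G ⥤ ModuleCat.{u} k} (g : t ⟶ t) (w : K ⊗[k] X.obj t) :
    transport h ((h.hom.functor.map (freeRepDesc (freeRepBasis g))).hom.baseChange K x) X w =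
      transport h x X ((X.map g).hom.baseChange K w) := by
  induction w using box_induction with
  | add w w' h h' => simp only [_root_.map_add, h, h']
  | tmul a v =>
    rw [transport_tmul, LinearMap.baseChange_tmul, transport_tmul, map_comp_baseChange,
      freeRepDesc_comp_freeRepDesc]

theorem galAct_transport (γ : Gal(K/k)) {X : G ⥤ ModuleCat.{u} k} (w : K ⊗[k] X.obj t) :
    galAct γ (transport h x X w) = transport h (galAct γ x) X (galAct γ w) := by
  refine (galAct_baseChange _ _ _).trans ?_
  rw [boxₗ.flip_apply, boxₗ_apply_apply, galAct_box]
  rfl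

end

variable {h : PiOne (ModuleCat.{u} k) G} {t : G} {x : K ⊗[k] h.hom.functor.obj (freeRep k t)}

theorem transport_bijective (hx : IsPoint x) (X : G ⥤ ModuleCat.{u} k) :
    Function.Bijective (transport h x X) :=
  fibre_bijective (shear_fibreMap_bijective h X t) hx

/-- The transport map of a constant functor is the base change of the unit isomorphism. -/
theorem transport_const (hx : IsPoint x) {V : ModuleCat.{u} k} (v : V) :
    transport h x ((Functor.const G).obj V) (1 ⊗ₜ v) = 1 ⊗ₜ (unitIso h V).hom.hom v := by
  let f : 𝟙_ (ModuleCat.{u} k) ⟶ V := ModuleCat.ofHom (LinearMap.toSpanSingleton k V v)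
  have h1 : (h.hom.functor.map ε[freeRep k t]).hom.baseChange K x =
      1 ⊗ₜ (unitIso h (𝟙_ _)).hom.hom (1 : k) := by
    have h2 : (OplaxMonoidal.η h.hom.functor).hom.baseChange K
        ((h.hom.functor.map ε[freeRep k t]).hom.baseChange K x) = 1 ⊗ₜ (1 : k) := by
      rw [← baseChange_comp_apply]
      exact hx.counit
    have h3 := congr_arg ((LaxMonoidal.ε h.hom.functor).hom.baseChange K) h2
    rw [← baseChange_comp_apply] at h3
    have h4 : (LaxMonoidal.ε h.hom.functor).hom ∘ₗ (OplaxMonoidal.η h.hom.functor).hom =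
        LinearMap.id :=
      congr_arg ModuleCat.Hom.hom (Functor.Monoidal.η_ε h.hom.functor)
    rw [h4, LinearMap.baseChange_id] at h3
    rw [unitIso_one]
    exact h3
  have h5 : ε[freeRep k t] ≫ (Functor.const G).map f =
      freeRepDesc (X := (Functor.const G).obj V) v := by
    rw [freeRep_counit]
    refine (freeRepDesc_comp _ _).trans ?_
    exact congr_arg (freeRepDesc (X := (Functor.const G).obj V)) (one_smul k v)
  refine (transport_tmul h x (X := (Functor.const G).obj V) 1 v).trans ?_
  rw [one_smul, ← h5, ← map_comp_baseChange, h1]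
  refine congr_arg (fun w => (1 : K) ⊗ₜ[k] w) ?_
  refine (ConcreteCategory.congr_hom (unitIso_naturality h f) (1 : k)).symm.trans ?_
  exact congr_arg (unitIso h V).hom.hom (one_smul k v)

theorem transport_unit (hx : IsPoint x) :
    transport h x (𝟙_ (G ⥤ ModuleCat.{u} k)) (1 ⊗ₜ unitOne t) =
      1 ⊗ₜ (LaxMonoidal.ε h.hom.functor).hom (1 : k) := by
  refine (transport_const hx (V := 𝟙_ _) (1 : k)).trans ?_
  rw [unitIso_one]

/-- The transport maps are monoidal. -/
theorem transport_tensor (hx : IsPoint x) {X Y : G ⥤ ModuleCat.{u} k} (v : K ⊗[k] X.obj t)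
    (w : K ⊗[k] Y.obj t) :
    (μ h.hom.functor X Y).hom.baseChange K (transport h x X v ⊠ transport h x Y w) =
      transport h x (X ⊗ Y) (v ⊠ w) := by
  induction v using box_induction with
  | add v v' e e' =>
    rw [_root_.map_add, add_box, _root_.map_add, e, e', add_box]
    exact (_root_.map_add (transport h x (X ⊗ Y)) _ _).symm
  | tmul a v =>
    induction w using box_induction with
    | add w w' e e' =>
      rw [_root_.map_add, box_add, _root_.map_add, e, e', box_add]
      exact (_root_.map_add (transport h x (X ⊗ Y)) _ _).symm
    | tmul b w =>
      rw [transport_tmul, transport_tmul, smul_box, box_smul, _root_.map_smul, _root_.map_smul,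
        ← baseChange_map_box, ← hx.comul, smul_smul, tmul_box_tmul]
      refine Eq.trans ?_ (transport_tmul h x (X := X ⊗ Y) (a * b) (pureTensor v w)).symm
      refine congr_arg ((a * b) • ·) ?_
      rw [← baseChange_comp_apply, ← baseChange_comp_apply]
      refine congr_arg (fun f : h.hom.functor.obj (freeRep k t) ⟶ h.hom.functor.obj (X ⊗ Y) =>
        f.hom.baseChange K x) (a₁ := (h.hom.functor.map Δ[freeRep k t] ≫ OplaxMonoidal.δ _ _ _) ≫
          (h.hom.functor.map (freeRepDesc v) ⊗ₘ h.hom.functor.map (freeRepDesc w)) ≫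
            μ h.hom.functor X Y) ?_
      rw [μ_natural, Category.assoc, Functor.Monoidal.δ_μ_assoc, ← h.hom.functor.map_comp]
      refine congr_arg h.hom.functor.map ?_
      rw [freeRep_comul, freeRepDesc_comp]
      exact congr_arg₂ (fun v w => freeRepDesc (pureTensor v w))
        (freeRepDesc_app_one v) (freeRepDesc_app_one w)

/-- A natural transformation out of the functor underlying a morphism of algebras is determined by
the image of a point. -/
theorem IsPoint.natTrans_ext (hx : IsPoint x) {H : (G ⥤ ModuleCat.{u} k) ⥤ ModuleCat.{u} k}
    {ξ ξ' : h.hom.functor ⟶ H}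
    (e : (ξ.app (freeRep k t)).hom.baseChange K x = (ξ'.app (freeRep k t)).hom.baseChange K x) :
    ξ = ξ' := by
  ext X : 2
  refine ModuleCat.hom_ext (baseChange_injective (K := K) (LinearMap.ext fun z => ?_))
  obtain ⟨w, rfl⟩ := (transport_bijective hx X).2 z
  have key (ξ : h.hom.functor ⟶ H) (v : X.obj t) :
      (ξ.app X).hom.baseChange K ((h.hom.functor.map (freeRepDesc v)).hom.baseChange K x) =
        (H.map (freeRepDesc v)).hom.baseChange K ((ξ.app (freeRep k t)).hom.baseChange K x) := by
    rw [← baseChange_comp_apply, ← baseChange_comp_apply]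
    exact congr_arg (fun f : h.hom.functor.obj (freeRep k t) ⟶ H.obj X => f.hom.baseChange K x)
      (ξ.naturality (freeRepDesc v))
  induction w using box_induction with
  | add w w' h h' => simp only [_root_.map_add, h, h']
  | tmul a v =>
    rw [transport_tmul, _root_.map_smul, _root_.map_smul, key, key, e]

/-- If the Galois group acts in the same way on points of `h(k[t, -])` and `h'(k[t, -])`, then there
is a morphism `h ⟶ h'` sending one point to the other, obtained by descent from the comparison of `K
⊗ h(X)` and `K ⊗ h'(X)` with `K ⊗ X(t)`. -/
theorem IsPointOver.exists_piOneHom [IsGalois k K] {ρ : SingleObj Gal(K/k) ⥤ G}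
    {h h' : PiOne (ModuleCat.{u} k) G}
    {x : K ⊗[k] h.hom.functor.obj (freeRep k (ρ.obj (SingleObj.star _)))}
    (hx : IsPointOver ρ (linYoneda k G ⋙ h.hom.functor) x)
    {x' : K ⊗[k] h'.hom.functor.obj (freeRep k (ρ.obj (SingleObj.star _)))}
    (hx' : IsPointOver ρ (linYoneda k G ⋙ h'.hom.functor) x') :
    ∃ ξ : h ⟶ h', (ξ.hom.hom.app (freeRep k _)).hom.baseChange K x = x' := by
  have hp : IsPoint x := hx.isPoint
  have hp' : IsPoint x' := hx'.isPoint
  have hgal {h : PiOne (ModuleCat.{u} k) G}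
      {x : K ⊗[k] h.hom.functor.obj (freeRep k (ρ.obj (SingleObj.star _)))}
      (hx : IsPointOver ρ (linYoneda k G ⋙ h.hom.functor) x) (X : G ⥤ ModuleCat.{u} k)
      (γ : Gal(K/k)) (w) : galAct γ (transport h x X w) = transport h x X
        ((X.map (ρ.map (SingleObj.toEnd _ γ))).hom.baseChange K (galAct γ w)) := by
    rw [galAct_transport, ← transport_pull]
    exact congr_arg (fun x => transport h x X _) (hx.galAct_eq γ)
  -- The comparison of `K ⊗ h(X)` and `K ⊗ h'(X)` through `K ⊗ X(t)`.
  let e (X : G ⥤ ModuleCat.{u} k) := LinearEquiv.ofBijective _ (transport_bijective hp X)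
  have hF (X : G ⥤ ModuleCat.{u} k) (w) :
      (transport h' x' X ∘ₗ (e X).symm.toLinearMap) (transport h x X w) = transport h' x' X w :=
    congr_arg (transport h' x' X) ((e X).symm_apply_apply w)
  have hex (X : G ⥤ ModuleCat.{u} k) :
      ∃ f : h.hom.functor.obj X ⟶ h'.hom.functor.obj X, ∀ w,
        f.hom.baseChange K (transport h x X w) = transport h' x' X w := by
    obtain ⟨f, hf⟩ := exists_baseChange_eq (transport h' x' X ∘ₗ (e X).symm.toLinearMap)
      fun γ z => by
        obtain ⟨w, rfl⟩ := (transport_bijective hp X).2 z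
        rw [hgal hx, hF, hF, hgal hx']
    exact ⟨ModuleCat.ofHom f, fun w => by rw [ModuleCat.hom_ofHom, hf, hF]⟩
  choose f hf using hex
  let ξ : h.hom.functor ⟶ h'.hom.functor :=
    { app := f
      naturality X Y g := by
        refine ModuleCat.hom_ext (baseChange_injective (K := K) (LinearMap.ext fun z => ?_))
        obtain ⟨w, rfl⟩ := (transport_bijective hp X).2 z
        rw [hom_comp_baseChange, hom_comp_baseChange, transport_naturality, hf, hf,
          transport_naturality] }
  have hunit : LaxMonoidal.ε h.hom.functor ≫ ξ.app (𝟙_ _) = LaxMonoidal.ε h'.hom.functor := by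
    refine ModuleCat.hom_ext (LinearMap.ext_ring (one_tmul_injective (k := k) (K := K) ?_))
    refine Eq.trans ?_ (transport_unit hp')
    rw [← hf, transport_unit hp]
    rfl
  have htensor (X Y : G ⥤ ModuleCat.{u} k) : μ h.hom.functor X Y ≫ ξ.app (X ⊗ Y) =
      (ξ.app X ⊗ₘ ξ.app Y) ≫ μ h'.hom.functor X Y := by
    refine ModuleCat.hom_ext (baseChange_injective (K := K) (box_ext fun z z' => ?_))
    obtain ⟨w, rfl⟩ := (transport_bijective hp X).2 z
    obtain ⟨w', rfl⟩ := (transport_bijective hp Y).2 z'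
    refine (hom_comp_baseChange _ _ _).trans (Eq.trans ?_ (hom_comp_baseChange _ _ _).symm)
    rw [transport_tensor hp]
    refine (hf _ _).trans ((transport_tensor hp' _ _).symm.trans ?_)
    refine congr_arg _ ?_
    rw [← hf, ← hf]
    exact (baseChange_map_box _ _ _ _).symm
  refine ⟨{ hom := { hom := ξ, isMonoidal := ⟨hunit, htensor⟩ }, w := ?_ }, ?_⟩
  · ext V v
    refine one_tmul_injective (k := k) (K := K) ?_
    refine Eq.trans ?_ (transport_const hp' v)
    rw [← hf, transport_const hp]
    rfl
  · have h1 := hf _ (1 ⊗ₜ freeRepBasis (𝟙 _))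
    rwa [transport_basis_one, transport_basis_one] at h1

end FibrePoints

/-! ### Functoriality of twisted invariants -/

section InvariantsMap

variable {k K : Type*} [Field k] [Field K] [Algebra k K]
  {V W : Type*} [AddCommGroup V] [Module k V] [AddCommGroup W] [Module k W]
  {σ : Gal(K/k) → V →ₗ[k] V} {σ' : Gal(K/k) → W →ₗ[k] W}

/-- The map of twisted invariants induced by an equivariant linear map. -/
def invariantsMap (f : V →ₗ[k] W) (hf : ∀ γ, f ∘ₗ σ γ = σ' γ ∘ₗ f) :
    twistedInvariants σ →ₗ[k] twistedInvariants σ' :=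
  ((f.baseChange K).restrictScalars k).restrict fun w hw γ => by
    change (σ' γ).baseChange K (galAct γ (f.baseChange K w)) = f.baseChange K w
    rw [galAct_baseChange, ← baseChange_comp_apply, ← hf, baseChange_comp_apply, hw γ]

theorem coe_invariantsMap (f : V →ₗ[k] W) (hf : ∀ γ, f ∘ₗ σ γ = σ' γ ∘ₗ f)
    (w : twistedInvariants σ) : (invariantsMap f hf w : K ⊗[k] W) = f.baseChange K w := rfl

/-- The comparison map is natural. -/
theorem comparison_invariantsMap (f : V →ₗ[k] W) (hf : ∀ γ, f ∘ₗ σ γ = σ' γ ∘ₗ f)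
    (z : K ⊗[k] twistedInvariants σ) :
    comparison σ' ((invariantsMap f hf).baseChange K z) = f.baseChange K (comparison σ z) := by
  induction z using box_induction with
  | add x y hx hy => simp only [map_add, hx, hy]
  | tmul a w => rw [LinearMap.baseChange_tmul, comparison_tmul, comparison_tmul, map_smul,
      coe_invariantsMap]

/-- The vectors of `V`, as twisted invariants for the trivial action on `V`. -/
def trivialInvariants (hσ : ∀ γ, σ γ = LinearMap.id) : V →ₗ[k] twistedInvariants σ :=
  (TensorProduct.mk k K V 1).codRestrict _ fun v γ => by
    rw [hσ, LinearMap.baseChange_id]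
    exact congr_arg (· ⊗ₜ v) (map_one γ)

theorem trivialInvariants_bijective [IsGalois k K] (hσ : ∀ γ, σ γ = LinearMap.id) :
    Function.Bijective (trivialInvariants hσ) := by
  refine ⟨fun v w h => one_tmul_injective (k := k) (K := K) (congr_arg Subtype.val h), fun w => ?_⟩
  obtain ⟨v, hv⟩ := exists_eq_one_tmul (x := (w : K ⊗[k] V)) fun γ => by
    have := w.2 γ
    rwa [hσ, LinearMap.baseChange_id] at this
  exact ⟨v, Subtype.ext hv.symm⟩

end InvariantsMap

/-! ### The morphism of algebras of a representation of the Galois group -/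

section Invariants

variable {k : Type u} [Field k] {G : Type u} [Category.{u} G] {K : Type u} [Field K] [Algebra k K]

local infixl:70 " ⊠ " => box

/-- The object of `G` on which a functor from the Galois group acts. -/
abbrev basePt (ρ : SingleObj Gal(K/k) ⥤ G) : G := ρ.obj (SingleObj.star _)

/-- The action of the Galois group on a value of `X`, through `ρ`. -/
def galRep (ρ : SingleObj Gal(K/k) ⥤ G) (X : G ⥤ ModuleCat.{u} k) (γ : Gal(K/k)) :
    X.obj (basePt ρ) →ₗ[k] X.obj (basePt ρ) :=
  (X.map (ρ.map (SingleObj.toEnd _ γ))).hom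

theorem galRep_mul (ρ : SingleObj Gal(K/k) ⥤ G) (X : G ⥤ ModuleCat.{u} k) (γ δ : Gal(K/k)) :
    galRep ρ X (γ * δ) = galRep ρ X γ ∘ₗ galRep ρ X δ := by
  refine congr_arg ModuleCat.Hom.hom (Eq.trans ?_ (X.map_comp _ _))
  refine congr_arg X.map (Eq.trans ?_ (ρ.map_comp _ _))
  rfl

theorem comp_galRep (ρ : SingleObj Gal(K/k) ⥤ G) {X Y : G ⥤ ModuleCat.{u} k} (f : X ⟶ Y)
    (γ : Gal(K/k)) :
    (f.app (basePt ρ)).hom ∘ₗ galRep ρ X γ = galRep ρ Y γ ∘ₗ (f.app (basePt ρ)).hom :=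
  congr_arg ModuleCat.Hom.hom (f.naturality _)

theorem map_comp_galRep {ρ ρ' : SingleObj Gal(K/k) ⥤ G} (τ : ρ ⟶ ρ') (X : G ⥤ ModuleCat.{u} k)
    (γ : Gal(K/k)) :
    (X.map (τ.app (SingleObj.star _))).hom ∘ₗ galRep ρ X γ =
      galRep ρ' X γ ∘ₗ (X.map (τ.app (SingleObj.star _))).hom := by
  refine congr_arg ModuleCat.Hom.hom ((X.map_comp _ _).symm.trans (Eq.trans ?_ (X.map_comp _ _)))
  exact congr_arg X.map (τ.naturality _)

/-- A continuous functor from the Galois group factors through a finite quotient. -/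
theorem ContHom.exists_fixingSubgroup (ρ : ContHom Gal(K/k) G) [IsGalois k K] :
    ∃ E : IntermediateField k K, FiniteDimensional k E ∧ Normal k E ∧
      ∀ γ ∈ E.fixingSubgroup, ρ.obj.map (SingleObj.toEnd _ γ) = 𝟙 _ := by
  let : TopologicalSpace (basePt ρ.obj ⟶ basePt ρ.obj) := ⊥
  have : DiscreteTopology (basePt ρ.obj ⟶ basePt ρ.obj) := ⟨rfl⟩
  have h1 : Continuous fun γ : Gal(K/k) => ρ.obj.map (SingleObj.toEnd _ γ) := ρ.property
  have h2 := (isOpen_discrete {𝟙 (basePt ρ.obj)}).preimage h1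
  have h3 := h2.mem_nhds (x := 1) (ρ.obj.map_id _)
  obtain ⟨E, h4, h5, h6⟩ := (krullTopology_mem_nhds_one_iff_of_normal k K _).mp h3
  exact ⟨E, h4, h5, fun γ hγ => h6 hγ⟩

theorem comparison_galRep_bijective [IsGalois k K] (ρ : ContHom Gal(K/k) G)
    (X : G ⥤ ModuleCat.{u} k) : Function.Bijective (comparison (galRep ρ.obj X)) := by
  obtain ⟨E, h4, h5, h6⟩ := ρ.exists_fixingSubgroup
  refine comparison_bijective _ (galRep_mul ρ.obj X) E fun γ hγ => ?_
  refine congr_arg ModuleCat.Hom.hom ((congr_arg X.map (h6 γ hγ)).trans (X.map_id _))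

/-- The functor sending `X` to the invariants of `K ⊗ X(t)` under the diagonal action of the Galois
group, which acts on `X(t)` through `ρ`. -/
def invariants (ρ : SingleObj Gal(K/k) ⥤ G) : (G ⥤ ModuleCat.{u} k) ⥤ ModuleCat.{u} k where
  obj X := ModuleCat.of k (twistedInvariants (galRep ρ X))
  map f := ModuleCat.ofHom (invariantsMap (f.app (basePt ρ)).hom (comp_galRep ρ f))
  map_id _ := ModuleCat.hom_ext (LinearMap.ext fun w => Subtype.ext
    (LinearMap.congr_fun LinearMap.baseChange_id w.1))
  map_comp f g := ModuleCat.hom_ext (LinearMap.ext fun w => Subtype.ext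
    (hom_comp_baseChange (f.app (basePt ρ)) (g.app (basePt ρ)) w.1))

/-- The isomorphism of a vector space with the invariants of its base change. -/
def constInvariantsIso [IsGalois k K] (ρ : SingleObj Gal(K/k) ⥤ G) (V : ModuleCat.{u} k) :
    V ≅ (invariants ρ).obj ((Functor.const G).obj V) :=
  (LinearEquiv.ofBijective (trivialInvariants (σ := galRep ρ ((Functor.const G).obj V))
    fun _ => rfl) (trivialInvariants_bijective _)).toModuleIso

/-- The isomorphism of the tensor product of invariants with the invariants of the tensor
product. -/
def tensorInvariantsIso [IsGalois k K] (ρ : ContHom Gal(K/k) G) (X Y : G ⥤ ModuleCat.{u} k) :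
    (invariants ρ.obj).obj X ⊗ (invariants ρ.obj).obj Y ≅ (invariants ρ.obj).obj (X ⊗ Y) :=
  (LinearEquiv.ofBijective (invariantsBox (galRep ρ.obj X) (galRep ρ.obj Y))
    (invariantsBox_bijective _ _ (comparison_galRep_bijective ρ X)
      (comparison_galRep_bijective ρ Y)
      (comparison_galRep_bijective ρ (X ⊗ Y)))).toModuleIso

/-- The monoidal structure given by the external product of invariants. -/
instance invariantsMonoidal [IsGalois k K] (ρ : ContHom Gal(K/k) G) :
    (invariants ρ.obj).Monoidal :=
  Functor.CoreMonoidal.toMonoidal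
    { εIso := constInvariantsIso ρ.obj (𝟙_ _)
      μIso := tensorInvariantsIso ρ
      μIso_hom_natural_left f Z := by
        refine ModuleCat.hom_ext (TensorProduct.ext' fun v w => Subtype.ext ?_)
        exact (baseChange_rTensor_box (f.app (basePt ρ.obj)).hom v.1 w.1).symm
      μIso_hom_natural_right Z f := by
        refine ModuleCat.hom_ext (TensorProduct.ext' fun v w => Subtype.ext ?_)
        exact (baseChange_lTensor_box (f.app (basePt ρ.obj)).hom v.1 w.1).symm
      associativity X Y Z := by
        refine ModuleCat.hom_ext (TensorProduct.ext_threefold fun u v w => Subtype.ext ?_)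
        exact baseChange_assoc_box u.1 v.1 w.1
      left_unitality X := by
        refine ModuleCat.hom_ext (TensorProduct.ext (LinearMap.ext_ring
          (LinearMap.ext fun w => Subtype.ext ?_)))
        exact (congr_arg Subtype.val (one_smul k w)).trans (baseChange_lid_box w.1).symm
      right_unitality X := by
        refine ModuleCat.hom_ext (TensorProduct.ext (LinearMap.ext fun w =>
          LinearMap.ext_ring (Subtype.ext ?_)))
        exact (congr_arg Subtype.val (one_smul k w)).trans (baseChange_rid_box w.1).symm }

instance invariantsBraided [IsGalois k K] (ρ : ContHom Gal(K/k) G) :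
    (invariants ρ.obj).Braided where
  braided X Y := by
    refine ModuleCat.hom_ext (TensorProduct.ext' fun v w => Subtype.ext ?_)
    exact baseChange_comm_box v.1 w.1

/-- After base change to `K`, the invariants of `K ⊗ X(t)` become isomorphic to `K ⊗ X(t)`. -/
def invariantsCompTensorLeft [IsGalois k K] (ρ : ContHom Gal(K/k) G) :
    invariants ρ.obj ⋙ tensorLeft (ModuleCat.of k K) ≅
      (evaluation G (ModuleCat.{u} k)).obj (basePt ρ.obj) ⋙ tensorLeft (ModuleCat.of k K) :=
  NatIso.ofComponents (fun X => ((LinearEquiv.ofBijective (comparison (galRep ρ.obj X))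
    (comparison_galRep_bijective ρ X)).restrictScalars k).toModuleIso) fun {X Y} f => by
      refine ModuleCat.hom_ext (LinearMap.ext fun z => ?_)
      exact comparison_invariantsMap (f.app (basePt ρ.obj)).hom (comp_galRep ρ.obj f) z

instance : (tensorLeft (ModuleCat.of k K)).ReflectsIsomorphisms where
  reflects {M N} f _ := by
    rw [ConcreteCategory.isIso_iff_bijective]
    refine bijective_of_baseChange (K := K) (f := f.hom) ?_
    exact (ConcreteCategory.isIso_iff_bijective
      ((tensorLeft (ModuleCat.of k K)).map f)).mp inferInstance

/-- The functor `X ↦ K ⊗ X(t)` preserves colimits, and `K ⊗ -` preserves and reflects them. -/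
instance invariants_preservesColimits [IsGalois k K] (ρ : ContHom Gal(K/k) G) :
    PreservesColimitsOfSize.{u, u} (invariants ρ.obj) where
  preservesColimitsOfShape {J _} := by
    have h1 : PreservesColimitsOfShape J (tensorLeft (ModuleCat.of k K)) := inferInstance
    have h2 : ReflectsColimitsOfShape J (tensorLeft (ModuleCat.of k K)) :=
      reflectsColimitsOfShape_of_reflectsIsomorphisms
    have h3 : PreservesColimitsOfShape J (invariants ρ.obj ⋙ tensorLeft (ModuleCat.of k K)) :=
      preservesColimitsOfShape_of_natIso (invariantsCompTensorLeft ρ).symm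
    exact preservesColimitsOfShape_of_reflects_of_preserves _ (tensorLeft (ModuleCat.of k K))

/-- The morphism of algebras `X ↦ (K ⊗ X(t))^Γ` given by a continuous functor `ρ` from the Galois
group. -/
def invariantsPiOne [IsGalois k K] (ρ : ContHom Gal(K/k) G) : PiOne (ModuleCat.{u} k) G where
  hom := { functor := invariants ρ.obj }
  unit := Com2RingHom.isoMk
    (NatIso.ofComponents (fun V => constInvariantsIso ρ.obj V) fun {V W} f => by
      refine ModuleCat.hom_ext (LinearMap.ext fun v => Subtype.ext ?_)
      exact (LinearMap.baseChange_tmul f.hom (1 : K) v).symm)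
    { unit := by
        refine ModuleCat.hom_ext (LinearMap.ext_ring (Subtype.ext ?_))
        exact (LinearMap.baseChange_tmul LinearMap.id (1 : K) (1 : k)).symm
      tensor V W := by
        refine ModuleCat.hom_ext (TensorProduct.ext' fun v w => Subtype.ext ?_)
        refine Eq.trans ?_ (congr_arg (LinearMap.id.baseChange K)
          (tmul_box_tmul (1 : K) 1 v w)).symm
        rw [one_mul]
        rfl }

/-- The functoriality of `invariantsPiOne`. -/
def invariantsPiOneMap [IsGalois k K] {ρ ρ' : ContHom Gal(K/k) G} (τ : ρ ⟶ ρ') :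
    invariantsPiOne ρ ⟶ invariantsPiOne ρ' where
  hom :=
    { hom :=
        { app X := ModuleCat.ofHom (invariantsMap (X.map (τ.hom.app (SingleObj.star _))).hom
            (map_comp_galRep τ.hom X))
          naturality X Y f := by
            refine ModuleCat.hom_ext (LinearMap.ext fun v => Subtype.ext ?_)
            refine (hom_comp_baseChange _ _ _).symm.trans
              (Eq.trans ?_ (hom_comp_baseChange _ _ _))
            rw [f.naturality] }
      isMonoidal :=
        { unit := by
            refine ModuleCat.hom_ext (LinearMap.ext_ring (Subtype.ext ?_))
            exact LinearMap.baseChange_tmul LinearMap.id (1 : K) (1 : k)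
          tensor X Y := by
            refine ModuleCat.hom_ext (TensorProduct.ext' fun v w => Subtype.ext ?_)
            exact baseChange_map_box _ _ v.1 w.1 } }
  w := by
    ext V v
    refine Subtype.ext ?_
    exact LinearMap.baseChange_tmul LinearMap.id (1 : K) v

variable (k G K) in
/-- The functor sending `ρ` to the morphism of algebras `X ↦ (K ⊗ X(t))^Γ`. -/
def contHomToPiOne [IsGalois k K] : ContHom Gal(K/k) G ⥤ PiOne (ModuleCat.{u} k) G where
  obj ρ := invariantsPiOne ρ
  map τ := invariantsPiOneMap τ
  map_id ρ := by
    ext X v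
    refine Subtype.ext ?_
    refine (congr_arg (fun f : X.obj (basePt ρ.obj) ⟶ X.obj (basePt ρ.obj) =>
      f.hom.baseChange K v.1) (X.map_id _)).trans ?_
    exact LinearMap.congr_fun LinearMap.baseChange_id v.1
  map_comp {ρ ρ' ρ''} τ τ' := by
    ext X v
    refine Subtype.ext ?_
    refine (congr_arg (fun f : X.obj (basePt ρ.obj) ⟶ X.obj (basePt ρ''.obj) =>
      f.hom.baseChange K v.1) (X.map_comp _ _)).trans ?_
    exact hom_comp_baseChange _ _ v.1

end Invariants

/-! ### The universal point -/

section UniversalPoint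

open ComonObj Opposite Functor Functor.LaxMonoidal

variable {k : Type u} [Field k] {G : Type u} [Groupoid.{u} G] {K : Type u} [Field K] [Algebra k K]
  [IsGalois k K]

local infixl:70 " ⊠ " => box

/-- The isomorphism `K ⊗ (K ⊗ X(t))^Γ ≅ K ⊗ X(t)`. -/
def comparisonEquiv (ρ : ContHom Gal(K/k) G) (X : G ⥤ ModuleCat.{u} k) :
    K ⊗[k] (invariantsPiOne ρ).hom.functor.obj X ≃ₗ[K] K ⊗[k] X.obj (basePt ρ.obj) :=
  LinearEquiv.ofBijective (comparison (galRep ρ.obj X)) (comparison_galRep_bijective ρ X)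

theorem comparisonEquiv_map (ρ : ContHom Gal(K/k) G) {X Y : G ⥤ ModuleCat.{u} k} (f : X ⟶ Y)
    (z : K ⊗[k] (invariantsPiOne ρ).hom.functor.obj X) :
    comparisonEquiv ρ Y (((invariantsPiOne ρ).hom.functor.map f).hom.baseChange K z) =
      (f.app (basePt ρ.obj)).hom.baseChange K (comparisonEquiv ρ X z) :=
  comparison_invariantsMap _ (comp_galRep ρ.obj f) z

theorem comparisonEquiv_app {ρ ρ' : ContHom Gal(K/k) G} (τ : ρ ⟶ ρ') {X : G ⥤ ModuleCat.{u} k}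
    (z : K ⊗[k] (invariantsPiOne ρ).hom.functor.obj X) :
    comparisonEquiv ρ' X (((invariantsPiOneMap τ).hom.hom.app X).hom.baseChange K z) =
      (X.map (τ.hom.app (SingleObj.star _))).hom.baseChange K (comparisonEquiv ρ X z) :=
  comparison_invariantsMap _ (map_comp_galRep τ.hom X) z

theorem comparisonEquiv_galAct (ρ : ContHom Gal(K/k) G) {X : G ⥤ ModuleCat.{u} k} (γ : Gal(K/k))
    (z : K ⊗[k] (invariantsPiOne ρ).hom.functor.obj X) :
    comparisonEquiv ρ X (galAct γ z) =
      (galRep ρ.obj X γ).baseChange K (galAct γ (comparisonEquiv ρ X z)) :=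
  (baseChange_galAct_comparison _ γ z).symm

theorem comparisonEquiv_μ (ρ : ContHom Gal(K/k) G) {X Y : G ⥤ ModuleCat.{u} k}
    (z : K ⊗[k] (invariantsPiOne ρ).hom.functor.obj X)
    (w : K ⊗[k] (invariantsPiOne ρ).hom.functor.obj Y) :
    comparisonEquiv ρ (X ⊗ Y) ((μ (invariantsPiOne ρ).hom.functor X Y).hom.baseChange K (z ⊠ w)) =
      comparisonEquiv ρ X z ⊠ comparisonEquiv ρ Y w :=
  comparison_baseChange_invariantsBox _ _ z w

theorem comparisonEquiv_ε (ρ : ContHom Gal(K/k) G) :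
    comparisonEquiv ρ (𝟙_ _) ((LaxMonoidal.ε (invariantsPiOne ρ).hom.functor).hom.baseChange K
      ((1 : K) ⊗ₜ (1 : k))) = 1 ⊗ₜ unitOne (basePt ρ.obj) := by
  refine (comparison_tmul _ (1 : K) _).trans ?_
  exact one_smul K _

/-- The universal point of `(K ⊗ k[t, t])^Γ`, which corresponds to the identity of `t`. -/
def universalPoint (ρ : ContHom Gal(K/k) G) :
    K ⊗[k] (invariantsPiOne ρ).hom.functor.obj (freeRep k (basePt ρ.obj)) :=
  (comparisonEquiv ρ _).symm (1 ⊗ₜ freeRepBasis (𝟙 (basePt ρ.obj)))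

theorem comparisonEquiv_universalPoint (ρ : ContHom Gal(K/k) G) :
    comparisonEquiv ρ _ (universalPoint ρ) = 1 ⊗ₜ freeRepBasis (𝟙 (basePt ρ.obj)) :=
  (comparisonEquiv ρ _).apply_symm_apply _

theorem comparisonEquiv_map_universalPoint (ρ : ContHom Gal(K/k) G) {X : G ⥤ ModuleCat.{u} k}
    (v : X.obj (basePt ρ.obj)) : comparisonEquiv ρ X
      (((invariantsPiOne ρ).hom.functor.map (freeRepDesc v)).hom.baseChange K (universalPoint ρ)) =
        1 ⊗ₜ v := by
  rw [comparisonEquiv_map, comparisonEquiv_universalPoint, LinearMap.baseChange_tmul,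
    freeRepDesc_app_one]

/-- The Galois group acts on the universal point through `ρ`. -/
theorem isPointOver_universalPoint (ρ : ContHom Gal(K/k) G) :
    IsPointOver ρ.obj (linYoneda k G ⋙ (invariantsPiOne ρ).hom.functor) (universalPoint ρ) where
  isPoint :=
    { comul := by
        let H := (invariantsPiOne ρ).hom.functor
        let P := freeRep k (basePt ρ.obj)
        have hinj : Function.Injective ((μ H P P).hom.baseChange K) :=
          (baseChange_bijective ((ConcreteCategory.isIso_iff_bijective (μ H P P)).mp
            inferInstance)).1
        have h1 : (μ H P P).hom.baseChange K ((H.map Δ[P] ≫ OplaxMonoidal.δ H P P).hom.baseChange K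
            (universalPoint ρ)) = (μ H P P).hom.baseChange K
              (universalPoint ρ ⊠ universalPoint ρ) := by
          rw [← hom_comp_baseChange, Category.assoc, Functor.Monoidal.δ_μ, Category.comp_id]
          refine (comparisonEquiv ρ _).injective ?_
          refine (comparisonEquiv_map_universalPoint ρ (X := P ⊗ P) _).trans ?_
          rw [comparisonEquiv_μ, comparisonEquiv_universalPoint, tmul_box_tmul, one_mul]
          rfl
        exact hinj h1
      counit := by
        let H := (invariantsPiOne ρ).hom.functor
        let P := freeRep k (basePt ρ.obj)
        have hinj : Function.Injective ((LaxMonoidal.ε H).hom.baseChange K) :=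
          (baseChange_bijective ((ConcreteCategory.isIso_iff_bijective (LaxMonoidal.ε H)).mp
            inferInstance)).1
        have h1 : (LaxMonoidal.ε H).hom.baseChange K
            ((H.map ε[P] ≫ OplaxMonoidal.η H).hom.baseChange K (universalPoint ρ)) =
              (LaxMonoidal.ε H).hom.baseChange K (1 ⊗ₜ (1 : k)) := by
          rw [← hom_comp_baseChange, Category.assoc, Functor.Monoidal.η_ε, Category.comp_id]
          refine (comparisonEquiv ρ _).injective ?_
          refine (comparisonEquiv_map_universalPoint ρ (X := 𝟙_ _) _).trans ?_
          exact (comparisonEquiv_ε ρ).symm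
        exact hinj h1 }
  galAct_eq γ := by
    refine (comparisonEquiv ρ _).injective ?_
    refine Eq.trans ?_ (comparisonEquiv_map_universalPoint ρ (X := freeRep k (basePt ρ.obj))
      (freeRepBasis _)).symm
    refine (comparisonEquiv_galAct ρ γ (universalPoint ρ)).trans ?_
    rw [comparisonEquiv_universalPoint, galAct_tmul, map_one, LinearMap.baseChange_tmul]
    refine congr_arg (fun v => (1 : K) ⊗ₜ[k] v) ?_
    refine (freeRep_map_basis _ _).trans ?_
    exact congr_arg freeRepBasis (Category.id_comp _)

/-- A natural transformation `τ` sends the universal point to the translate by `τ` of the universal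
point. -/
theorem invariantsPiOneMap_universalPoint {ρ ρ' : ContHom Gal(K/k) G} (τ : ρ ⟶ ρ') :
    ((invariantsPiOneMap τ).hom.hom.app _).hom.baseChange K (universalPoint ρ) =
      (pull (linYoneda k G ⋙ (invariantsPiOne ρ').hom.functor)
        (τ.hom.app (SingleObj.star _))).baseChange K (universalPoint ρ') := by
  refine (comparisonEquiv ρ' _).injective ?_
  refine Eq.trans ?_ (comparisonEquiv_map_universalPoint ρ' (X := freeRep k (basePt ρ.obj))
    (freeRepBasis _)).symm
  rw [comparisonEquiv_app, comparisonEquiv_universalPoint, LinearMap.baseChange_tmul]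
  refine congr_arg (fun v => (1 : K) ⊗ₜ[k] v) ?_
  refine (freeRep_map_basis _ _).trans ?_
  exact congr_arg freeRepBasis (Category.id_comp _)

end UniversalPoint

/-! ### Equivalences of categories -/

section Equivalences

open ComonObj Opposite

variable (k : Type u) [Field k] (G : Type u) [Groupoid.{u} G] (K : Type u) [Field K] [Algebra k K]
  [IsGalois k K]

instance : (contHomToPiOne k G K).Faithful where
  map_injective {ρ ρ'} τ τ' h := by
    have h1 : invariantsPiOneMap τ = invariantsPiOneMap τ' := h
    have h2 := invariantsPiOneMap_universalPoint τ
    rw [h1, invariantsPiOneMap_universalPoint] at h2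
    have h3 := (isTorsor_fibreComon (invariantsPiOne ρ')).pull_injective
      (isPointOver_universalPoint ρ').isPoint h2
    exact ObjectProperty.hom_ext _ (NatTrans.ext (funext fun _ => h3.symm))

/-- A morphism sends the universal point to a translate of the universal point, by an arrow that is
a natural transformation inducing the given morphism. -/
instance : (contHomToPiOne k G K).Full where
  map_surjective {ρ ρ'} (ξ : invariantsPiOne ρ ⟶ invariantsPiOne ρ') := by
    let hy := isTorsor_fibreComon (invariantsPiOne ρ')
    have hx := isPointOver_universalPoint ρ
    have hx' := isPointOver_universalPoint ρ'
    have := isComonHom_whiskerLeft_linYoneda ξ.hom.hom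
    let f : linYoneda k G ⋙ (invariantsPiOne ρ).hom.functor ⟶
      linYoneda k G ⋙ (invariantsPiOne ρ').hom.functor :=
        Functor.whiskerLeft (linYoneda k G) ξ.hom.hom
    have hz := hx.app f
    obtain ⟨g, hg⟩ := hy.exists_eq_pull hx'.isPoint hz.isPoint
    have hgρ := hy.map_comp_eq hx' g (by rw [← hg]; exact hz)
    let τ : ρ ⟶ ρ' := ObjectProperty.homMk
      { app := fun _ => g
        naturality := fun _ _ γ => hgρ γ }
    refine ⟨τ, Com2AlgHom.hom_ext (Com2RingHom.hom_ext
      (IsPoint.natTrans_ext (x := universalPoint ρ) hx.isPoint ?_))⟩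
    exact (invariantsPiOneMap_universalPoint τ).trans hg.symm

/-- The torsor of a morphism of algebras has a point over some `ρ`, which is matched with the
universal point of `ρ`. -/
instance [IsSepClosed K] : (contHomToPiOne k G K).EssSurj where
  mem_essImage h := by
    obtain ⟨ρ, x, hx⟩ := (isTorsor_fibreComon h).exists_isPointOver (K := K)
    have hu := isPointOver_universalPoint ρ
    obtain ⟨ξ, hξ⟩ := hu.exists_piOneHom hx
    obtain ⟨ξ', hξ'⟩ := hx.exists_piOneHom hu
    refine ⟨ρ, ⟨{ hom := ξ, inv := ξ', hom_inv_id := ?_, inv_hom_id := ?_ }⟩⟩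
    · refine Com2AlgHom.hom_ext (Com2RingHom.hom_ext
        (IsPoint.natTrans_ext (x := universalPoint ρ) hu.isPoint ?_))
      refine (hom_comp_baseChange _ _ _).trans (Eq.trans ?_
        (LinearMap.congr_fun LinearMap.baseChange_id _).symm)
      exact (congr_arg _ hξ).trans hξ'
    · refine Com2AlgHom.hom_ext (Com2RingHom.hom_ext
        (IsPoint.natTrans_ext (h := h) (x := x) hx.isPoint ?_))
      refine (hom_comp_baseChange _ _ _).trans (Eq.trans ?_
        (LinearMap.congr_fun LinearMap.baseChange_id _).symm)
      exact (congr_arg _ hξ').trans hξ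

instance [IsSepClosed K] : (contHomToPiOne k G K).IsEquivalence where

instance : (fibreTors k G).Faithful where
  map_injective {h h'} ξ ξ' e := by
    obtain ⟨ρ, x, hx⟩ := (isTorsor_fibreComon h).exists_isPointOver (K := SeparableClosure k)
    have e' : Functor.whiskerLeft (linYoneda k G) ξ.hom.hom =
        Functor.whiskerLeft (linYoneda k G) ξ'.hom.hom :=
      congr_arg (fun f => f.hom.hom.hom) e
    refine Com2AlgHom.hom_ext (Com2RingHom.hom_ext
      (IsPoint.natTrans_ext (h := h) (x := x) hx.isPoint ?_))
    exact congr_arg (fun f => (f.app (op _)).hom.baseChange _ x) e'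

instance : (fibreTors k G).Full where
  map_surjective {h h'} f := by
    obtain ⟨ρ, x, hx⟩ := (isTorsor_fibreComon h).exists_isPointOver (K := SeparableClosure k)
    let φ : linYoneda k G ⋙ h.hom.functor ⟶ linYoneda k G ⋙ h'.hom.functor := f.hom.hom.hom
    have : IsComonHom φ := f.hom.hom.isComonHom_hom
    obtain ⟨ξ, hξ⟩ := hx.exists_piOneHom (hx.app φ)
    refine ⟨ξ, ObjectProperty.hom_ext _ (CommComon.hom_ext _ _ ?_)⟩
    exact (isTorsor_fibreComon h).hom_ext hx.isPoint hξ

instance : (fibreTors k G).EssSurj where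
  mem_essImage y := by
    obtain ⟨ρ, x, hx⟩ := y.property.exists_isPointOver (K := SeparableClosure k)
    have hu := isPointOver_universalPoint ρ
    let y' := (fibreTors k G).obj (invariantsPiOne ρ)
    obtain ⟨f, hfc, hf⟩ := y'.property.exists_app_eq hu hx
    obtain ⟨f', hfc', hf'⟩ := y.property.exists_app_eq (y' := y'.obj) hx hu
    refine ⟨invariantsPiOne ρ, ⟨{
      hom := ObjectProperty.homMk (InducedCategory.homMk { hom := f, isComonHom_hom := hfc })
      inv := ObjectProperty.homMk (InducedCategory.homMk { hom := f', isComonHom_hom := hfc' })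
      hom_inv_id := ?_
      inv_hom_id := ?_ }⟩⟩
    · refine ObjectProperty.hom_ext _ (CommComon.hom_ext _ _ (y'.property.hom_ext hu.isPoint ?_))
      refine (hom_comp_baseChange _ _ _).trans (Eq.trans ?_
        (LinearMap.congr_fun LinearMap.baseChange_id _).symm)
      exact (congr_arg _ hf).trans hf'
    · refine ObjectProperty.hom_ext _ (CommComon.hom_ext _ _ (y.property.hom_ext hx.isPoint ?_))
      refine (hom_comp_baseChange _ _ _).trans (Eq.trans ?_
        (LinearMap.congr_fun LinearMap.baseChange_id _).symm)
      exact (congr_arg _ hf').trans hf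

instance : (fibreTors k G).IsEquivalence where

/-- The category of torsors is equivalent to the category of continuous functors from the Galois
group. -/
def torsEquivalence :
    Tors G (ModuleCat.{u} k) ≌ ContHom Gal(SeparableClosure k/k) G :=
  (contHomToPiOne k G (SeparableClosure k) ⋙ fibreTors k G).asEquivalence.symm

instance (Γ : Type u) [Group Γ] [TopologicalSpace Γ] : IsGroupoid (ContHom Γ G) where
  all_isIso {ρ ρ'} τ := by
    have : IsIso τ.hom := NatIso.isIso_of_isIso_app _
    exact ⟨ObjectProperty.homMk (inv τ.hom), ObjectProperty.hom_ext _ (IsIso.hom_inv_id τ.hom),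
      ObjectProperty.hom_ext _ (IsIso.inv_hom_id τ.hom)⟩

theorem isGroupoid_tors : IsGroupoid (Tors G (ModuleCat.{u} k)) where
  all_isIso f := isIso_of_reflects_iso f (torsEquivalence k G).functor

end Equivalences

/-! ### Pseudonaturality -/

section Representability

variable (k : Type u) [Field k] (K : Type u) [Field K] [Algebra k K] [IsGalois k K]

/-- The functors `contHomToPiOne` are compatible with composition of functors of groupoids. -/
def contHomToPiOneMapIso {G H : Type u} [Groupoid.{u} G] [Groupoid.{u} H] (F : G ⥤ H) :
    contHomMap Gal(K/k) F ⋙ contHomToPiOne k H K ≅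
      contHomToPiOne k G K ⋙ piOneMap (ModuleCat.{u} k) F :=
  NatIso.ofComponents (fun ρ => Com2AlgHom.isoMk
    (h := (contHomToPiOne k H K).obj ((contHomMap Gal(K/k) F).obj ρ))
    (h' := (piOneMap (ModuleCat.{u} k) F).obj ((contHomToPiOne k G K).obj ρ))
    (Com2RingHom.isoMk (NatIso.ofComponents (fun X => Iso.refl _) fun f => by
        exact (Category.comp_id _).trans (Category.id_comp _).symm)
      { unit := by
          refine (Category.comp_id _).trans ?_
          exact ((congr_arg (Functor.LaxMonoidal.ε (invariants ρ.obj) ≫ ·)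
            ((invariants ρ.obj).map_id _)).trans (Category.comp_id _)).symm
        tensor X Y := by
          refine (Category.comp_id _).trans ?_
          refine Eq.trans ?_ ((congr_arg (· ≫ _)
            (id_tensorHom_id ((invariants ρ.obj).obj (F ⋙ X))
              ((invariants ρ.obj).obj (F ⋙ Y)))).trans (Category.id_comp _)).symm
          exact ((congr_arg (Functor.LaxMonoidal.μ (invariants ρ.obj) (F ⋙ X) (F ⋙ Y) ≫ ·)
            ((invariants ρ.obj).map_id _)).trans (Category.comp_id _)).symm })
    (by
      ext1
      ext1
      funext V
      refine (Category.comp_id _).trans ?_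
      refine Eq.trans ?_ (Com2AlgHom.comp_unit_hom_app (precomp (ModuleCat.{u} k) F)
        (invariantsPiOne ρ) V).symm
      exact ((congr_arg ((constInvariantsIso ρ.obj V).hom ≫ ·)
            ((invariants ρ.obj).map_id _)).trans (Category.comp_id _)).symm))
    (fun {ρ ρ'} τ => by
      ext1
      ext1
      ext1
      funext X
      exact (Category.comp_id _).trans (Category.id_comp _).symm)

/-- The pseudonatural transformation `Hom(Γ, -) → π₁` given by the functors `contHomToPiOne`. -/
def contHomToPiOneTrans :
    Pseudofunctor.StrongTrans (contHom Gal(K/k)) (piOne (ModuleCat.{u} k)) where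
  app G := (AsSmall.down.{u, u, u + 1} ⋙ contHomToPiOne k G.Obj K).toCatHom
  naturality {G H} F := Cat.Hom.isoMk
    (Functor.isoWhiskerLeft AsSmall.down.{u, u, u + 1}
      (contHomToPiOneMapIso k K (G := G.Obj) (H := H.Obj) F.hom.toFunctor))
  naturality_naturality α := piOne_hom₂_ext fun ρ X => by
    refine (Category.comp_id _).trans ((Eq.symm (Category.id_comp _)).trans ?_)
    rfl
  naturality_id G := piOne_hom₂_ext fun ρ X => by
    have h := congr_arg (fun ξ => ξ.hom.hom.app X)
      ((contHomToPiOne k G.Obj K).map_id (AsSmall.down.{u, u, u + 1}.obj ρ))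
    refine (Category.comp_id _).trans (Eq.symm ?_)
    exact (congr_arg (· ≫ _) h).trans ((Category.id_comp _).trans (Category.comp_id _))
  naturality_comp {G H I} F F' := piOne_hom₂_ext fun ρ X => by
    have h := congr_arg (fun ξ => ξ.hom.hom.app X) ((contHomToPiOne k I.Obj K).map_id
      ((contHomMap _ F'.hom.toFunctor).obj
        ((contHomMap _ F.hom.toFunctor).obj (AsSmall.down.{u, u, u + 1}.obj ρ))))
    refine (Category.comp_id _).trans (Eq.symm ?_)
    refine (congr_arg (· ≫ _) h).trans ((Category.id_comp _).trans ?_)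
    refine (Category.id_comp _).trans ((Category.id_comp _).trans ?_)
    exact (Category.id_comp _).trans (Category.comp_id _)

end Representability

end TwoRing

theorem mainTheorem3 (k : Type u) [Field k] :
    (∃ η : Pseudofunctor.StrongTrans (TwoRing.contHom Gal(SeparableClosure k/k))
        (TwoRing.piOne (ModuleCat.{u} k)),
      ∀ G : TwoRing.Gpd.{u}, (η.app G).toFunctor.IsEquivalence) ∧
    ∀ (G : Type u) [Groupoid.{u} G],
      IsGroupoid (TwoRing.Tors G (ModuleCat.{u} k)) ∧
      Nonempty (TwoRing.Tors G (ModuleCat.{u} k) ≌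
        TwoRing.ContHom Gal(SeparableClosure k/k) G) := by
  refine ⟨⟨TwoRing.contHomToPiOneTrans k (SeparableClosure k), fun G => ?_⟩, fun G _ =>
    ⟨TwoRing.isGroupoid_tors k G, ⟨TwoRing.torsEquivalence k G⟩⟩⟩
  have : (AsSmall.down : AsSmall.{u + 1} (TwoRing.ContHom Gal(SeparableClosure k/k) G.Obj) ⥤
    _).IsEquivalence := inferInstanceAs AsSmall.equiv.inverse.IsEquivalence
  exact inferInstanceAs (AsSmall.down.{u, u, u + 1} ⋙
    TwoRing.contHomToPiOne k G.Obj (SeparableClosure k)).IsEquivalence
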